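/- Let $\mathbb{D}$ be the open unit disk. For $f:\mathbb D\to\mathbb C$ with $f_z,f_{\bar z}$ its Wirtinger derivatives put $J_f=|f_z|^2-|f_{\bar z}|^2$ and $\Lambda_f=|f_z|+|f_{\bar z}|$. Let $\mathcal{S}_H$ be the class of univalent (injective) harmonic mappings $f=h+\overline{g}$ of $\mathbb{D}$ with $J_f>0$ in $\mathbb D$, where $h,g$ are analytic in $\mathbb{D}$ and $h(0)=g(0)=h'(0)-1=0$. For $K\ge 1$ let $\mathcal{S}_H(K)$ be the class of those $f\in\mathcal{S}_H$ that are $K$-quasiregular in $\mathbb{D}$, i.e. $f$ is absolutely continuous on lines with locally square integrable partial derivatives, $J_f\ge 0$ a.e. and $\Lambda_f^2\le K J_f$ a.e.; thus $\mathcal S_H(1)$ is the classical class $\mathcal S$ of normalized analytic univalent functions. For $0<p<\infty$ and $0<r<1$ let $$M_p(r,f)=\left(\frac1{2\pi}\int_0^{2\pi}|f(re^{i\theta})|^p\,d\theta\right)^{1/p}.$$ Let $$\gamma=\sup_{f\in\mathcal{S}_H}\frac{|f_{zz}(0)|}{2},\qquad \gamma_1=\sup_{f\in\mathcal{S}_H(1)}\frac{|f_{zz}(0)|}{2}.$$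 Then $\gamma$ is finite, and for every $K\ge 1$: (a) for every $f\in\mathcal{S}_H(K)$ and every $p\in(1/\gamma,\infty)$, $$M_p(r,f)=O\left(\frac{1}{(1-r)^{\gamma-1/p}}\right)\quad\text{as } r\to1^-;$$ (b) there is a constant $C$, depending only on $K$, such that for every $f=h+\overline g\in\mathcal{S}_H(K)$ with $h(z)=z+\sum_{n\ge2}a_nz^n$ one has $|a_n|\le C\,n^{\gamma-1}$ for all $n\ge 2$. For $K=1$ the estimate holds with $\gamma_1$ in place of $\gamma$, and the exponent $\gamma_1-1$ is sharp: there is a constant $C$ with $|a_n|\le C\,n^{\gamma_1-1}$ for all $f\in\mathcal{S}_H(1)$ and $n\ge2$, and there is an $f\in\mathcal{S}_H(1)$ such that for no $\alpha<\gamma_1-1$ and no constant $C$ one has $|a_n|\le C\,n^{\alpha}$ for all $n\ge 2$. -/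

import Mathlib

open Set Filter Topology MeasureTheory Asymptotics
open scoped ComplexConjugate

noncomputable section

namespace HarmonicQR

/-- The open unit disk. -/
def unitDisk : Set ℂ := Metric.ball (0 : ℂ) 1

/-- The partial derivative `∂f/∂x`. -/
def partialX (f : ℂ → ℂ) (z : ℂ) : ℂ := lineDeriv ℝ f z 1

/-- The partial derivative `∂f/∂y`. -/
def partialY (f : ℂ → ℂ) (z : ℂ) : ℂ := lineDeriv ℝ f z Complex.I

/-- `f_z = (f_x - i f_y) / 2`. -/
def dz (f : ℂ → ℂ) (z : ℂ) : ℂ := (partialX f z - Complex.I * partialY f z) / 2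

/-- `f_{\bar z} = (f_x + i f_y) / 2`. -/
def dzbar (f : ℂ → ℂ) (z : ℂ) : ℂ := (partialX f z + Complex.I * partialY f z) / 2

/-- The Jacobian `J_f = |f_z|² - |f_{\bar z}|²`. -/
def jacobian (f : ℂ → ℂ) (z : ℂ) : ℝ := ‖dz f z‖ ^ 2 - ‖dzbar f z‖ ^ 2

/-- `Λ_f = |f_z| + |f_{\bar z}|`, the maximum of the moduli of the directional derivatives. -/
def bigLambda (f : ℂ → ℂ) (z : ℂ) : ℝ := ‖dz f z‖ + ‖dzbar f z‖

/-- `f` is absolutely continuous on lines in `Ω`: on every closed rectangle in `Ω` with sides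
parallel to the axes, it is absolutely continuous on almost every horizontal and almost every
vertical segment. -/
def IsACL (f : ℂ → ℂ) (Ω : Set ℂ) : Prop :=
  ∀ a b c d : ℝ, a ≤ b → c ≤ d → Icc a b ×ℂ Icc c d ⊆ Ω →
    (∀ᵐ y : ℝ, y ∈ Icc c d →
      AbsolutelyContinuousOnInterval (fun x : ℝ => f ⟨x, y⟩) a b) ∧
    (∀ᵐ x : ℝ, x ∈ Icc a b →
      AbsolutelyContinuousOnInterval (fun y : ℝ => f ⟨x, y⟩) c d)

/-- `f` is ACL in `Ω` and its partial derivatives are locally square integrable in `Ω`. -/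
def IsACL2 (f : ℂ → ℂ) (Ω : Set ℂ) : Prop :=
  IsACL f Ω ∧ ∀ Q : Set ℂ, Q ⊆ Ω → IsCompact Q →
    MemLp (partialX f) 2 (volume.restrict Q) ∧ MemLp (partialY f) 2 (volume.restrict Q)

/-- `(K, K')`-quasiregular mappings in `Ω`. -/
def IsQuasiregular (K K' : ℝ) (f : ℂ → ℂ) (Ω : Set ℂ) : Prop :=
  IsACL2 f Ω ∧ (∀ᵐ z : ℂ, z ∈ Ω → 0 ≤ jacobian f z) ∧
    ∀ᵐ z : ℂ, z ∈ Ω → bigLambda f z ^ 2 ≤ K * jacobian f z + K'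

/-- `f = h + \bar g` in the unit disk with `h`, `g` analytic there and
`h(0) = g(0) = h'(0) - 1 = 0`. Every such `f` is harmonic. -/
structure IsNormalizedDecomp (f h g : ℂ → ℂ) : Prop where
  analytic_h : DifferentiableOn ℂ h unitDisk
  analytic_g : DifferentiableOn ℂ g unitDisk
  eq_add_conj : ∀ z ∈ unitDisk, f z = h z + conj (g z)
  h_zero : h 0 = 0
  g_zero : g 0 = 0
  deriv_h_zero : deriv h 0 = 1

/-- The class `S_H` of normalized sense-preserving harmonic univalent mappings of the disk.
Only the values in the disk matter. -/
def SH : Set (ℂ → ℂ) :=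
  {f | (∃ h g : ℂ → ℂ, IsNormalizedDecomp f h g) ∧ InjOn f unitDisk ∧
    ∀ z ∈ unitDisk, 0 < jacobian f z}

/-- The class `S_H(K)` of `K`-quasiregular members of `S_H`. -/
def SHK (K : ℝ) : Set (ℂ → ℂ) := {f | f ∈ SH ∧ IsQuasiregular K 0 f unitDisk}

/-- The values `|f_{zz}(0)| / 2` for `f` in a class `S`. -/
def secondCoeffs (S : Set (ℂ → ℂ)) : Set ℝ := (fun f => ‖dz (dz f) 0‖ / 2) '' S

/-- `sup_{f ∈ S} |f_{zz}(0)| / 2`. -/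
def secondCoeffSup (S : Set (ℂ → ℂ)) : ℝ := sSup (secondCoeffs S)

/-- The integral mean `M_p(r, f)`, `0 < p < ∞`. -/
def integralMean (p r : ℝ) (f : ℂ → ℂ) : ℝ :=
  ((1 / (2 * Real.pi)) * ∫ θ in (0 : ℝ)..(2 * Real.pi),
    ‖f (r * Complex.exp (θ * Complex.I))‖ ^ p) ^ (1 / p)

/-- `h(z) = ∑ a_n z^n` in the unit disk. -/
def HasTaylorCoeffs (h : ℂ → ℂ) (a : ℕ → ℂ) : Prop :=
  ∀ z ∈ unitDisk, HasSum (fun n : ℕ => a n * z ^ n) (h z)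

end HarmonicQR

end

/-!
A mapping `f = h + \bar g` of `S_H` is handled through the pair `(h, g)` (`UnivalentPair`). Its
differential is `v ↦ h' v + \overline{g' v}`, so `J_f = |h'|² - |g'|²` and `Λ_f = |h'| + |g'|`, and
`f_{zz}(0) = h''(0)`. Two tools are used throughout: the length–area inequality, in which the length
of the image of a radius or of a circle in a metric `v(|w|) |dw|` is compared through Cauchy's
inequality with the area of the image of an annulus (`energy_le`, `polar_area_le`), and the
identification of the coefficients of `h` with Fourier coefficients of `f` on circles
(`norm_coeff_mul_pow_le`).

*Finiteness of `γ`.* Post-composition with a real-affine map reduces to `g'(0) = 0`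
(`UnivalentPair.affine`). By Schwarz's lemma `|g' / h'| ≤ |z|`, so `f` has bounded distortion on
compact subsets of the disk, close to `1` near the origin. Length–area for radii then shows that `f`
takes a value of bounded size on every circle `|z| = t` with `t ≤ 3/4`
(`UnivalentPair.exists_norm_le_on_sphere`), and length–area for circles that `f` is bounded on
`|z| ≤ 1/4` (`UnivalentPair.norm_le_of_norm_le`). Cauchy's estimate bounds `h''(0)`.

*Growth.* `S_H` is invariant under Koebe transforms, so the bound `|h''(0)| ≤ 2γ` at the origin is a
differential inequality for `log |h'|` at every point. Integrating it gives
`|f(z)| ≤ 2^γ (1 - |z|)^{-γ}` (`UnivalentPair.norm_hmap_le`).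

*Integral means.* Let `I(t)` be the integral of `|f|^p` over the circle of radius `t`. In the bound
`|∂_t |f|^p| ≤ p |f|^{p-1} Λ_f`, Cauchy's inequality together with `Λ_f² ≤ K J_f` and
`1 - t ≤ (A / |f|)^{1/γ}`, where `A = 2^γ`, splits the right-hand side into a part
`β / (1 - t) · |f|^p` and a multiple of `|f|^{p - 1/γ - 2} J_f`. The area integral of the latter is
controlled by univalence and growth and is `O((1 - r)^{-β})` with `β = γp - 1`. The former is
absorbed by considering the maximum of `I(t) (1 - t)^β` (`exists_meanPow_le`). This is the
estimate for `M_p`; the coefficient estimate is the case `p = 1` on the circle of radius `1 - 1/n`,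
which is admissible because `γ ≥ 2`.

*The analytic case.* For `K = 1` the co-analytic part vanishes, and `γ₁ = 2` by Bieberbach's theorem
(`UnivalentPair.norm_deriv_deriv_le_four`) and the Koebe function `∑ n z^n`, which also shows that
the exponent `γ₁ - 1 = 1` is sharp. Bieberbach's theorem is derived from the same area estimate:
with `s = (h(z)/z)^{-1/2}` and `q = s - 2 z s'` one has `|h'|² / |h|³ = |q|² / |z|³`, and the image of
the disk cannot cover more than the area of `{|w| > σ}` in the metric `|w|^{-3/2} |dw|`.
-/

namespace HarmonicQR

/-! ### Harmonic mappings through their analytic and co-analytic parts -/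

/-- The harmonic mapping `h + \bar g`. -/
noncomputable def hmap (h g : ℂ → ℂ) (z : ℂ) : ℂ := h z + conj (g z)

/-- A normalized sense-preserving univalent harmonic mapping `h + \bar g` of the unit disk, given by
its analytic part `h` and its co-analytic part `g`. -/
structure UnivalentPair (h g : ℂ → ℂ) : Prop where
  diff_h : DifferentiableOn ℂ h unitDisk
  diff_g : DifferentiableOn ℂ g unitDisk
  inj : InjOn (hmap h g) unitDisk
  lt : ∀ z ∈ unitDisk, ‖deriv g z‖ < ‖deriv h z‖
  h_zero : h 0 = 0
  g_zero : g 0 = 0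
  deriv_h_zero : deriv h 0 = 1

/-- The Jacobian of `h + \bar g`, which is `|h'|² - |g'|²`. -/
noncomputable def jac (h g : ℂ → ℂ) (z : ℂ) : ℝ := ‖deriv h z‖ ^ 2 - ‖deriv g z‖ ^ 2

lemma isOpen_unitDisk : IsOpen unitDisk := Metric.isOpen_ball

lemma mem_unitDisk {z : ℂ} : z ∈ unitDisk ↔ ‖z‖ < 1 := by simp [unitDisk]

lemma zero_mem_unitDisk : (0 : ℂ) ∈ unitDisk := by simp [mem_unitDisk]

/-- The real-linear map `v ↦ a v + \overline{b v}`. -/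
noncomputable def wirtinger (a b : ℂ) : ℂ →L[ℝ] ℂ :=
  ((ContinuousLinearMap.mul ℝ ℂ) a) +
    (Complex.conjCLE : ℂ →L[ℝ] ℂ).comp ((ContinuousLinearMap.mul ℝ ℂ) b)

@[simp] lemma wirtinger_apply (a b v : ℂ) : wirtinger a b v = a * v + conj (b * v) := by
  simp [wirtinger]

lemma det_wirtinger (a b : ℂ) : (wirtinger a b).det = ‖a‖ ^ 2 - ‖b‖ ^ 2 := by
  have : (wirtinger a b).det = LinearMap.det (wirtinger a b : ℂ →ₗ[ℝ] ℂ) := rfl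
  rw [this, ← LinearMap.det_toMatrix Complex.basisOneI, Matrix.det_fin_two]
  simp [LinearMap.toMatrix_apply, Complex.basisOneI, Complex.sq_norm, Complex.normSq_apply,
    wirtinger]
  ring

lemma norm_wirtinger_apply_le (a b v : ℂ) : ‖wirtinger a b v‖ ≤ (‖a‖ + ‖b‖) * ‖v‖ := by
  rw [wirtinger_apply]
  refine (norm_add_le _ _).trans ?_
  rw [Complex.norm_conj, norm_mul, norm_mul]
  exact (add_mul _ _ _).ge

lemma wirtinger_injective {a b : ℂ} (hab : ‖b‖ < ‖a‖) : Function.Injective (wirtinger a b) := by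
  rw [injective_iff_map_eq_zero]
  intro v hv
  rw [wirtinger_apply, add_eq_zero_iff_eq_neg] at hv
  have h1 := congrArg norm hv
  rw [norm_neg, Complex.norm_conj, norm_mul, norm_mul] at h1
  by_contra hne
  have : 0 < ‖v‖ := norm_pos_iff.mpr hne
  nlinarith

section Smooth

variable {h g : ℂ → ℂ} {z : ℂ}

lemma hasStrictFDerivAt_hmap (dh : DifferentiableOn ℂ h unitDisk)
    (dg : DifferentiableOn ℂ g unitDisk) (hz : z ∈ unitDisk) :
    HasStrictFDerivAt (hmap h g) (wirtinger (deriv h z) (deriv g z)) z := by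
  have H : ∀ {k : ℂ → ℂ}, DifferentiableOn ℂ k unitDisk →
      HasStrictFDerivAt k ((ContinuousLinearMap.mul ℝ ℂ) (deriv k z)) z := by
    intro k dk
    have h1 : HasStrictDerivAt k (deriv k z) z :=
      (dk.analyticAt (isOpen_unitDisk.mem_nhds hz)).hasStrictDerivAt
    have h2 := h1.hasStrictFDerivAt.restrictScalars ℝ
    have h3 : (ContinuousLinearMap.mul ℝ ℂ) (deriv k z) = ContinuousLinearMap.restrictScalars ℝ
        (ContinuousLinearMap.toSpanSingleton ℂ (deriv k z)) := by
      ext; simp [mul_comm]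
    rw [h3]
    exact h2
  exact (H dh).add
    (((Complex.conjCLE : ℂ →L[ℝ] ℂ).hasStrictFDerivAt).comp z (H dg))

lemma hasFDerivAt_hmap (dh : DifferentiableOn ℂ h unitDisk)
    (dg : DifferentiableOn ℂ g unitDisk) (hz : z ∈ unitDisk) :
    HasFDerivAt (hmap h g) (wirtinger (deriv h z) (deriv g z)) z :=
  (hasStrictFDerivAt_hmap dh dg hz).hasFDerivAt

lemma continuousOn_hmap (dh : DifferentiableOn ℂ h unitDisk)
    (dg : DifferentiableOn ℂ g unitDisk) : ContinuousOn (hmap h g) unitDisk :=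
  fun _ hz => (hasFDerivAt_hmap dh dg hz).continuousAt.continuousWithinAt

lemma continuousOn_deriv (dh : DifferentiableOn ℂ h unitDisk) :
    ContinuousOn (deriv h) unitDisk :=
  (dh.deriv isOpen_unitDisk).continuousOn

lemma continuousOn_jac (dh : DifferentiableOn ℂ h unitDisk)
    (dg : DifferentiableOn ℂ g unitDisk) : ContinuousOn (jac h g) unitDisk :=
  ((continuousOn_deriv dh).norm.pow 2).sub ((continuousOn_deriv dg).norm.pow 2)

/-- `h + \bar g` is open where its Jacobian is positive, by the inverse function theorem. -/
lemma map_nhds_hmap (dh : DifferentiableOn ℂ h unitDisk)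
    (dg : DifferentiableOn ℂ g unitDisk) (hz : z ∈ unitDisk)
    (hlt : ‖deriv g z‖ < ‖deriv h z‖) :
    Filter.map (hmap h g) (𝓝 z) = 𝓝 (hmap h g z) := by
  refine (hasStrictFDerivAt_hmap dh dg hz).map_nhds_eq_of_surj ?_
  have h1 := wirtinger_injective hlt
  exact LinearMap.range_eq_top.mpr
    ((LinearMap.injective_iff_surjective (f := (wirtinger (deriv h z) (deriv g z) : ℂ →ₗ[ℝ] ℂ))).mp h1)

variable {f : ℂ → ℂ}

lemma partialX_eq (dh : DifferentiableOn ℂ h unitDisk) (dg : DifferentiableOn ℂ g unitDisk)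
    (hf : ∀ z ∈ unitDisk, f z = h z + conj (g z)) (hz : z ∈ unitDisk) :
    partialX f z = deriv h z + conj (deriv g z) := by
  have he : f =ᶠ[𝓝 z] hmap h g :=
    Filter.eventually_of_mem (isOpen_unitDisk.mem_nhds hz) hf
  rw [partialX, he.lineDeriv_eq, ((hasFDerivAt_hmap dh dg hz).hasLineDerivAt 1).lineDeriv]
  simp

lemma partialY_eq (dh : DifferentiableOn ℂ h unitDisk) (dg : DifferentiableOn ℂ g unitDisk)
    (hf : ∀ z ∈ unitDisk, f z = h z + conj (g z)) (hz : z ∈ unitDisk) :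
    partialY f z = deriv h z * Complex.I + conj (deriv g z * Complex.I) := by
  have he : f =ᶠ[𝓝 z] hmap h g :=
    Filter.eventually_of_mem (isOpen_unitDisk.mem_nhds hz) hf
  rw [partialY, he.lineDeriv_eq, ((hasFDerivAt_hmap dh dg hz).hasLineDerivAt Complex.I).lineDeriv]
  simp

lemma dz_eq (dh : DifferentiableOn ℂ h unitDisk) (dg : DifferentiableOn ℂ g unitDisk)
    (hf : ∀ z ∈ unitDisk, f z = h z + conj (g z)) (hz : z ∈ unitDisk) :
    dz f z = deriv h z := by
  rw [dz, partialX_eq dh dg hf hz, partialY_eq dh dg hf hz]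
  simp only [map_mul, Complex.conj_I]
  linear_combination (-(deriv h z) / 2 + (conj (deriv g z)) / 2) * Complex.I_sq

lemma dzbar_eq (dh : DifferentiableOn ℂ h unitDisk) (dg : DifferentiableOn ℂ g unitDisk)
    (hf : ∀ z ∈ unitDisk, f z = h z + conj (g z)) (hz : z ∈ unitDisk) :
    dzbar f z = conj (deriv g z) := by
  rw [dzbar, partialX_eq dh dg hf hz, partialY_eq dh dg hf hz]
  simp only [map_mul, Complex.conj_I]
  linear_combination ((deriv h z) / 2 - (conj (deriv g z)) / 2) * Complex.I_sq

lemma jacobian_eq (dh : DifferentiableOn ℂ h unitDisk) (dg : DifferentiableOn ℂ g unitDisk)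
    (hf : ∀ z ∈ unitDisk, f z = h z + conj (g z)) (hz : z ∈ unitDisk) :
    jacobian f z = jac h g z := by
  rw [jacobian, dz_eq dh dg hf hz, dzbar_eq dh dg hf hz, Complex.norm_conj, jac]

lemma bigLambda_eq (dh : DifferentiableOn ℂ h unitDisk) (dg : DifferentiableOn ℂ g unitDisk)
    (hf : ∀ z ∈ unitDisk, f z = h z + conj (g z)) (hz : z ∈ unitDisk) :
    bigLambda f z = ‖deriv h z‖ + ‖deriv g z‖ := by
  rw [bigLambda, dz_eq dh dg hf hz, dzbar_eq dh dg hf hz, Complex.norm_conj]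

/-- Since `f_z = h'` is analytic, `f_{zz}` is its complex derivative. -/
lemma dz_dz_zero (dh : DifferentiableOn ℂ h unitDisk) (dg : DifferentiableOn ℂ g unitDisk)
    (hf : ∀ z ∈ unitDisk, f z = h z + conj (g z)) :
    dz (dz f) 0 = deriv (deriv h) 0 := by
  refine dz_eq (g := 0) (dh.deriv isOpen_unitDisk) (differentiableOn_const 0) ?_ zero_mem_unitDisk
  intro z hz
  simp [dz_eq dh dg hf hz]

end Smooth

section Bridge

variable {f h g : ℂ → ℂ}

lemma UnivalentPair.of_mem_SH (hf : f ∈ SH) (hd : IsNormalizedDecomp f h g) :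
    UnivalentPair h g where
  diff_h := hd.analytic_h
  diff_g := hd.analytic_g
  inj := hf.2.1.congr hd.eq_add_conj
  lt := fun z hz => by
    have := hf.2.2 z hz
    rw [jacobian_eq hd.analytic_h hd.analytic_g hd.eq_add_conj hz, jac, sub_pos] at this
    exact lt_of_pow_lt_pow_left₀ 2 (norm_nonneg _) this
  h_zero := hd.h_zero
  g_zero := hd.g_zero
  deriv_h_zero := hd.deriv_h_zero

lemma UnivalentPair.isNormalizedDecomp (hp : UnivalentPair h g) :
    IsNormalizedDecomp (hmap h g) h g :=
  ⟨hp.diff_h, hp.diff_g, fun _ _ => rfl, hp.h_zero, hp.g_zero, hp.deriv_h_zero⟩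

lemma UnivalentPair.jac_pos (hp : UnivalentPair h g) {z : ℂ} (hz : z ∈ unitDisk) :
    0 < jac h g z :=
  sub_pos.mpr (pow_lt_pow_left₀ (hp.lt z hz) (norm_nonneg _) two_ne_zero)

lemma UnivalentPair.mem_SH (hp : UnivalentPair h g) : hmap h g ∈ SH := by
  refine ⟨⟨h, g, hp.isNormalizedDecomp⟩, hp.inj, fun z hz => ?_⟩
  rw [jacobian_eq (f := hmap h g) hp.diff_h hp.diff_g (fun _ _ => rfl) hz]
  exact hp.jac_pos hz

/-- By continuity, the almost everywhere inequality that defines quasiregularity holds at every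
point of the disk. -/
lemma dilatation_le_of_mem_SHK {K : ℝ} (hf : f ∈ SHK K) (hd : IsNormalizedDecomp f h g) :
    ∀ z ∈ unitDisk, (‖deriv h z‖ + ‖deriv g z‖) ^ 2 ≤ K * jac h g z := by
  have hae : ∀ᵐ z : ℂ, z ∈ unitDisk → (‖deriv h z‖ + ‖deriv g z‖) ^ 2 ≤ K * jac h g z := by
    filter_upwards [hf.2.2.2] with z hz hzD
    have := hz hzD
    rwa [bigLambda_eq hd.analytic_h hd.analytic_g hd.eq_add_conj hzD,
      jacobian_eq hd.analytic_h hd.analytic_g hd.eq_add_conj hzD, add_zero] at this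
  by_contra! hcon
  obtain ⟨z, hz, hlt⟩ := hcon
  have hopen : IsOpen (unitDisk ∩
      {z | K * jac h g z - (‖deriv h z‖ + ‖deriv g z‖) ^ 2 ∈ Iio (0 : ℝ)}) := by
    refine ContinuousOn.isOpen_inter_preimage (f := fun z => K * jac h g z -
      (‖deriv h z‖ + ‖deriv g z‖) ^ 2) ?_ isOpen_unitDisk isOpen_Iio
    exact (continuousOn_const.mul (continuousOn_jac hd.analytic_h hd.analytic_g)).sub
      (((continuousOn_deriv hd.analytic_h).norm.add (continuousOn_deriv hd.analytic_g).norm).pow 2)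
  have hpos := hopen.measure_pos volume ⟨z, hz, by simpa using hlt⟩
  refine hpos.ne' (measure_mono_null ?_ (ae_iff.mp hae))
  rintro w ⟨hw, hw2⟩
  simp only [mem_ofPred_eq, mem_Iio, sub_neg] at hw2 ⊢
  exact fun hcon => not_lt.mpr (hcon hw) hw2

end Bridge

/-! ### Iterated integrals of continuous functions -/

section Iterated

variable {F : ℝ → ℝ → ℝ} {a b c d : ℝ}

/-- A function continuous on a strip `[a, b] × ℝ` agrees there with a continuous function on the
plane. -/
lemma exists_continuous_extension_strip (hab : a ≤ b)
    (hF : ContinuousOn (Function.uncurry F) (Icc a b ×ˢ univ)) :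
    ∃ G : ℝ → ℝ → ℝ, Continuous (Function.uncurry G) ∧ ∀ t ∈ Icc a b, G t = F t := by
  refine ⟨fun t => F (projIcc a b hab t), ?_, fun t ht => by simp only [projIcc_of_mem hab ht]⟩
  have : Continuous fun p : ℝ × ℝ => (((projIcc a b hab p.1 : Icc a b) : ℝ), p.2) := by
    fun_prop
  exact hF.comp_continuous this fun p => ⟨(projIcc a b hab p.1).2, mem_univ _⟩

lemma continuousOn_integral_strip (hab : a ≤ b)
    (hF : ContinuousOn (Function.uncurry F) (Icc a b ×ˢ univ)) :
    ContinuousOn (fun t => ∫ θ in c..d, F t θ) (Icc a b) := by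
  obtain ⟨G, hG, hGF⟩ := exists_continuous_extension_strip hab hF
  refine (intervalIntegral.continuous_parametric_intervalIntegral_of_continuous' (μ := volume)
    hG c d |>.continuousOn (s := Icc a b)).congr fun t ht => ?_
  simp only [hGF t ht]

lemma continuousOn_integral_strip' (hab : a ≤ b)
    (hF : ContinuousOn (Function.uncurry F) (Icc a b ×ˢ univ)) :
    Continuous (fun θ => ∫ t in a..b, F t θ) := by
  obtain ⟨G, hG, hGF⟩ := exists_continuous_extension_strip hab hF
  have hG' : Continuous (Function.uncurry fun θ t => G t θ) := hG.comp continuous_swap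
  convert intervalIntegral.continuous_parametric_intervalIntegral_of_continuous' hG'
    (μ := volume) a b using 2 with θ
  refine intervalIntegral.integral_congr fun t ht => ?_
  rw [uIcc_of_le hab] at ht
  simp only [hGF t ht]

lemma integral_swap_strip (hab : a ≤ b) (hcd : c ≤ d)
    (hF : ContinuousOn (Function.uncurry F) (Icc a b ×ˢ univ)) :
    ∫ θ in c..d, ∫ t in a..b, F t θ = ∫ t in a..b, ∫ θ in c..d, F t θ := by
  have hint : Integrable (Function.uncurry F)
      ((volume.restrict (Ioc a b)).prod (volume.restrict (Ioc c d))) := by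
    rw [Measure.prod_restrict]
    have h1 : IntegrableOn (Function.uncurry F) (Icc a b ×ˢ Icc c d) (volume.prod volume) :=
      (hF.mono (prod_mono_right (subset_univ _))).integrableOn_compact
        (isCompact_Icc.prod isCompact_Icc)
    exact h1.mono_set (prod_mono Ioc_subset_Icc_self Ioc_subset_Icc_self)
  simp only [intervalIntegral.integral_of_le hab, intervalIntegral.integral_of_le hcd]
  exact (integral_integral_swap hint).symm

/-- The iterated Bochner integral of a continuous nonnegative function, as a Lebesgue integral. -/
lemma ofReal_iterated_integral (hab : a ≤ b) (hcd : c ≤ d)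
    (hF : ContinuousOn (Function.uncurry F) (Icc a b ×ˢ univ))
    (h0 : ∀ t ∈ Icc a b, ∀ θ, 0 ≤ F t θ) :
    ENNReal.ofReal (∫ t in a..b, ∫ θ in c..d, F t θ) =
      ∫⁻ t in Ioc a b, ∫⁻ θ in Ioc c d, ENNReal.ofReal (F t θ) := by
  have hslice : ∀ t ∈ Icc a b, Continuous (F t) := fun t ht =>
    hF.comp_continuous (f := fun θ => (t, θ)) (by fun_prop) fun θ => ⟨ht, mem_univ _⟩
  rw [intervalIntegral.integral_of_le hab, ofReal_integral_eq_lintegral_ofReal]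
  · refine setLIntegral_congr_fun measurableSet_Ioc fun t ht => ?_
    have ht' := Ioc_subset_Icc_self ht
    rw [intervalIntegral.integral_of_le hcd, ofReal_integral_eq_lintegral_ofReal]
    · exact ((hslice t ht').integrableOn_Icc).mono_set Ioc_subset_Icc_self
    · exact ae_of_all _ fun θ => h0 t ht' θ
  · exact ((continuousOn_integral_strip hab hF).integrableOn_compact isCompact_Icc).mono_set
      Ioc_subset_Icc_self
  · filter_upwards [ae_restrict_mem measurableSet_Ioc] with t ht
    exact intervalIntegral.integral_nonneg hcd fun θ _ => h0 t (Ioc_subset_Icc_self ht) θ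

end Iterated

/-! ### Area estimates in polar coordinates -/

/-- The point with polar coordinates `(t, θ)`. -/
noncomputable def circ (t θ : ℝ) : ℂ := t * Complex.exp (θ * Complex.I)

@[fun_prop] lemma continuous_circ : Continuous (Function.uncurry circ) := by
  unfold circ Function.uncurry; fun_prop

lemma norm_circ (t θ : ℝ) : ‖circ t θ‖ = |t| := by
  simp [circ, Complex.norm_exp_ofReal_mul_I]

lemma circ_periodic (t : ℝ) : Function.Periodic (circ t) (2 * Real.pi) := by
  intro θ
  simp only [circ]
  push_cast
  rw [add_mul, Complex.exp_add, Complex.exp_two_pi_mul_I, mul_one]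

lemma circ_mem_unitDisk {t θ : ℝ} (ht0 : 0 ≤ t) (ht : t < 1) : circ t θ ∈ unitDisk := by
  rw [mem_unitDisk, norm_circ, abs_of_nonneg ht0]; exact ht

lemma exists_circ_eq (z : ℂ) : ∃ θ : ℝ, circ ‖z‖ θ = z :=
  ⟨z.arg, Complex.norm_mul_exp_arg_mul_I z⟩

lemma lintegral_circ {F : ℂ → ENNReal} (hF : Measurable F) :
    ∫⁻ t in Ioi (0 : ℝ), ∫⁻ θ in Ioo (-Real.pi) Real.pi, ENNReal.ofReal t * F (circ t θ) =
      ∫⁻ z, F z := by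
  rw [← Complex.lintegral_comp_polarCoord_symm, polarCoord_target,
    Measure.volume_eq_prod, setLIntegral_prod]
  · refine lintegral_congr fun t => lintegral_congr fun θ => ?_
    rw [Complex.polarCoord_symm_apply, smul_eq_mul, circ, Complex.exp_mul_I]
    push_cast
    rfl
  · refine Measurable.aemeasurable ?_
    simp only [Complex.polarCoord_symm_apply, smul_eq_mul]
    refine (ENNReal.measurable_ofReal.comp measurable_fst).mul (hF.comp ?_)
    exact Continuous.measurable (by fun_prop)

lemma lintegral_circ_swap {F : ℂ → ENNReal} (hF : Measurable F) :
    ∫⁻ θ in Ioo (-Real.pi) Real.pi, ∫⁻ t in Ioi (0 : ℝ), ENNReal.ofReal t * F (circ t θ) =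
      ∫⁻ z, F z := by
  rw [← lintegral_circ hF]
  refine lintegral_lintegral_swap (Measurable.aemeasurable ?_)
  exact (ENNReal.measurable_ofReal.comp measurable_snd).mul
    (hF.comp (continuous_circ.comp continuous_swap).measurable)

lemma lintegral_radial {φ : ℝ → ENNReal} (hφ : Measurable φ) :
    ∫⁻ z : ℂ, φ ‖z‖ =
      ENNReal.ofReal (2 * Real.pi) * ∫⁻ s in Ioi (0 : ℝ), ENNReal.ofReal s * φ s := by
  rw [← lintegral_circ (F := fun z => φ ‖z‖) (hφ.comp measurable_norm),
    ← lintegral_const_mul' _ _ ENNReal.ofReal_ne_top]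
  refine setLIntegral_congr_fun measurableSet_Ioi fun t ht => ?_
  simp only [norm_circ, abs_of_pos (mem_Ioi.mp ht)]
  rw [setLIntegral_const, Real.volume_Ioo, mul_comm]
  congr 2
  ring

section Area

variable {h g : ℂ → ℂ}

/-- Change of variables for an injective map: an integral over the disk with weight `J_f` of a
function of `|f|` is at most the integral of that function over the plane. -/
lemma lintegral_area_le (hp : UnivalentPair h g) {S : Set ℂ} (hS : MeasurableSet S)
    (hSD : S ⊆ unitDisk) {φ : ℝ → ENNReal} (hφ : Measurable φ) :
    ∫⁻ z in S, ENNReal.ofReal (jac h g z) * φ ‖hmap h g z‖ ≤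
      ENNReal.ofReal (2 * Real.pi) * ∫⁻ s in Ioi (0 : ℝ), ENNReal.ofReal s * φ s := by
  have h1 := lintegral_image_eq_lintegral_abs_det_fderiv_mul volume hS
    (fun z hz => (hasFDerivAt_hmap hp.diff_h hp.diff_g (hSD hz)).hasFDerivWithinAt)
    (hp.inj.mono hSD) (fun w => φ ‖w‖)
  rw [← lintegral_radial hφ]
  refine le_trans (le_of_eq ?_) ((h1.symm.le).trans (setLIntegral_le_lintegral _ _))
  refine setLIntegral_congr_fun hS fun z hz => ?_
  simp only [det_wirtinger]
  have := hp.jac_pos (hSD hz)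
  rw [jac] at this ⊢
  rw [abs_of_pos this]

lemma measurable_area_integrand (hp : UnivalentPair h g) {S : Set ℂ} (hS : MeasurableSet S)
    (hSD : S ⊆ unitDisk) {φ : ℝ → ENNReal} (hφ : Measurable φ) :
    Measurable (S.indicator fun z => ENNReal.ofReal (jac h g z) * φ ‖hmap h g z‖) := by
  classical
  have e : S.indicator (fun z => ENNReal.ofReal (jac h g z) * φ ‖hmap h g z‖) =
      S.indicator (fun z => ENNReal.ofReal (S.piecewise (jac h g) 0 z) *
        φ ‖S.piecewise (hmap h g) 0 z‖) := by
    refine indicator_congr fun z hz => ?_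
    rw [piecewise_eq_of_mem _ _ _ hz, piecewise_eq_of_mem _ _ _ hz]
  rw [e]
  refine Measurable.indicator ?_ hS
  refine (ENNReal.measurable_ofReal.comp ?_).mul (hφ.comp (Measurable.norm ?_))
  · exact ContinuousOn.measurable_piecewise ((continuousOn_jac hp.diff_h hp.diff_g).mono hSD)
      continuousOn_const hS
  · exact ContinuousOn.measurable_piecewise ((continuousOn_hmap hp.diff_h hp.diff_g).mono hSD)
      continuousOn_const hS

/-- The area estimate in polar coordinates, with the integral over the rays on the outside. -/
lemma lintegral_polar_area_le (hp : UnivalentPair h g) {S : Set ℂ} (hS : MeasurableSet S)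
    (hSD : S ⊆ unitDisk) {φ : ℝ → ENNReal} (hφ : Measurable φ) :
    ∫⁻ θ in Ioo (-Real.pi) Real.pi, ∫⁻ t in Ioi (0 : ℝ), ENNReal.ofReal t *
      S.indicator (fun z => ENNReal.ofReal (jac h g z) * φ ‖hmap h g z‖) (circ t θ) ≤
      ENNReal.ofReal (2 * Real.pi) * ∫⁻ s in Ioi (0 : ℝ), ENNReal.ofReal s * φ s := by
  rw [lintegral_circ_swap (measurable_area_integrand hp hS hSD hφ), lintegral_indicator hS]
  exact lintegral_area_le hp hS hSD hφ

lemma continuousOn_circ_comp {k : ℂ → ℝ} (hk : ContinuousOn k unitDisk) {a b : ℝ} (ha : 0 ≤ a)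
    (hb : b < 1) :
    ContinuousOn (Function.uncurry fun t θ => k (circ t θ)) (Icc a b ×ˢ univ) := by
  refine hk.comp (continuous_circ.continuousOn) ?_
  rintro ⟨t, θ⟩ ⟨ht, -⟩
  exact circ_mem_unitDisk (ha.trans ht.1) (ht.2.trans_lt hb)

/-- The area estimate on an annulus: if `|f|` takes values in `T` on the annulus `a ≤ |z| ≤ b`, then
the integral of `φ(|f|) J_f` over it is at most `2π ∫_T s φ(s) ds`. -/
lemma polar_area_le (hp : UnivalentPair h g) {a b : ℝ} (ha : 0 < a) (hab : a ≤ b) (hb : b < 1)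
    {T : Set ℝ} (hT : MeasurableSet T) (hfT : ∀ z, a ≤ ‖z‖ → ‖z‖ ≤ b → ‖hmap h g z‖ ∈ T)
    {φ : ℝ → ℝ} (hφ : ContinuousOn φ T) (hφ0 : ∀ s ∈ T, 0 ≤ φ s) {B : ℝ} (hB0 : 0 ≤ B)
    (hB : ∫⁻ s in T ∩ Ioi 0, ENNReal.ofReal (s * φ s) ≤ ENNReal.ofReal B) :
    ∫ t in a..b, ∫ θ in (0 : ℝ)..(2 * Real.pi),
      t * (φ ‖hmap h g (circ t θ)‖ * jac h g (circ t θ)) ≤ 2 * Real.pi * B := by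
  classical
  have hper : ∀ t : ℝ, ∫ θ in (0 : ℝ)..(2 * Real.pi),
      t * (φ ‖hmap h g (circ t θ)‖ * jac h g (circ t θ)) =
      ∫ θ in (-Real.pi)..Real.pi, t * (φ ‖hmap h g (circ t θ)‖ * jac h g (circ t θ)) := by
    intro t
    have hP : Function.Periodic
        (fun θ => t * (φ ‖hmap h g (circ t θ)‖ * jac h g (circ t θ))) (2 * Real.pi) := by
      intro θ
      simp only [circ_periodic t θ]
    have := hP.intervalIntegral_add_eq 0 (-Real.pi)
    rw [zero_add] at this
    rw [this]
    congr 1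
    ring
  simp only [hper]
  have hmem : ∀ t ∈ Icc a b, ∀ θ, a ≤ ‖circ t θ‖ ∧ ‖circ t θ‖ ≤ b := fun t ht θ => by
    rw [norm_circ, abs_of_pos (ha.trans_le ht.1)]; exact ht
  have hcont : ContinuousOn (Function.uncurry fun t θ =>
      t * (φ ‖hmap h g (circ t θ)‖ * jac h g (circ t θ))) (Icc a b ×ˢ univ) := by
    refine continuousOn_fst.mul (ContinuousOn.mul ?_
      (continuousOn_circ_comp (continuousOn_jac hp.diff_h hp.diff_g) ha.le hb))
    refine hφ.comp (continuousOn_circ_comp (continuousOn_hmap hp.diff_h hp.diff_g).norm ha.le hb) ?_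
    rintro ⟨t, θ⟩ ⟨ht, -⟩
    exact hfT _ (hmem t ht θ).1 (hmem t ht θ).2
  have hnn : ∀ t ∈ Icc a b, ∀ θ, 0 ≤ t * (φ ‖hmap h g (circ t θ)‖ * jac h g (circ t θ)) := by
    intro t ht θ
    have hz : circ t θ ∈ unitDisk := circ_mem_unitDisk (ha.le.trans ht.1) (ht.2.trans_lt hb)
    exact mul_nonneg (ha.le.trans ht.1) (mul_nonneg
      (hφ0 _ (hfT _ (hmem t ht θ).1 (hmem t ht θ).2)) (hp.jac_pos hz).le)
  have hpi : -Real.pi ≤ Real.pi := by linarith [Real.pi_pos]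
  rw [← ENNReal.ofReal_le_ofReal_iff (by positivity),
    ofReal_iterated_integral hab hpi hcont hnn]
  set S : Set ℂ := {z | a ≤ ‖z‖ ∧ ‖z‖ ≤ b} with hSdef
  have hS : MeasurableSet S :=
    (measurableSet_le measurable_const measurable_norm).inter
      (measurableSet_le measurable_norm measurable_const)
  have hSD : S ⊆ unitDisk := fun z hz => mem_unitDisk.mpr (hz.2.trans_lt hb)
  set ψ : ℝ → ENNReal := T.indicator fun s => ENNReal.ofReal (T.piecewise φ 0 s) with hψdef
  have hψ : Measurable ψ := by
    refine Measurable.indicator (ENNReal.measurable_ofReal.comp ?_) hT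
    exact ContinuousOn.measurable_piecewise hφ continuousOn_const hT
  calc _ ≤ ∫⁻ t in Ioi (0 : ℝ), ∫⁻ θ in Ioo (-Real.pi) Real.pi, ENNReal.ofReal t *
      S.indicator (fun z => ENNReal.ofReal (jac h g z) * ψ ‖hmap h g z‖) (circ t θ) := by
        refine le_trans (setLIntegral_mono' measurableSet_Ioc fun t ht => ?_)
          (lintegral_mono_set (fun t ht => mem_Ioi.mpr (ha.trans ht.1)))
        rw [setLIntegral_congr Ioo_ae_eq_Ioc.symm]
        refine le_of_eq (lintegral_congr fun θ => ?_)
        have ht' := Ioc_subset_Icc_self ht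
        have hzS : circ t θ ∈ S := hmem t ht' θ
        have hzT := hfT _ (hmem t ht' θ).1 (hmem t ht' θ).2
        rw [indicator_of_mem hzS, hψdef, indicator_of_mem hzT, piecewise_eq_of_mem _ _ _ hzT,
          ENNReal.ofReal_mul (ha.le.trans ht'.1), mul_comm (φ _),
          ENNReal.ofReal_mul (hp.jac_pos (hSD hzS)).le]
    _ = ∫⁻ z in S, ENNReal.ofReal (jac h g z) * ψ ‖hmap h g z‖ := by
        rw [lintegral_circ (measurable_area_integrand hp hS hSD hψ), lintegral_indicator hS]
    _ ≤ _ := lintegral_area_le hp hS hSD hψ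
    _ ≤ ENNReal.ofReal (2 * Real.pi) * ENNReal.ofReal B := by
        refine mul_le_mul_right (le_trans (le_of_eq ?_) hB) _
        rw [← setLIntegral_indicator hT fun s => ENNReal.ofReal (s * φ s)]
        refine setLIntegral_congr_fun measurableSet_Ioi fun s hs => ?_
        by_cases hsT : s ∈ T
        · simp only [hψdef, indicator_of_mem hsT, piecewise_eq_of_mem _ _ _ hsT]
          rw [ENNReal.ofReal_mul (le_of_lt hs)]
        · simp only [hψdef, indicator_of_notMem hsT, mul_zero]
    _ = _ := (ENNReal.ofReal_mul (by positivity)).symm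

end Area

/-! ### Boundary values on circles -/

section Topology

variable {h g : ℂ → ℂ}

lemma UnivalentPair.isOpen_image (hp : UnivalentPair h g) {U : Set ℂ} (hU : IsOpen U)
    (hUD : U ⊆ unitDisk) : IsOpen (hmap h g '' U) := by
  rw [isOpen_iff_mem_nhds]
  rintro _ ⟨z, hz, rfl⟩
  rw [← map_nhds_hmap hp.diff_h hp.diff_g (hUD hz) (hp.lt z (hUD hz))]
  exact image_mem_map (hU.mem_nhds hz)

lemma UnivalentPair.hmap_zero (hp : UnivalentPair h g) : hmap h g 0 = 0 := by
  simp [hmap, hp.h_zero, hp.g_zero]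

lemma UnivalentPair.hmap_ne_zero (hp : UnivalentPair h g) {z : ℂ} (hz : z ∈ unitDisk)
    (hz0 : z ≠ 0) : hmap h g z ≠ 0 := by
  intro hcon
  rw [← hp.hmap_zero] at hcon
  exact hz0 (hp.inj hz zero_mem_unitDisk hcon)

lemma closedBall_subset_unitDisk {t : ℝ} (ht : t < 1) : Metric.closedBall 0 t ⊆ unitDisk :=
  Metric.closedBall_subset_ball ht

/-- The image of a disk about the origin contains the disk up to its distance from the image of
the boundary circle, since that part of the image is open and closed in it. -/
lemma UnivalentPair.ball_subset_image (hp : UnivalentPair h g) {ρ m : ℝ} (hρ0 : 0 < ρ)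
    (hρ : ρ < 1) (hm : ∀ z, ‖z‖ = ρ → m ≤ ‖hmap h g z‖) :
    Metric.ball 0 m ⊆ hmap h g '' Metric.ball 0 ρ := by
  rcases le_or_gt m 0 with hm0 | hm0
  · rw [Metric.ball_eq_empty.mpr hm0]; exact empty_subset _
  have hsub : Metric.closedBall (0 : ℂ) ρ ⊆ unitDisk := closedBall_subset_unitDisk hρ
  refine IsPreconnected.subset_of_closure_inter_subset (convex_ball 0 m).isPreconnected
    (hp.isOpen_image Metric.isOpen_ball (Metric.ball_subset_closedBall.trans hsub))
    ⟨0, Metric.mem_ball_self hm0, 0, Metric.mem_ball_self hρ0, hp.hmap_zero⟩ ?_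
  have hcl : closure (hmap h g '' Metric.ball 0 ρ) ⊆ hmap h g '' Metric.closedBall 0 ρ := by
    refine closure_minimal (image_mono Metric.ball_subset_closedBall) ?_
    exact ((isCompact_closedBall 0 ρ).image_of_continuousOn
      ((continuousOn_hmap hp.diff_h hp.diff_g).mono hsub)).isClosed
  rintro w ⟨hw1, hw2⟩
  obtain ⟨z, hz, rfl⟩ := hcl hw1
  refine ⟨z, ?_, rfl⟩
  rw [mem_closedBall_zero_iff] at hz
  rw [mem_ball_zero_iff] at hw2 ⊢
  exact lt_of_le_of_ne hz fun he => not_lt.mpr (hm z he) hw2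

/-- A minimum principle: a lower bound for `|f|` on a circle about the origin persists outside that
circle, because the values closer to the origin are already taken inside. -/
lemma UnivalentPair.le_norm_of_le_norm_sphere (hp : UnivalentPair h g) {ρ m : ℝ} (hρ0 : 0 < ρ)
    (hρ : ρ < 1) (hm : ∀ z, ‖z‖ = ρ → m ≤ ‖hmap h g z‖) {z : ℂ} (hz : z ∈ unitDisk)
    (hρz : ρ ≤ ‖z‖) : m ≤ ‖hmap h g z‖ := by
  by_contra! hcon
  obtain ⟨w, hw, hwz⟩ := hp.ball_subset_image hρ0 hρ hm (mem_ball_zero_iff.mpr hcon)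
  have hwD : w ∈ unitDisk :=
    closedBall_subset_unitDisk hρ (Metric.ball_subset_closedBall hw)
  rw [hp.inj hwD hz hwz, mem_ball_zero_iff] at hw
  exact not_lt.mpr hρz hw

/-- A maximum principle for `|f|`, from the openness of `f`. -/
lemma UnivalentPair.exists_norm_ge_on_sphere (hp : UnivalentPair h g) {t : ℝ}
    (ht : t < 1) {z₁ : ℂ} (hz₁ : ‖z₁‖ ≤ t) :
    ∃ z, ‖z‖ = t ∧ ‖hmap h g z₁‖ ≤ ‖hmap h g z‖ := by
  have hsub : Metric.closedBall (0 : ℂ) t ⊆ unitDisk := closedBall_subset_unitDisk ht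
  obtain ⟨z, hz, hmax⟩ := (isCompact_closedBall (0 : ℂ) t).exists_isMaxOn
    ⟨z₁, mem_closedBall_zero_iff.mpr hz₁⟩ ((continuousOn_hmap hp.diff_h hp.diff_g).mono hsub).norm
  refine ⟨z, ?_, hmax (mem_closedBall_zero_iff.mpr hz₁)⟩
  by_contra hne
  have hzt : z ∈ Metric.ball (0 : ℂ) t :=
    mem_ball_zero_iff.mpr (lt_of_le_of_ne (mem_closedBall_zero_iff.mp hz) hne)
  have hin : hmap h g '' Metric.ball 0 t ⊆ Metric.closedBall 0 ‖hmap h g z‖ := by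
    rintro _ ⟨w, hw, rfl⟩
    exact mem_closedBall_zero_iff.mpr (hmax (Metric.ball_subset_closedBall hw))
  have hint := interior_maximal hin
    (hp.isOpen_image Metric.isOpen_ball (Metric.ball_subset_closedBall.trans hsub))
  have := hint (mem_image_of_mem _ hzt)
  rw [interior_closedBall', mem_ball_zero_iff] at this
  exact lt_irrefl _ this

end Topology

/-! ### The length–area method -/

/-- The length of a curve in the conformal metric `v(|w|) |dw|` is at least the increment of any
primitive `V` of `v` along `|w|`. -/
lemma abs_sub_le_integral_of_curve {γ γ' : ℝ → ℂ} {a b : ℝ} (hab : a ≤ b)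
    (hγ : ∀ x ∈ Icc a b, HasDerivAt γ (γ' x) x) (hγ' : ContinuousOn γ' (Icc a b))
    (hne : ∀ x ∈ Icc a b, γ x ≠ 0) {V v : ℝ → ℝ} (hV : ∀ s, 0 < s → HasDerivAt V (v s) s)
    (hv : ContinuousOn v (Ioi 0)) (hv0 : ∀ s, 0 < s → 0 ≤ v s) :
    |V ‖γ b‖ - V ‖γ a‖| ≤ ∫ x in a..b, v ‖γ x‖ * ‖γ' x‖ := by
  have hcγ : ContinuousOn γ (Icc a b) := fun x hx => (hγ x hx).continuousAt.continuousWithinAt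
  have hd : ∀ x ∈ Icc a b, HasDerivAt (fun x => ‖γ x‖) (inner ℝ (γ x) (γ' x) / ‖γ x‖) x := by
    intro x hx
    have h1 := (hγ x hx).norm_sq.sqrt (by have := hne x hx; positivity)
    simp only [Real.sqrt_sq (norm_nonneg _)] at h1
    convert h1 using 1
    exact (mul_div_mul_left _ _ two_ne_zero).symm
  have hvc : ContinuousOn (fun x => v ‖γ x‖) (Icc a b) :=
    hv.comp hcγ.norm fun x hx => mem_Ioi.mpr (norm_pos_iff.mpr (hne x hx))
  have hdc : ContinuousOn (fun x => v ‖γ x‖ * (inner ℝ (γ x) (γ' x) / ‖γ x‖)) (Icc a b) :=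
    hvc.mul ((hcγ.inner hγ').div hcγ.norm fun x hx => norm_ne_zero_iff.mpr (hne x hx))
  have hftc : ∫ x in a..b, v ‖γ x‖ * (inner ℝ (γ x) (γ' x) / ‖γ x‖) = V ‖γ b‖ - V ‖γ a‖ := by
    refine intervalIntegral.integral_eq_sub_of_hasDerivAt (f := fun x => V ‖γ x‖) ?_
      (hdc.intervalIntegrable_of_Icc hab)
    intro x hx
    rw [uIcc_of_le hab] at hx
    exact (hV _ (norm_pos_iff.mpr (hne x hx))).comp x (hd x hx)
  rw [← hftc, ← Real.norm_eq_abs]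
  refine intervalIntegral.norm_integral_le_of_norm_le hab (ae_of_all _ fun x hx => ?_)
    ((hvc.mul hγ'.norm).intervalIntegrable_of_Icc hab)
  have hx' := Ioc_subset_Icc_self hx
  have hpos := norm_pos_iff.mpr (hne x hx')
  rw [norm_mul, Real.norm_of_nonneg (hv0 _ hpos)]
  refine mul_le_mul_of_nonneg_left ?_ (hv0 _ hpos)
  rw [norm_div, norm_norm, div_le_iff₀ hpos, mul_comm]
  exact norm_inner_le_norm _ _

section LengthArea

variable {h g : ℂ → ℂ}

/-- The maximal stretching `|h'| + |g'|` of `h + \bar g`. -/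
noncomputable def stretch (h g : ℂ → ℂ) (z : ℂ) : ℝ := ‖deriv h z‖ + ‖deriv g z‖

lemma stretch_nonneg (z : ℂ) : 0 ≤ stretch h g z := add_nonneg (norm_nonneg _) (norm_nonneg _)

lemma continuousOn_stretch (dh : DifferentiableOn ℂ h unitDisk)
    (dg : DifferentiableOn ℂ g unitDisk) : ContinuousOn (stretch h g) unitDisk :=
  (continuousOn_deriv dh).norm.add (continuousOn_deriv dg).norm

lemma hasDerivAt_circ_left (t θ : ℝ) :
    HasDerivAt (fun t => circ t θ) (Complex.exp (θ * Complex.I)) t := by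
  have := (Complex.ofRealCLM.hasDerivAt (x := t)).mul_const (Complex.exp (θ * Complex.I))
  simpa [circ] using this

lemma hasDerivAt_circ_right (t θ : ℝ) :
    HasDerivAt (fun θ => circ t θ) (circ t θ * Complex.I) θ := by
  have h1 : HasDerivAt (fun θ : ℝ => (θ : ℂ) * Complex.I) Complex.I θ := by
    simpa using (Complex.ofRealCLM.hasDerivAt (x := θ)).mul_const Complex.I
  have := (h1.cexp).const_mul (t : ℂ)
  simpa [circ, mul_assoc] using this

lemma continuousOn_wirtinger_comp (dh : DifferentiableOn ℂ h unitDisk)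
    (dg : DifferentiableOn ℂ g unitDisk) {c w : ℝ → ℂ} {s : Set ℝ} (hc : ContinuousOn c s)
    (hw : ContinuousOn w s) (hs : ∀ x ∈ s, c x ∈ unitDisk) :
    ContinuousOn (fun x => wirtinger (deriv h (c x)) (deriv g (c x)) (w x)) s := by
  simp only [wirtinger_apply]
  exact (((continuousOn_deriv dh).comp hc hs).mul hw).add
    (Complex.continuous_conj.comp_continuousOn (((continuousOn_deriv dg).comp hc hs).mul hw))

variable {V v : ℝ → ℝ}

/-- The image of a radial segment is at least as long, in the metric `v(|w|) |dw|`, as the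
increment of `V` along `|f|`. -/
lemma UnivalentPair.abs_sub_le_integral_radius (hp : UnivalentPair h g) {a b : ℝ} (ha : 0 < a)
    (hab : a ≤ b) (hb : b < 1) (hV : ∀ s, 0 < s → HasDerivAt V (v s) s)
    (hv : ContinuousOn v (Ioi 0)) (hv0 : ∀ s, 0 < s → 0 ≤ v s) (θ : ℝ) :
    |V ‖hmap h g (circ b θ)‖ - V ‖hmap h g (circ a θ)‖| ≤
      ∫ t in a..b, v ‖hmap h g (circ t θ)‖ * stretch h g (circ t θ) := by
  have hD : ∀ t ∈ Icc a b, circ t θ ∈ unitDisk := fun t ht =>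
    circ_mem_unitDisk (ha.le.trans ht.1) (ht.2.trans_lt hb)
  have hne : ∀ t ∈ Icc a b, hmap h g (circ t θ) ≠ 0 := fun t ht => by
    refine hp.hmap_ne_zero (hD t ht) (norm_ne_zero_iff.mp ?_)
    rw [norm_circ]; exact abs_ne_zero.mpr (ha.trans_le ht.1).ne'
  have hcc : Continuous fun t => circ t θ := by
    unfold circ; fun_prop
  have hd : ContinuousOn (fun t => wirtinger (deriv h (circ t θ)) (deriv g (circ t θ))
      (Complex.exp (θ * Complex.I))) (Icc a b) :=
    continuousOn_wirtinger_comp hp.diff_h hp.diff_g hcc.continuousOn continuousOn_const hD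
  have hvc : ContinuousOn (fun t => v ‖hmap h g (circ t θ)‖) (Icc a b) :=
    hv.comp ((continuousOn_hmap hp.diff_h hp.diff_g).comp hcc.continuousOn hD).norm
      fun t ht => norm_pos_iff.mpr (hne t ht)
  refine (abs_sub_le_integral_of_curve hab (γ := fun t => hmap h g (circ t θ))
    (fun t ht => ?_) hd hne hV hv hv0).trans ?_
  · exact (hasFDerivAt_hmap hp.diff_h hp.diff_g (hD t ht)).comp_hasDerivAt t
      (hasDerivAt_circ_left t θ)
  · refine intervalIntegral.integral_mono_on hab ((hvc.mul hd.norm).intervalIntegrable_of_Icc hab)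
      ((hvc.mul ((continuousOn_stretch hp.diff_h hp.diff_g).comp hcc.continuousOn
        hD)).intervalIntegrable_of_Icc hab) fun t ht => ?_
    refine mul_le_mul_of_nonneg_left ?_ (hv0 _ (norm_pos_iff.mpr (hne t ht)))
    refine (norm_wirtinger_apply_le _ _ _).trans (le_of_eq ?_)
    rw [Complex.norm_exp_ofReal_mul_I, mul_one, stretch]

/-- The image of a circle is at least as long, in the metric `v(|w|) |dw|`, as the variation of `V`
between any two of its points. -/
lemma UnivalentPair.abs_sub_le_integral_circle (hp : UnivalentPair h g) {t : ℝ} (ht0 : 0 < t)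
    (ht : t < 1) (hV : ∀ s, 0 < s → HasDerivAt V (v s) s)
    (hv : ContinuousOn v (Ioi 0)) (hv0 : ∀ s, 0 < s → 0 ≤ v s) {z₁ z₂ : ℂ} (hz₁ : ‖z₁‖ = t)
    (hz₂ : ‖z₂‖ = t) :
    |V ‖hmap h g z₂‖ - V ‖hmap h g z₁‖| ≤ ∫ θ in (0 : ℝ)..(2 * Real.pi),
      v ‖hmap h g (circ t θ)‖ * (stretch h g (circ t θ) * t) := by
  have hD : ∀ θ, circ t θ ∈ unitDisk := fun θ => circ_mem_unitDisk ht0.le ht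
  have hne : ∀ θ, hmap h g (circ t θ) ≠ 0 := fun θ => by
    refine hp.hmap_ne_zero (hD θ) (norm_ne_zero_iff.mp ?_)
    rw [norm_circ]; exact abs_ne_zero.mpr ht0.ne'
  have hcc : Continuous fun θ => circ t θ := by
    unfold circ; fun_prop
  have hd : ContinuousOn (fun θ => wirtinger (deriv h (circ t θ)) (deriv g (circ t θ))
      (circ t θ * Complex.I)) univ :=
    continuousOn_wirtinger_comp hp.diff_h hp.diff_g hcc.continuousOn
      (hcc.mul continuous_const).continuousOn fun θ _ => hD θ
  have hvc : Continuous (fun θ => v ‖hmap h g (circ t θ)‖) :=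
    hv.comp_continuous ((continuousOn_hmap hp.diff_h hp.diff_g).comp_continuous hcc hD).norm
      fun θ => norm_pos_iff.mpr (hne θ)
  have hsc : Continuous fun θ => stretch h g (circ t θ) :=
    (continuousOn_stretch hp.diff_h hp.diff_g).comp_continuous hcc hD
  have hang : ∀ z : ℂ, ‖z‖ = t → ∃ θ ∈ Ico (0 : ℝ) (2 * Real.pi), circ t θ = z := by
    intro z hz
    obtain ⟨θ₀, hθ₀⟩ := exists_circ_eq z
    obtain ⟨θ, hθ, he⟩ := (circ_periodic t).exists_mem_Ico₀ (by positivity) θ₀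
    exact ⟨θ, hθ, by rw [← he, ← hz, hθ₀]⟩
  obtain ⟨θ₁, h₁, rfl⟩ := hang z₁ hz₁
  obtain ⟨θ₂, h₂, rfl⟩ := hang z₂ hz₂
  have key : ∀ θ₁ ∈ Ico (0 : ℝ) (2 * Real.pi), ∀ θ₂ ∈ Ico (0 : ℝ) (2 * Real.pi), θ₁ ≤ θ₂ →
      |V ‖hmap h g (circ t θ₂)‖ - V ‖hmap h g (circ t θ₁)‖| ≤ ∫ θ in (0 : ℝ)..(2 * Real.pi),
        v ‖hmap h g (circ t θ)‖ * (stretch h g (circ t θ) * t) := by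
    intro θ₁ h₁ θ₂ h₂ h12
    refine (abs_sub_le_integral_of_curve h12 (γ := fun θ => hmap h g (circ t θ))
      (fun θ _ => (hasFDerivAt_hmap hp.diff_h hp.diff_g (hD θ)).comp_hasDerivAt θ
        (hasDerivAt_circ_right t θ)) (hd.mono (subset_univ _)) (fun θ _ => hne θ)
      hV hv hv0).trans ?_
    have hcont := hvc.mul (hsc.mul (continuous_const (y := t)))
    refine le_trans (intervalIntegral.integral_mono_on h12
      ((hvc.continuousOn.mul (hd.mono (subset_univ _)).norm).intervalIntegrable_of_Icc h12)
      (hcont.intervalIntegrable _ _) fun θ _ => ?_)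
      (intervalIntegral.integral_mono_interval h₁.1 h12 h₂.2.le (ae_of_all _ fun θ => ?_)
        (hcont.intervalIntegrable _ _))
    · refine mul_le_mul_of_nonneg_left ?_ (hv0 _ (norm_pos_iff.mpr (hne θ)))
      refine (norm_wirtinger_apply_le _ _ _).trans (le_of_eq ?_)
      rw [norm_mul, Complex.norm_I, mul_one, norm_circ, abs_of_pos ht0]
      rfl
    · exact mul_nonneg (hv0 _ (norm_pos_iff.mpr (hne θ))) (mul_nonneg (stretch_nonneg _) ht0.le)
  rcases le_total θ₁ θ₂ with h12 | h12
  · exact key θ₁ h₁ θ₂ h₂ h12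
  · rw [abs_sub_comm]
    exact key θ₂ h₂ θ₁ h₁ h12

/-- The area of the image of an annulus in the metric `v(|w|) |dw|`, when `s v(s) ≤ 1`, is
controlled by the increment of a primitive of `v`. -/
lemma UnivalentPair.energy_le (hp : UnivalentPair h g) {a b m l : ℝ} (ha : 0 < a)
    (hab : a ≤ b) (hb : b < 1) (hf : ∀ z, a ≤ ‖z‖ → ‖z‖ ≤ b → m ≤ ‖hmap h g z‖)
    (hV : ∀ s, m ≤ s → HasDerivAt V (v s) s) (hv : ContinuousOn v (Ici m))
    (hv0 : ∀ s, m ≤ s → 0 ≤ v s) (hv1 : ∀ s, m ≤ s → s * v s ≤ 1)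
    (hl : Tendsto V atTop (𝓝 l)) :
    ∫ t in a..b, ∫ θ in (0 : ℝ)..(2 * Real.pi),
      t * (v ‖hmap h g (circ t θ)‖ ^ 2 * jac h g (circ t θ)) ≤ 2 * Real.pi * (l - V m) := by
  have hint : IntegrableOn v (Ioi m) :=
    integrableOn_Ioi_deriv_of_nonneg' (fun s hs => hV s hs) (fun s hs => hv0 s (le_of_lt hs)) hl
  have heq : ∫ s in Ioi m, v s = l - V m :=
    integral_Ioi_of_hasDerivAt_of_nonneg' (fun s hs => hV s hs)
      (fun s hs => hv0 s (le_of_lt hs)) hl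
  have hnn : 0 ≤ᵐ[volume.restrict (Ioi m)] v := by
    filter_upwards [ae_restrict_mem measurableSet_Ioi] with s hs using hv0 s (le_of_lt hs)
  refine polar_area_le hp ha hab hb measurableSet_Ici (T := Ici m) hf (φ := fun s => v s ^ 2)
    (hv.pow 2) (fun s _ => sq_nonneg _) ?_ ?_
  · rw [← heq]; exact integral_nonneg_of_ae hnn
  · rw [← heq, ofReal_integral_eq_lintegral_ofReal hint hnn, setLIntegral_congr Ioi_ae_eq_Ici]
    refine (lintegral_mono_set inter_subset_left).trans
      (setLIntegral_mono' measurableSet_Ici fun s hs => ENNReal.ofReal_le_ofReal ?_)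
    nlinarith [hv0 s hs, hv1 s hs]

end LengthArea

/-! ### Local boundedness of normalized harmonic univalent mappings -/

lemma two_mul_le_add_of_sq_le_mul {x k y : ℝ} (hk : 0 ≤ k) (hy : 0 ≤ y) (h : x ^ 2 ≤ k * y) :
    2 * x ≤ k + y := by
  nlinarith [sq_nonneg (k - y), add_nonneg hk hy]

section Metric

variable {α β s : ℝ}

lemma hasDerivAt_log_sub_log (hα : 0 < s + α) (hβ : 0 < s + β) :
    HasDerivAt (fun s => Real.log (s + α) - Real.log (s + β)) (1 / (s + α) - 1 / (s + β)) s :=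
  (((hasDerivAt_id s).add_const α).log hα.ne').sub (((hasDerivAt_id s).add_const β).log hβ.ne')

lemma continuousOn_one_div_sub {S : Set ℝ} (hα : ∀ s ∈ S, 0 < s + α) (hαβ : α ≤ β) :
    ContinuousOn (fun s => 1 / (s + α) - 1 / (s + β)) S := by
  refine ContinuousOn.sub ?_ ?_ <;>
  refine ContinuousOn.div (by fun_prop) (by fun_prop) fun s hs => ?_
  · exact (hα s hs).ne'
  · linarith [hα s hs]

lemma one_div_sub_nonneg (hα : 0 < s + α) (hαβ : α ≤ β) : 0 ≤ 1 / (s + α) - 1 / (s + β) :=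
  sub_nonneg.mpr (one_div_le_one_div_of_le hα (by linarith))

lemma mul_one_div_sub_le_one (hα : 0 < s + α) (hα0 : 0 ≤ α) (hs : 0 ≤ s) (hαβ : α ≤ β) :
    s * (1 / (s + α) - 1 / (s + β)) ≤ 1 := by
  have h1 : s * (1 / (s + α)) ≤ 1 := by
    rw [mul_one_div, div_le_one hα]; linarith
  have h2 : 0 ≤ s * (1 / (s + β)) := by
    have : 0 < s + β := by linarith
    positivity
  linarith [mul_sub s (1 / (s + α)) (1 / (s + β))]

lemma tendsto_log_sub_log :
    Tendsto (fun s : ℝ => Real.log (s + α) - Real.log (s + β)) atTop (𝓝 0) := by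
  have := (Real.tendsto_log_comp_add_sub_log α).sub (Real.tendsto_log_comp_add_sub_log β)
  simpa using this

end Metric

section Bounded

variable {h g : ℂ → ℂ}

/-- The Schwarz lemma for the dilatation `g' / h'`. -/
lemma UnivalentPair.norm_deriv_g_le (hp : UnivalentPair h g) (hg0 : deriv g 0 = 0) {z : ℂ}
    (hz : z ∈ unitDisk) : ‖deriv g z‖ ≤ ‖z‖ * ‖deriv h z‖ := by
  have hne : ∀ w ∈ unitDisk, 0 < ‖deriv h w‖ := fun w hw => (norm_nonneg _).trans_lt (hp.lt w hw)
  have hd : DifferentiableOn ℂ (fun w => deriv g w / deriv h w) (Metric.ball 0 1) :=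
    (hp.diff_g.deriv isOpen_unitDisk).div (hp.diff_h.deriv isOpen_unitDisk)
      fun w hw => norm_pos_iff.mp (hne w hw)
  have := Complex.norm_le_norm_of_mapsTo_ball hd (fun w hw => ?_) (by simp [hg0])
    (mem_unitDisk.mp hz)
  · rwa [norm_div, div_le_iff₀ (hne z hz)] at this
  · rw [mem_closedBall_zero_iff, norm_div]
    exact div_le_one_of_le₀ (hp.lt w hw).le (norm_nonneg _)

/-- The distortion of `h + \bar g` at `z`, when `g'(0) = 0`. -/
lemma UnivalentPair.stretch_sq_le (hp : UnivalentPair h g) (hg0 : deriv g 0 = 0) {z : ℂ}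
    (hz : z ∈ unitDisk) : (1 - ‖z‖) * stretch h g z ^ 2 ≤ (1 + ‖z‖) * jac h g z := by
  have h1 := hp.norm_deriv_g_le hg0 hz
  have h2 : jac h g z = (‖deriv h z‖ - ‖deriv g z‖) * stretch h g z := by
    rw [jac, stretch]; ring
  have h3 := stretch_nonneg (h := h) (g := g) z
  rw [h2]
  have : 0 ≤ stretch h g z * ((1 + ‖z‖) * (‖deriv h z‖ - ‖deriv g z‖) -
      (1 - ‖z‖) * stretch h g z) := by
    refine mul_nonneg h3 ?_
    rw [stretch]; linarith
  linarith

/-- When `g'(0) = 0`, the mapping is `z + o(z)` at the origin. -/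
lemma UnivalentPair.exists_small_circle (hp : UnivalentPair h g) (hg0 : deriv g 0 = 0) {b : ℝ}
    (hb : 0 < b) : ∃ ε, 0 < ε ∧ ε < b ∧
      ∀ z, ‖z‖ = ε → ε / 2 ≤ ‖hmap h g z‖ ∧ ‖hmap h g z‖ ≤ 2 * ε := by
  have hd := (hasFDerivAt_hmap hp.diff_h hp.diff_g zero_mem_unitDisk).isLittleO
  have h1 := hd.def (c := 1 / 2) (by norm_num)
  simp only [sub_zero, hp.hmap_zero, hp.deriv_h_zero, hg0, wirtinger_apply, one_mul, zero_mul,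
    map_zero, add_zero] at h1
  obtain ⟨r, hr, hrb⟩ := Metric.eventually_nhds_iff_ball.mp h1
  refine ⟨min (r / 2) (b / 2), by positivity, (min_le_right _ _).trans_lt (by linarith),
    fun z hz => ?_⟩
  have hzr : z ∈ Metric.ball (0 : ℂ) r := by
    rw [mem_ball_zero_iff, hz]; exact (min_le_left _ _).trans_lt (by linarith)
  have h2 := hrb z hzr
  have h3 := norm_sub_norm_le (hmap h g z) z
  have h4 := norm_sub_norm_le z (hmap h g z)
  rw [norm_sub_rev] at h4
  rw [hz] at h2 h3 h4
  constructor <;> linarith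

/-- Continuity in polar coordinates of the area density of the image in the metric `v(|w|) |dw|`. -/
lemma continuousOn_density (hp : UnivalentPair h g) {v : ℝ → ℝ} (hv : ContinuousOn v (Ioi 0))
    {a b : ℝ} (ha : 0 < a) (hb : b < 1) :
    ContinuousOn (Function.uncurry fun t θ =>
      t * (v ‖hmap h g (circ t θ)‖ ^ 2 * jac h g (circ t θ))) (Icc a b ×ˢ univ) := by
  have hJ := continuousOn_circ_comp (continuousOn_jac hp.diff_h hp.diff_g) ha.le hb
  have hN := continuousOn_circ_comp (continuousOn_hmap hp.diff_h hp.diff_g).norm ha.le hb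
  refine continuousOn_fst.mul (ContinuousOn.mul ((hv.comp hN ?_).pow 2) hJ)
  rintro ⟨t, θ⟩ ⟨ht, -⟩
  refine norm_pos_iff.mpr (hp.hmap_ne_zero (circ_mem_unitDisk (ha.le.trans ht.1)
    (ht.2.trans_lt hb)) (norm_pos_iff.mp ?_))
  rw [norm_circ]; exact abs_pos.mpr (ha.trans_le ht.1).ne'

/-- A normalized mapping takes a value of bounded size on every circle: otherwise the images of the
radial segments would be too long for the area they span. -/
lemma UnivalentPair.exists_norm_le_on_sphere (hp : UnivalentPair h g) (hg0 : deriv g 0 = 0) {b : ℝ}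
    (hb0 : 0 < b) (hb : b ≤ 3 / 4) : ∃ z, ‖z‖ = b ∧ ‖hmap h g z‖ ≤ Real.exp 14 := by
  by_contra! hcon
  -- `14` makes the final inequality fail, since `28 - 4 log 2 > 22 + 2 log 2`
  set R := Real.exp 14 with hR
  have hRpos : 0 < R := Real.exp_pos _
  have hR1 : 1 ≤ R := Real.one_le_exp (by norm_num)
  have hb1 : b < 1 := by linarith
  obtain ⟨ε, hε0, hεb, hε⟩ := hp.exists_small_circle hg0 hb0
  -- the metric is close to `|dw| / |w|` for `|w| < R` and decays fast enough beyond
  set V : ℝ → ℝ := fun s => Real.log (s + 0) - Real.log (s + R) with hVdef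
  set v : ℝ → ℝ := fun s => 1 / (s + 0) - 1 / (s + R) with hvdef
  have hV : ∀ s, 0 < s → HasDerivAt V (v s) s := fun s hs =>
    hasDerivAt_log_sub_log (by linarith) (by linarith)
  have hvc : ContinuousOn v (Ioi 0) :=
    continuousOn_one_div_sub (fun s hs => by simpa using hs) hRpos.le
  have hv0 : ∀ s, 0 < s → 0 ≤ v s := fun s hs => one_div_sub_nonneg (by linarith) hRpos.le
  have hmono : ∀ x y, 0 < x → x ≤ y → V x ≤ V y := by
    intro x y hx hxy
    have h1 : MonotoneOn V (Ioi 0) := by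
      refine monotoneOn_of_deriv_nonneg (convex_Ioi 0)
        (fun s hs => (hV s hs).continuousAt.continuousWithinAt) ?_ ?_
      · intro s hs; rw [interior_Ioi] at hs
        exact (hV s hs).differentiableAt.differentiableWithinAt
      · intro s hs; rw [interior_Ioi] at hs
        rw [(hV s hs).deriv]; exact hv0 s hs
    exact h1 hx (hx.trans_le hxy) hxy
  have hD : ∀ t ∈ Icc ε b, ∀ θ, circ t θ ∈ unitDisk := fun t ht θ =>
    circ_mem_unitDisk (hε0.le.trans ht.1) (ht.2.trans_lt hb1)
  have hnorm : ∀ t ∈ Icc ε b, ∀ θ, ‖circ t θ‖ = t := fun t ht θ => by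
    rw [norm_circ, abs_of_pos (hε0.trans_le ht.1)]
  set E : ℝ → ℝ → ℝ := fun t θ => t * (v ‖hmap h g (circ t θ)‖ ^ 2 * jac h g (circ t θ)) with hE
  have hEc : ContinuousOn (Function.uncurry E) (Icc ε b ×ˢ univ) :=
    continuousOn_density hp hvc hε0 hb1
  have henergy : ∫ t in ε..b, ∫ θ in (0 : ℝ)..(2 * Real.pi), E t θ ≤
      2 * Real.pi * (0 - V (ε / 2)) := by
    refine hp.energy_le hε0 hεb.le hb1 (m := ε / 2) (fun z hz1 hz2 => ?_)
      (fun s hs => hV s (by linarith)) (hvc.mono fun s hs => ?_)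
      (fun s hs => hv0 s (by linarith))
      (fun s hs => mul_one_div_sub_le_one (by linarith) le_rfl (by linarith) hRpos.le)
      tendsto_log_sub_log
    · exact hp.le_norm_of_le_norm_sphere hε0 (hεb.trans hb1) (fun w hw => (hε w hw).1)
        (mem_unitDisk.mpr (hz2.trans_lt hb1)) hz1
    · exact lt_of_lt_of_le (by positivity) (mem_Ici.mp hs)
  have hkint : IntervalIntegrable (fun t : ℝ => 1 / t + 8) volume ε b := by
    refine ContinuousOn.intervalIntegrable_of_Icc hεb.le (ContinuousOn.add ?_ continuousOn_const)
    exact continuousOn_const.div continuousOn_id fun t ht => (hε0.trans_le ht.1).ne'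
  have hkval : ∫ t in ε..b, (1 / t + 8) ≤ -Real.log ε + 8 := by
    rw [intervalIntegral.integral_add, integral_one_div_of_pos hε0 hb0,
      intervalIntegral.integral_const, Real.log_div hb0.ne' hε0.ne', smul_eq_mul]
    · have := Real.log_nonpos hb0.le hb1.le
      linarith
    · exact ContinuousOn.intervalIntegrable_of_Icc hεb.le
        (continuousOn_const.div continuousOn_id fun t ht => (hε0.trans_le ht.1).ne')
    · exact intervalIntegrable_const
  have hEint : ∀ θ, IntervalIntegrable (fun t => E t θ) volume ε b := fun θ =>
    ContinuousOn.intervalIntegrable_of_Icc hεb.le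
      (hEc.comp (f := fun t => (t, θ)) (by fun_prop) fun t ht => ⟨ht, mem_univ _⟩)
  -- the length of the image of a radius; the weight `1 / t` gives the divergent terms `log ε` the
  -- same coefficient on both sides
  have hray : ∀ θ : ℝ, 2 * (V R - V (2 * ε)) ≤ (-Real.log ε + 8) + ∫ t in ε..b, E t θ := by
    intro θ
    have hl := (le_abs_self _).trans
      (hp.abs_sub_le_integral_radius hε0 hεb.le hb1 hV hvc hv0 θ)
    have h1 : V R ≤ V ‖hmap h g (circ b θ)‖ :=
      hmono _ _ hRpos (hcon _ (hnorm b ⟨hεb.le, le_rfl⟩ θ)).le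
    have h2 : V ‖hmap h g (circ ε θ)‖ ≤ V (2 * ε) := by
      have := hε _ (hnorm ε ⟨le_rfl, hεb.le⟩ θ)
      exact hmono _ _ (lt_of_lt_of_le (by positivity) this.1) this.2
    have h3 : 2 * ∫ t in ε..b, v ‖hmap h g (circ t θ)‖ * stretch h g (circ t θ) ≤
        ∫ t in ε..b, ((1 / t + 8) + E t θ) := by
      rw [← intervalIntegral.integral_const_mul]
      refine intervalIntegral.integral_mono_on hεb.le ?_ (hkint.add (hEint θ)) fun t ht => ?_
      · refine ContinuousOn.intervalIntegrable_of_Icc hεb.le (continuousOn_const.mul ?_)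
        have hcc : ContinuousOn (fun t => circ t θ) (Icc ε b) := by unfold circ; fun_prop
        refine ContinuousOn.mul (hvc.comp ((continuousOn_hmap hp.diff_h hp.diff_g).comp hcc
          fun t ht => hD t ht θ).norm fun t ht => ?_)
          ((continuousOn_stretch hp.diff_h hp.diff_g).comp hcc fun t ht => hD t ht θ)
        refine norm_pos_iff.mpr (hp.hmap_ne_zero (hD t ht θ) (norm_pos_iff.mp ?_))
        rw [hnorm t ht]; exact hε0.trans_le ht.1
      · have ht0 : 0 < t := hε0.trans_le ht.1
        have hJ := (hp.jac_pos (hD t ht θ)).le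
        refine two_mul_le_add_of_sq_le_mul (by positivity) (by rw [hE]; positivity) ?_
        have hs := hp.stretch_sq_le hg0 (hD t ht θ)
        rw [hnorm t ht] at hs
        -- `(1 + t) / (1 - t) ≤ 1 + 8 t` for `t ≤ 3 / 4`
        have hs2 : stretch h g (circ t θ) ^ 2 ≤ (1 + 8 * t) * jac h g (circ t θ) := by
          have ht34 : t ≤ 3 / 4 := ht.2.trans hb
          have h1t : 0 < 1 - t := by linarith
          refine le_of_mul_le_mul_left (hs.trans ?_) h1t
          rw [← mul_assoc]
          refine mul_le_mul_of_nonneg_right ?_ hJ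
          nlinarith
        calc _ = v ‖hmap h g (circ t θ)‖ ^ 2 * stretch h g (circ t θ) ^ 2 := by ring
          _ ≤ v ‖hmap h g (circ t θ)‖ ^ 2 * ((1 + 8 * t) * jac h g (circ t θ)) :=
            mul_le_mul_of_nonneg_left hs2 (sq_nonneg _)
          _ = _ := by rw [hE]; field_simp
    rw [intervalIntegral.integral_add hkint (hEint θ)] at h3
    linarith
  have hmain := intervalIntegral.integral_mono_on (μ := volume) (a := 0) (b := 2 * Real.pi)
    (by positivity) intervalIntegrable_const
    ((continuous_const.add (continuousOn_integral_strip' hεb.le hEc)).intervalIntegrable _ _)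
    (fun θ _ => hray θ)
  simp only [Pi.add_apply] at hmain
  rw [intervalIntegral.integral_const, intervalIntegral.integral_add intervalIntegrable_const
    ((continuousOn_integral_strip' hεb.le hEc).intervalIntegrable _ _),
    intervalIntegral.integral_const, integral_swap_strip hεb.le (by positivity) hEc, smul_eq_mul,
    smul_eq_mul, sub_zero] at hmain
  have hfin : 2 * (V R - V (2 * ε)) ≤ (-Real.log ε + 8) + (0 - V (ε / 2)) := by
    have hpi : (0 : ℝ) < 2 * Real.pi := by positivity
    refine le_of_mul_le_mul_left (hmain.trans ?_) hpi
    linarith [henergy]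
  simp only [hVdef, add_zero] at hfin
  have e1 : Real.log R = 14 := by rw [hR, Real.log_exp]
  have e2 : Real.log (R + R) = Real.log 2 + 14 := by
    rw [← two_mul, Real.log_mul two_ne_zero hRpos.ne', e1]
  have e3 : Real.log (2 * ε) = Real.log 2 + Real.log ε :=
    Real.log_mul two_ne_zero hε0.ne'
  have e4 : Real.log (ε / 2) = Real.log ε - Real.log 2 := Real.log_div hε0.ne' two_ne_zero
  have e5 : 14 ≤ Real.log (2 * ε + R) := by
    rw [← e1]; exact Real.log_le_log hRpos (by linarith)
  have e6 : Real.log (ε / 2 + R) ≤ Real.log 2 + 14 := by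
    rw [← e2]; exact Real.log_le_log (by positivity) (by linarith)
  have := Real.log_two_lt_d9
  linarith

/-- A uniform bound on a smaller disk: the images of the circles `1/4 ≤ |z| ≤ 3/4` join points of
bounded size to points of size `|f(z₁)|`, and they are too long for the area they sweep if
`|f(z₁)|` is large. -/
lemma UnivalentPair.norm_le_of_norm_le (hp : UnivalentPair h g) (hg0 : deriv g 0 = 0) {z₁ : ℂ}
    (hz₁ : ‖z₁‖ ≤ 1 / 4) : ‖hmap h g z₁‖ ≤ Real.exp (20 + 56 * Real.pi ^ 2) := by
  by_contra! hcon
  set M := ‖hmap h g z₁‖ with hM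
  set δ := Real.exp 14 with hδ
  have hδ0 : 0 < δ := Real.exp_pos _
  have hpi := Real.pi_pos
  have hδM : δ ≤ M := le_trans (Real.exp_le_exp.mpr (by nlinarith)) hcon.le
  have hM0 : 0 < M := hδ0.trans_le hδM
  -- the metric is close to `|dw| / |w|` for `δ < |w| < M`
  set V : ℝ → ℝ := fun s => Real.log (s + δ) - Real.log (s + M) with hVdef
  set v : ℝ → ℝ := fun s => 1 / (s + δ) - 1 / (s + M) with hvdef
  have hV : ∀ s, 0 ≤ s → HasDerivAt V (v s) s := fun s hs =>
    hasDerivAt_log_sub_log (by linarith) (by linarith)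
  have hvc : ContinuousOn v (Ici 0) :=
    continuousOn_one_div_sub (fun s hs => add_pos_of_nonneg_of_pos hs hδ0) hδM
  have hvc' := hvc.mono Ioi_subset_Ici_self
  have hv0 : ∀ s, 0 ≤ s → 0 ≤ v s := fun s hs => one_div_sub_nonneg (by linarith) hδM
  have hmono : MonotoneOn V (Ici 0) := by
    refine monotoneOn_of_deriv_nonneg (convex_Ici 0)
      (fun s hs => (hV s hs).continuousAt.continuousWithinAt) ?_ ?_
    · intro s hs; rw [interior_Ici] at hs
      exact (hV s (le_of_lt hs)).differentiableAt.differentiableWithinAt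
    · intro s hs; rw [interior_Ici] at hs
      rw [(hV s (le_of_lt hs)).deriv]; exact hv0 s (le_of_lt hs)
  have hab : (1 / 4 : ℝ) ≤ 3 / 4 := by norm_num
  have ha : (0 : ℝ) < 1 / 4 := by norm_num
  have hb1 : (3 / 4 : ℝ) < 1 := by norm_num
  have hD : ∀ t ∈ Icc (1 / 4 : ℝ) (3 / 4), ∀ θ, circ t θ ∈ unitDisk := fun t ht θ =>
    circ_mem_unitDisk (ha.le.trans ht.1) (ht.2.trans_lt hb1)
  have hnorm : ∀ t ∈ Icc (1 / 4 : ℝ) (3 / 4), ∀ θ, ‖circ t θ‖ = t := fun t ht θ => by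
    rw [norm_circ, abs_of_pos (ha.trans_le ht.1)]
  set E : ℝ → ℝ → ℝ := fun t θ => t * (v ‖hmap h g (circ t θ)‖ ^ 2 * jac h g (circ t θ)) with hE
  have hEc : ContinuousOn (Function.uncurry E) (Icc (1 / 4 : ℝ) (3 / 4) ×ˢ univ) :=
    continuousOn_density hp hvc' ha hb1
  have henergy : ∫ t in (1 / 4 : ℝ)..(3 / 4), ∫ θ in (0 : ℝ)..(2 * Real.pi), E t θ ≤
      2 * Real.pi * (0 - V 0) :=
    hp.energy_le ha hab hb1 (fun z _ _ => norm_nonneg _) hV hvc hv0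
      (fun s hs => mul_one_div_sub_le_one (by linarith) hδ0.le hs hδM) tendsto_log_sub_log
  -- the length of the image of a circle; after integration over `t` the weight `4π` makes the area
  -- term about half of the length term
  have hcircle : ∀ t ∈ Icc (1 / 4 : ℝ) (3 / 4), 2 * (V M - V δ) ≤
      2 * Real.pi * (4 * Real.pi * 7) + (∫ θ in (0 : ℝ)..(2 * Real.pi), E t θ) / (4 * Real.pi) := by
    intro t ht
    have ht0 : 0 < t := ha.trans_le ht.1
    have ht1 : t < 1 := ht.2.trans_lt hb1
    obtain ⟨w₁, hw₁, hw₁δ⟩ := hp.exists_norm_le_on_sphere hg0 ht0 ht.2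
    obtain ⟨w₂, hw₂, hw₂M⟩ := hp.exists_norm_ge_on_sphere ht1 (hz₁.trans ht.1)
    have hl := (le_abs_self _).trans
      (hp.abs_sub_le_integral_circle ht0 ht1 (fun s hs => hV s hs.le) hvc'
        (fun s hs => hv0 s hs.le) hw₁ hw₂)
    have h1 : V M ≤ V ‖hmap h g w₂‖ := hmono hM0.le (norm_nonneg _) hw₂M
    have h2 : V ‖hmap h g w₁‖ ≤ V δ := hmono (norm_nonneg _) hδ0.le hw₁δ
    have hcc : Continuous fun θ => circ t θ := by unfold circ; fun_prop
    have hEcont : Continuous (E t) :=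
      hEc.comp_continuous (f := fun θ => (t, θ)) (by fun_prop) fun θ => ⟨ht, mem_univ _⟩
    have h3 : 2 * ∫ θ in (0 : ℝ)..(2 * Real.pi),
        v ‖hmap h g (circ t θ)‖ * (stretch h g (circ t θ) * t) ≤
        ∫ θ in (0 : ℝ)..(2 * Real.pi), (4 * Real.pi * 7 + E t θ / (4 * Real.pi)) := by
      rw [← intervalIntegral.integral_const_mul]
      refine intervalIntegral.integral_mono_on (by positivity) ?_ ?_ fun θ _ => ?_
      · refine Continuous.intervalIntegrable (continuous_const.mul (Continuous.mul ?_
          (((continuousOn_stretch hp.diff_h hp.diff_g).comp_continuous hcc (hD t ht)).mul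
            continuous_const))) _ _
        exact hvc.comp_continuous ((continuousOn_hmap hp.diff_h hp.diff_g).comp_continuous hcc
          (hD t ht)).norm fun θ => norm_nonneg _
      · exact (continuous_const.add (hEcont.div_const _)).intervalIntegrable _ _
      · have hJ := (hp.jac_pos (hD t ht θ)).le
        refine two_mul_le_add_of_sq_le_mul (by positivity) (by rw [hE]; positivity) ?_
        have hs := hp.stretch_sq_le hg0 (hD t ht θ)
        rw [hnorm t ht] at hs
        have hs2 : stretch h g (circ t θ) ^ 2 ≤ 7 * jac h g (circ t θ) := by
          have h1t : 0 < 1 - t := by linarith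
          refine le_of_mul_le_mul_left (hs.trans ?_) h1t
          rw [← mul_assoc]
          refine mul_le_mul_of_nonneg_right ?_ hJ
          linarith [ht.2]
        calc _ = t * (t * (v ‖hmap h g (circ t θ)‖ ^ 2 * stretch h g (circ t θ) ^ 2)) := by ring
          _ ≤ 1 * (t * (v ‖hmap h g (circ t θ)‖ ^ 2 * (7 * jac h g (circ t θ)))) := by
            gcongr
          _ = _ := by rw [hE]; field_simp
    rw [intervalIntegral.integral_add intervalIntegrable_const
      ((hEcont.div_const _).intervalIntegrable _ _), intervalIntegral.integral_const,
      intervalIntegral.integral_div, smul_eq_mul, sub_zero] at h3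
    linarith
  have hIc : ContinuousOn (fun t => ∫ θ in (0 : ℝ)..(2 * Real.pi), E t θ)
      (Icc (1 / 4 : ℝ) (3 / 4)) := continuousOn_integral_strip hab hEc
  have hIi := (hIc.div_const (4 * Real.pi)).intervalIntegrable_of_Icc (μ := volume) hab
  have hmain := intervalIntegral.integral_mono_on (μ := volume) hab intervalIntegrable_const
    (intervalIntegrable_const.add hIi) hcircle
  rw [intervalIntegral.integral_const, intervalIntegral.integral_add intervalIntegrable_const hIi,
    intervalIntegral.integral_const, intervalIntegral.integral_div, smul_eq_mul,
    smul_eq_mul] at hmain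
  have h5 : (∫ t in (1 / 4 : ℝ)..(3 / 4), ∫ θ in (0 : ℝ)..(2 * Real.pi), E t θ) / (4 * Real.pi) ≤
      (0 - V 0) / 2 := by
    rw [div_le_iff₀ (by positivity)]
    linarith
  have hfin : V M - V δ ≤ 28 * Real.pi ^ 2 + (0 - V 0) / 2 := by nlinarith
  simp only [hVdef, zero_add] at hfin
  have e1 : Real.log δ = 14 := by rw [hδ, Real.log_exp]
  have e2 : Real.log (δ + δ) = Real.log 2 + 14 := by
    rw [← two_mul, Real.log_mul two_ne_zero hδ0.ne', e1]
  have e3 : Real.log (M + M) = Real.log 2 + Real.log M := by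
    rw [← two_mul, Real.log_mul two_ne_zero hM0.ne']
  have e4 : Real.log M ≤ Real.log (M + δ) := Real.log_le_log hM0 (by linarith)
  have e5 : Real.log M ≤ Real.log (δ + M) := Real.log_le_log hM0 (by linarith)
  have e6 : 20 + 56 * Real.pi ^ 2 < Real.log M := (Real.lt_log_iff_exp_lt hM0).mpr hcon
  have := Real.log_two_lt_d9
  linarith

end Bounded

/-! ### Fourier coefficients on circles -/

section Fourier

variable {h g : ℂ → ℂ} {a : ℕ → ℂ}

lemma HasTaylorCoeffs.summable_norm (ha : HasTaylorCoeffs h a) {r : ℝ} (hr0 : 0 ≤ r)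
    (hr : r < 1) : Summable fun n => ‖a n‖ * r ^ n := by
  have h1 := (ha r (mem_unitDisk.mpr (by simpa [abs_of_nonneg hr0] using hr))).summable.norm
  refine h1.congr fun n => ?_
  rw [norm_mul, norm_pow, Complex.norm_real, Real.norm_of_nonneg hr0]

lemma integral_exp_int (m : ℤ) :
    ∫ θ in (0 : ℝ)..(2 * Real.pi), Complex.exp ((m : ℂ) * Complex.I * θ) =
      if m = 0 then 2 * (Real.pi : ℂ) else 0 := by
  split_ifs with hm
  · simp [hm]
  · have hc : (m : ℂ) * Complex.I ≠ 0 := mul_ne_zero (Int.cast_ne_zero.mpr hm) Complex.I_ne_zero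
    rw [integral_exp_mul_complex hc]
    have : (m : ℂ) * Complex.I * ((2 * Real.pi : ℝ) : ℂ) = m * (2 * Real.pi * Complex.I) := by
      push_cast; ring
    rw [this, Complex.exp_int_mul_two_pi_mul_I]
    simp

/-- The Fourier coefficients of an analytic function on a circle. -/
lemma HasTaylorCoeffs.integral_circ (ha : HasTaylorCoeffs h a) {r : ℝ} (hr0 : 0 ≤ r) (hr : r < 1)
    (k : ℤ) :
    HasSum (fun n : ℕ => a n * r ^ n * if (n : ℤ) = k then 2 * (Real.pi : ℂ) else 0)
      (∫ θ in (0 : ℝ)..(2 * Real.pi), h (circ r θ) * Complex.exp (-k * Complex.I * θ)) := by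
  have hterm : ∀ (n : ℕ) (θ : ℝ), a n * circ r θ ^ n * Complex.exp (-k * Complex.I * θ) =
      a n * r ^ n * Complex.exp (((n - k : ℤ) : ℂ) * Complex.I * θ) := by
    intro n θ
    rw [circ, mul_pow, ← Complex.exp_nat_mul, mul_assoc, mul_assoc, ← Complex.exp_add, ← mul_assoc]
    congr 2
    push_cast
    ring
  have hsum := intervalIntegral.hasSum_integral_of_dominated_convergence (μ := volume)
    (a := 0) (b := 2 * Real.pi)
    (F := fun n θ => a n * circ r θ ^ n * Complex.exp (-k * Complex.I * θ))
    (f := fun θ => h (circ r θ) * Complex.exp (-k * Complex.I * θ))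
    (fun n _ => ‖a n‖ * r ^ n)
    (fun n => by
      refine Continuous.aestronglyMeasurable ?_
      unfold circ
      fun_prop)
    (fun n => ae_of_all _ fun θ _ => by
      rw [hterm, norm_mul, norm_mul, norm_pow, Complex.norm_real, Real.norm_of_nonneg hr0]
      have : ((n - k : ℤ) : ℂ) * Complex.I * θ = (((n - k : ℤ) * θ : ℝ) : ℂ) * Complex.I := by
        push_cast; ring
      rw [this, Complex.norm_exp_ofReal_mul_I, mul_one])
    (ae_of_all _ fun θ _ => ha.summable_norm hr0 hr)
    intervalIntegrable_const
    (ae_of_all _ fun θ _ => (ha _ (circ_mem_unitDisk hr0 hr)).mul_right _)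
  refine (congrArg (fun F => HasSum F _) (funext fun n => ?_)).mpr hsum
  simp only [hterm]
  rw [intervalIntegral.integral_const_mul, integral_exp_int]
  simp only [sub_eq_zero]

lemma HasTaylorCoeffs.integral_circ_nat (ha : HasTaylorCoeffs h a) {r : ℝ} (hr0 : 0 ≤ r)
    (hr : r < 1) (k : ℕ) :
    ∫ θ in (0 : ℝ)..(2 * Real.pi), h (circ r θ) * Complex.exp (-(k : ℤ) * Complex.I * θ) =
      2 * Real.pi * (a k * r ^ k) := by
  refine (ha.integral_circ hr0 hr k).unique ?_
  have := hasSum_single (f := fun n : ℕ => a n * (r : ℂ) ^ n *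
    if (n : ℤ) = (k : ℤ) then 2 * (Real.pi : ℂ) else 0) k (fun n hn => by simp [hn])
  convert this using 1
  simp only [if_true]
  ring

lemma HasTaylorCoeffs.integral_circ_neg (ha : HasTaylorCoeffs h a) {r : ℝ} (hr0 : 0 ≤ r)
    (hr : r < 1) {k : ℕ} (hk : 1 ≤ k) :
    ∫ θ in (0 : ℝ)..(2 * Real.pi), h (circ r θ) * Complex.exp ((k : ℤ) * Complex.I * θ) = 0 := by
  have h1 := ha.integral_circ hr0 hr (-(k : ℤ))
  simp only [Int.cast_neg, neg_neg] at h1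
  refine h1.unique ?_
  convert hasSum_zero using 2 with n
  rw [if_neg (by omega), mul_zero]

lemma hasTaylorCoeffs_taylor (dh : DifferentiableOn ℂ h unitDisk) :
    HasTaylorCoeffs h fun n => (n.factorial : ℂ)⁻¹ * iteratedDeriv n h 0 := by
  intro z hz
  have := Complex.hasSum_taylorSeries_on_ball (c := 0) (r := 1) dh hz
  simp only [sub_zero, smul_eq_mul] at this
  refine (congrArg (fun F => HasSum F _) (funext fun n => ?_)).mpr this
  ring

/-- The analytic coefficients of a harmonic mapping are its Fourier coefficients of positive
order. -/
lemma norm_coeff_mul_pow_le (dh : DifferentiableOn ℂ h unitDisk) (dg : DifferentiableOn ℂ g unitDisk)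
    (ha : HasTaylorCoeffs h a) {r : ℝ} (hr0 : 0 ≤ r) (hr : r < 1) {n : ℕ} (hn : 1 ≤ n) :
    2 * Real.pi * (‖a n‖ * r ^ n) ≤ ∫ θ in (0 : ℝ)..(2 * Real.pi), ‖hmap h g (circ r θ)‖ := by
  have hcc : Continuous fun θ => circ r θ := by unfold circ; fun_prop
  have hD : ∀ θ, circ r θ ∈ unitDisk := fun θ => circ_mem_unitDisk hr0 hr
  have hhc := dh.continuousOn.comp_continuous hcc hD
  have hgc := dg.continuousOn.comp_continuous hcc hD
  have e1 := ha.integral_circ_nat hr0 hr n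
  have e2 := (hasTaylorCoeffs_taylor dg).integral_circ_neg hr0 hr hn
  have e3 : ∫ θ in (0 : ℝ)..(2 * Real.pi),
      hmap h g (circ r θ) * Complex.exp (-(n : ℤ) * Complex.I * θ) =
      2 * Real.pi * (a n * r ^ n) := by
    have hconj : ∫ θ in (0 : ℝ)..(2 * Real.pi),
        conj (g (circ r θ)) * Complex.exp (-(n : ℤ) * Complex.I * θ) = 0 := by
      have h4 := congrArg conj e2
      rw [← intervalIntegral.intervalIntegral_conj, map_zero] at h4
      rw [← h4]
      refine intervalIntegral.integral_congr fun θ _ => ?_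
      simp only [map_mul, ← Complex.exp_conj, Complex.conj_I, Complex.conj_ofReal, map_intCast]
      congr 2
      ring
    simp only [hmap, add_mul]
    rw [intervalIntegral.integral_add, e1, hconj, add_zero]
    · exact Continuous.intervalIntegrable (hhc.mul (by fun_prop)) _ _
    · exact Continuous.intervalIntegrable
        ((Complex.continuous_conj.comp hgc).mul (by fun_prop)) _ _
  have e4 : ‖(2 * Real.pi * (a n * r ^ n) : ℂ)‖ = 2 * Real.pi * (‖a n‖ * r ^ n) := by
    rw [norm_mul, norm_mul, norm_mul, norm_pow, Complex.norm_real, Complex.norm_real,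
      Real.norm_of_nonneg hr0, Real.norm_of_nonneg Real.pi_pos.le, Complex.norm_ofNat]
  rw [← e4, ← e3]
  refine (intervalIntegral.norm_integral_le_integral_norm (by positivity)).trans (le_of_eq ?_)
  refine intervalIntegral.integral_congr fun θ _ => ?_
  have : -((n : ℤ) : ℂ) * Complex.I * θ = ((-(n * θ) : ℝ) : ℂ) * Complex.I := by
    push_cast; ring
  simp only [norm_mul, this, Complex.norm_exp_ofReal_mul_I, mul_one]

end Fourier

/-! ### Finiteness of the second coefficient -/

section SecondCoefficient

variable {h g : ℂ → ℂ}

lemma hmap_swap (h g : ℂ → ℂ) (z : ℂ) : hmap g h z = conj (hmap h g z) := by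
  simp [hmap, add_comm]

/-- Cauchy's estimate on the circle of radius `1 / 4`. -/
lemma norm_deriv_deriv_le (dh : DifferentiableOn ℂ h unitDisk) (dg : DifferentiableOn ℂ g unitDisk)
    {M : ℝ} (hM : ∀ z, ‖z‖ ≤ 1 / 4 → ‖hmap h g z‖ ≤ M) : ‖deriv (deriv h) 0‖ ≤ 32 * M := by
  have h1 := norm_coeff_mul_pow_le dh dg (hasTaylorCoeffs_taylor dh) (r := 1 / 4) (by norm_num)
    (by norm_num) (n := 2) (by norm_num)
  have hcc : Continuous fun θ => circ (1 / 4) θ := by unfold circ; fun_prop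
  have h2 : ∫ θ in (0 : ℝ)..(2 * Real.pi), ‖hmap h g (circ (1 / 4) θ)‖ ≤ 2 * Real.pi * M := by
    have := intervalIntegral.integral_mono_on (μ := volume) (a := 0) (b := 2 * Real.pi)
      (f := fun θ => ‖hmap h g (circ (1 / 4) θ)‖) (g := fun _ => M) (by positivity)
      (Continuous.intervalIntegrable ((continuousOn_hmap dh dg).comp_continuous hcc
        fun θ => circ_mem_unitDisk (by norm_num) (by norm_num)).norm _ _)
      intervalIntegrable_const (fun θ _ => hM _ (by rw [norm_circ]; norm_num))
    simpa using this
  have h3 := le_of_mul_le_mul_left (h1.trans h2) (by positivity)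
  rw [iteratedDeriv_succ, iteratedDeriv_one, norm_mul] at h3
  norm_num [Nat.factorial] at h3
  linarith

/-- Post-composition with a real-affine map makes `g'(0)` vanish. -/
lemma UnivalentPair.affine (hp : UnivalentPair h g) :
    UnivalentPair (fun z => (h z - conj (deriv g 0) * g z) / (1 - ‖deriv g 0‖ ^ 2 : ℝ))
      (fun z => (g z - deriv g 0 * h z) / (1 - ‖deriv g 0‖ ^ 2 : ℝ)) := by
  set b := deriv g 0 with hb
  have hb1 : ‖b‖ < 1 := by
    have := hp.lt 0 zero_mem_unitDisk
    rwa [hp.deriv_h_zero, norm_one] at this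
  set d : ℝ := 1 - ‖b‖ ^ 2 with hd
  have hd0 : 0 < d := by rw [hd]; nlinarith [norm_nonneg b]
  have hdC : (d : ℂ) ≠ 0 := Complex.ofReal_ne_zero.mpr hd0.ne'
  have hbb : conj b * b = 1 - d := by
    rw [mul_comm, Complex.mul_conj, Complex.normSq_eq_norm_sq, hd]
    push_cast; ring
  have hdh : ∀ z ∈ unitDisk, deriv (fun z => (h z - conj b * g z) / (d : ℂ)) z =
      (deriv h z - conj b * deriv g z) / d := fun z hz => by
    have h1 := (hp.diff_h.differentiableAt (isOpen_unitDisk.mem_nhds hz)).hasDerivAt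
    have h2 := (hp.diff_g.differentiableAt (isOpen_unitDisk.mem_nhds hz)).hasDerivAt
    exact ((h1.sub (h2.const_mul (conj b))).div_const (d : ℂ)).deriv
  have hdg : ∀ z ∈ unitDisk, deriv (fun z => (g z - b * h z) / (d : ℂ)) z =
      (deriv g z - b * deriv h z) / d := fun z hz => by
    have h1 := (hp.diff_h.differentiableAt (isOpen_unitDisk.mem_nhds hz)).hasDerivAt
    have h2 := (hp.diff_g.differentiableAt (isOpen_unitDisk.mem_nhds hz)).hasDerivAt
    exact ((h2.sub (h1.const_mul b)).div_const (d : ℂ)).deriv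
  refine ⟨?_, ?_, ?_, fun z hz => ?_, ?_, ?_, ?_⟩
  · exact (hp.diff_h.sub (hp.diff_g.const_mul _)).div_const _
  · exact (hp.diff_g.sub (hp.diff_h.const_mul _)).div_const _
  · -- the original mapping `f` is recovered from the new one `F` as `F + conj (b * F)`
    intro z hz w hw hzw
    refine hp.inj hz hw ?_
    have hrec : ∀ z, hmap h g z =
        hmap (fun z => (h z - conj b * g z) / (d : ℂ)) (fun z => (g z - b * h z) / (d : ℂ)) z +
        conj (b * hmap (fun z => (h z - conj b * g z) / (d : ℂ))
          (fun z => (g z - b * h z) / (d : ℂ)) z) := by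
      intro z
      simp only [hmap, map_add, map_mul, map_sub, map_div₀, Complex.conj_conj, Complex.conj_ofReal]
      field_simp
      linear_combination (h z + conj (g z)) * hbb
    rw [hrec z, hrec w, hzw]
  · rw [hdh z hz, hdg z hz, norm_div, norm_div]
    refine div_lt_div_of_pos_right ?_ (norm_pos_iff.mpr hdC)
    -- `|p - conj b q|² - |q - b p|² = (1 - |b|²)(|p|² - |q|²)`
    have hlt := hp.lt z hz
    refine lt_of_pow_lt_pow_left₀ 2 (norm_nonneg _) ?_
    have hid : ‖deriv h z - conj b * deriv g z‖ ^ 2 - ‖deriv g z - b * deriv h z‖ ^ 2 =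
        d * (‖deriv h z‖ ^ 2 - ‖deriv g z‖ ^ 2) := by
      simp only [hd, Complex.sq_norm, Complex.normSq_apply, Complex.sub_re, Complex.sub_im,
        Complex.mul_re, Complex.mul_im, Complex.conj_re, Complex.conj_im]
      ring
    have : 0 < d * (‖deriv h z‖ ^ 2 - ‖deriv g z‖ ^ 2) :=
      mul_pos hd0 (sub_pos.mpr (pow_lt_pow_left₀ hlt (norm_nonneg _) two_ne_zero))
    linarith
  · simp [hp.h_zero, hp.g_zero]
  · simp [hp.h_zero, hp.g_zero]
  · rw [hdh 0 zero_mem_unitDisk, hp.deriv_h_zero, ← hb, hbb]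
    field_simp
    ring

/-- The second coefficient is bounded on `S_H`: the affine normalization `H + \bar G` of `f` is
bounded on `|z| ≤ 1/4`, and `h = H + \bar{b} G` with `b = g'(0)`, `|b| < 1`. -/
lemma UnivalentPair.norm_deriv_deriv_le (hp : UnivalentPair h g) :
    ‖deriv (deriv h) 0‖ ≤ 64 * Real.exp (20 + 56 * Real.pi ^ 2) := by
  have hq := hp.affine
  set b := deriv g 0 with hb
  have hb1 : ‖b‖ < 1 := by
    have := hp.lt 0 zero_mem_unitDisk
    rwa [hp.deriv_h_zero, norm_one] at this
  set d : ℝ := 1 - ‖b‖ ^ 2 with hd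
  have hd0 : 0 < d := by rw [hd]; nlinarith [norm_nonneg b]
  have hdC : (d : ℂ) ≠ 0 := Complex.ofReal_ne_zero.mpr hd0.ne'
  have hbb : conj b * b = 1 - d := by
    rw [mul_comm, Complex.mul_conj, Complex.normSq_eq_norm_sq, hd]
    push_cast; ring
  set H : ℂ → ℂ := fun z => (h z - conj b * g z) / (d : ℂ) with hH
  set G : ℂ → ℂ := fun z => (g z - b * h z) / (d : ℂ) with hG
  have hG0 : deriv G 0 = 0 := by
    have h1 := (hp.diff_h.differentiableAt (isOpen_unitDisk.mem_nhds zero_mem_unitDisk)).hasDerivAt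
    have h2 := (hp.diff_g.differentiableAt (isOpen_unitDisk.mem_nhds zero_mem_unitDisk)).hasDerivAt
    have h3 : deriv G 0 = (deriv g 0 - b * deriv h 0) / d :=
      ((h2.sub (h1.const_mul b)).div_const (d : ℂ)).deriv
    rw [h3, hp.deriv_h_zero, ← hb]
    simp
  have hM : ∀ z : ℂ, ‖z‖ ≤ 1 / 4 → ‖hmap H G z‖ ≤ Real.exp (20 + 56 * Real.pi ^ 2) :=
    fun z hz => hq.norm_le_of_norm_le hG0 hz
  have hM' : ∀ z : ℂ, ‖z‖ ≤ 1 / 4 → ‖hmap G H z‖ ≤ Real.exp (20 + 56 * Real.pi ^ 2) :=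
    fun z hz => by rw [hmap_swap, Complex.norm_conj]; exact hM z hz
  have hHb := HarmonicQR.norm_deriv_deriv_le hq.diff_h hq.diff_g hM
  have hGb := HarmonicQR.norm_deriv_deriv_le hq.diff_g hq.diff_h hM'
  have hh : h = fun z => H z + conj b * G z := by
    funext z
    simp only [hH, hG]
    field_simp
    linear_combination (h z) * hbb
  have hdd : deriv (deriv h) 0 = deriv (deriv H) 0 + conj b * deriv (deriv G) 0 := by
    have h1 : deriv h =ᶠ[𝓝 0] fun z => deriv H z + conj b * deriv G z := by
      filter_upwards [isOpen_unitDisk.mem_nhds zero_mem_unitDisk] with z hz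
      rw [hh]
      have h1 := (hq.diff_h.differentiableAt (isOpen_unitDisk.mem_nhds hz)).hasDerivAt
      have h2 := (hq.diff_g.differentiableAt (isOpen_unitDisk.mem_nhds hz)).hasDerivAt
      exact (h1.add (h2.const_mul (conj b))).deriv
    rw [h1.deriv_eq]
    have h1 := ((hq.diff_h.deriv isOpen_unitDisk).differentiableAt
      (isOpen_unitDisk.mem_nhds zero_mem_unitDisk)).hasDerivAt
    have h2 := ((hq.diff_g.deriv isOpen_unitDisk).differentiableAt
      (isOpen_unitDisk.mem_nhds zero_mem_unitDisk)).hasDerivAt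
    exact (h1.add (h2.const_mul (conj b))).deriv
  rw [hdd]
  refine (norm_add_le _ _).trans ?_
  rw [norm_mul, Complex.norm_conj]
  nlinarith [norm_nonneg (deriv (deriv G) 0), norm_nonneg b]

end SecondCoefficient

/-! ### Linear invariance and growth -/

section Growth

variable {h g : ℂ → ℂ}

lemma one_add_conj_mul_ne_zero {a ζ : ℂ} (ha : ‖a‖ < 1) (hζ : ‖ζ‖ < 1) : 1 + conj a * ζ ≠ 0 := by
  intro hcon
  have h1 : conj a * ζ = -1 := by linear_combination hcon
  have h2 := congrArg norm h1
  rw [norm_mul, Complex.norm_conj, norm_neg, norm_one] at h2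
  nlinarith [norm_nonneg a, norm_nonneg ζ]

/-- The automorphism of the unit disk that sends `0` to `a`. -/
noncomputable def diskAut (a ζ : ℂ) : ℂ := (ζ + a) / (1 + conj a * ζ)

lemma diskAut_mem {a ζ : ℂ} (ha : a ∈ unitDisk) (hζ : ζ ∈ unitDisk) : diskAut a ζ ∈ unitDisk := by
  rw [mem_unitDisk] at *
  have hne := one_add_conj_mul_ne_zero ha hζ
  rw [diskAut, norm_div, div_lt_one (norm_pos_iff.mpr hne)]
  refine lt_of_pow_lt_pow_left₀ 2 (norm_nonneg _) ?_
  have hid : ‖1 + conj a * ζ‖ ^ 2 - ‖ζ + a‖ ^ 2 = (1 - ‖a‖ ^ 2) * (1 - ‖ζ‖ ^ 2) := by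
    simp only [Complex.sq_norm, Complex.normSq_apply, Complex.add_re, Complex.add_im,
      Complex.mul_re, Complex.mul_im, Complex.conj_re, Complex.conj_im, Complex.one_re,
      Complex.one_im]
    ring
  have h1 : 0 < 1 - ‖a‖ ^ 2 := by nlinarith [norm_nonneg a]
  have h2 : 0 < 1 - ‖ζ‖ ^ 2 := by nlinarith [norm_nonneg ζ]
  have := mul_pos h1 h2
  linarith

lemma one_sub_norm_sq_ne_zero {a : ℂ} (ha : a ∈ unitDisk) : (1 - conj a * a : ℂ) ≠ 0 := by
  rw [mem_unitDisk] at ha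
  rw [mul_comm, Complex.mul_conj, Complex.normSq_eq_norm_sq]
  have h1 : 0 < 1 - ‖a‖ ^ 2 := by nlinarith [norm_nonneg a]
  exact_mod_cast h1.ne'

lemma diskAut_injOn {a : ℂ} (ha : a ∈ unitDisk) : InjOn (diskAut a) unitDisk := by
  intro z hz w hw hzw
  have h1 := one_add_conj_mul_ne_zero (mem_unitDisk.mp ha) (mem_unitDisk.mp hz)
  have h2 := one_add_conj_mul_ne_zero (mem_unitDisk.mp ha) (mem_unitDisk.mp hw)
  rw [diskAut, diskAut, div_eq_div_iff h1 h2] at hzw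
  have h3 : (1 - conj a * a) * (z - w) = 0 := by linear_combination hzw
  exact sub_eq_zero.mp ((mul_eq_zero.mp h3).resolve_left (one_sub_norm_sq_ne_zero ha))

lemma hasDerivAt_diskAut {a ζ : ℂ} (ha : a ∈ unitDisk) (hζ : ζ ∈ unitDisk) :
    HasDerivAt (diskAut a) ((1 - conj a * a) / (1 + conj a * ζ) ^ 2) ζ := by
  have hne := one_add_conj_mul_ne_zero (mem_unitDisk.mp ha) (mem_unitDisk.mp hζ)
  have h1 := ((hasDerivAt_id ζ).add_const a).div
    (((hasDerivAt_id ζ).const_mul (conj a)).const_add 1) hne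
  refine h1.congr_deriv ?_
  simp only [id]
  ring

/-- The Koebe transform: `S_H` is linearly invariant. The mapping
`ζ ↦ (f(φ(ζ)) - f(a)) / ((1 - |a|²) h'(a))`, with `φ` the disk automorphism that sends `0` to `a`,
has the second coefficient stated here, and its co-analytic part vanishes if that of `f` does. -/
lemma UnivalentPair.koebeTransform (hp : UnivalentPair h g) {a : ℂ} (ha : a ∈ unitDisk) :
    ∃ H G : ℂ → ℂ, UnivalentPair H G ∧
      deriv (deriv H) 0 = (1 - conj a * a) * (deriv (deriv h) a / deriv h a) - 2 * conj a ∧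
      ((∀ z ∈ unitDisk, g z = 0) → ∀ z ∈ unitDisk, G z = 0) := by
  set p := deriv h a with hpdef
  have hp0 : p ≠ 0 := norm_pos_iff.mp ((norm_nonneg _).trans_lt (hp.lt a ha))
  have hd0 := one_sub_norm_sq_ne_zero ha
  set d : ℂ := 1 - conj a * a with hd
  have hdconj : conj d = d := by rw [hd]; simp [mul_comm]
  have hq0 : d * p ≠ 0 := mul_ne_zero hd0 hp0
  have hcomp : ∀ {k : ℂ → ℂ}, DifferentiableOn ℂ k unitDisk → ∀ c : ℂ, ∀ ζ ∈ unitDisk,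
      HasDerivAt (fun ζ => (k (diskAut a ζ) - k a) / c)
        (deriv k (diskAut a ζ) * (d / (1 + conj a * ζ) ^ 2) / c) ζ := by
    intro k dk c ζ hζ
    have h1 := (dk.differentiableAt (isOpen_unitDisk.mem_nhds (diskAut_mem ha hζ))).hasDerivAt
    exact ((h1.comp ζ (hasDerivAt_diskAut ha hζ)).sub_const _).div_const c
  have h0 : diskAut a 0 = a := by simp [diskAut]
  refine ⟨fun ζ => (h (diskAut a ζ) - h a) / (d * p), fun ζ => (g (diskAut a ζ) - g a) / conj (d * p),
    ⟨?_, ?_, ?_, ?_, ?_, ?_, ?_⟩, ?_, ?_⟩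
  · exact fun ζ hζ => (hcomp hp.diff_h _ ζ hζ).differentiableAt.differentiableWithinAt
  · exact fun ζ hζ => (hcomp hp.diff_g _ ζ hζ).differentiableAt.differentiableWithinAt
  · intro z hz w hw hzw
    refine diskAut_injOn ha hz hw (hp.inj (diskAut_mem ha hz) (diskAut_mem ha hw) ?_)
    have hF : ∀ ζ, hmap (fun ζ => (h (diskAut a ζ) - h a) / (d * p))
        (fun ζ => (g (diskAut a ζ) - g a) / conj (d * p)) ζ =
        (hmap h g (diskAut a ζ) - hmap h g a) / (d * p) := by
      intro ζ
      simp only [hmap, map_div₀, map_sub, Complex.conj_conj]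
      ring
    rw [hF, hF, div_left_inj' hq0] at hzw
    exact sub_left_inj.mp hzw
  · intro ζ hζ
    rw [(hcomp hp.diff_h _ ζ hζ).deriv, (hcomp hp.diff_g _ ζ hζ).deriv]
    have hne := one_add_conj_mul_ne_zero (mem_unitDisk.mp ha) (mem_unitDisk.mp hζ)
    rw [norm_div, norm_div, norm_mul, norm_mul, Complex.norm_conj]
    refine div_lt_div_of_pos_right ?_ (norm_pos_iff.mpr hq0)
    exact mul_lt_mul_of_pos_right (hp.lt _ (diskAut_mem ha hζ))
      (norm_pos_iff.mpr (div_ne_zero hd0 (pow_ne_zero 2 hne)))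
  · simp [h0]
  · simp [h0]
  · rw [(hcomp hp.diff_h _ 0 zero_mem_unitDisk).deriv, h0]
    simp only [mul_zero, add_zero, one_pow, div_one, ← hpdef]
    rw [mul_comm, div_self hq0]
  · have he : deriv (fun ζ => (h (diskAut a ζ) - h a) / (d * p)) =ᶠ[𝓝 0]
        fun ζ => deriv h (diskAut a ζ) * (d / (1 + conj a * ζ) ^ 2) / (d * p) := by
      filter_upwards [isOpen_unitDisk.mem_nhds zero_mem_unitDisk] with ζ hζ
      exact (hcomp hp.diff_h _ ζ hζ).deriv
    rw [he.deriv_eq]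
    have h1 : HasDerivAt (deriv h) (deriv (deriv h) a) (diskAut a 0) := by
      rw [h0]
      exact ((hp.diff_h.deriv isOpen_unitDisk).differentiableAt
        (isOpen_unitDisk.mem_nhds ha)).hasDerivAt
    have h2 := h1.comp 0 (hasDerivAt_diskAut ha zero_mem_unitDisk)
    have h3 : HasDerivAt (fun ζ : ℂ => d / (1 + conj a * ζ) ^ 2) (-(2 * conj a * d)) 0 := by
      have h4 := ((((hasDerivAt_id (0 : ℂ)).const_mul (conj a)).const_add 1).pow 2)
      have h5 := (hasDerivAt_const (0 : ℂ) d).div h4 (by simp)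
      refine h5.congr_deriv ?_
      simp
      ring
    have h6 := ((h2.mul h3).div_const (d * p)).deriv
    refine h6.trans ?_
    simp only [Function.comp, h0, mul_zero, add_zero, one_pow, div_one, ← hpdef, ← hd]
    field_simp
    ring
  · intro hg z hz
    simp [hg _ (diskAut_mem ha hz), hg _ ha]

/-- The bound on `h'' / h'` that expresses that every Koebe transform of `h + \bar g` has second
coefficient at most `α` implies the distortion theorem of order `α`. -/
lemma UnivalentPair.norm_deriv_le (hp : UnivalentPair h g) {α : ℝ}
    (hα : ∀ z ∈ unitDisk,
      ‖(1 - conj z * z) * (deriv (deriv h) z / deriv h z) - 2 * conj z‖ ≤ 2 * α)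
    {z : ℂ} (hz : z ∈ unitDisk) :
    ‖deriv h z‖ ≤ (1 + ‖z‖) ^ (α - 1) * (1 - ‖z‖) ^ (-(α + 1)) := by
  obtain ⟨θ, hθ⟩ := exists_circ_eq z
  set r := ‖z‖ with hr
  have hr0 : 0 ≤ r := norm_nonneg z
  have hr1 : r < 1 := mem_unitDisk.mp hz
  have hD : ∀ t ∈ Icc 0 r, circ t θ ∈ unitDisk := fun t ht =>
    circ_mem_unitDisk ht.1 (ht.2.trans_lt hr1)
  have hne : ∀ t ∈ Icc 0 r, deriv h (circ t θ) ≠ 0 := fun t ht =>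
    norm_pos_iff.mp ((norm_nonneg _).trans_lt (hp.lt _ (hD t ht)))
  set e : ℂ := Complex.exp (θ * Complex.I) with he
  have hee : ‖e‖ = 1 := Complex.norm_exp_ofReal_mul_I θ
  have hu : ∀ t ∈ Icc 0 r, HasDerivAt (fun t => deriv h (circ t θ))
      (deriv (deriv h) (circ t θ) * e) t := by
    intro t ht
    have h1 := ((hp.diff_h.deriv isOpen_unitDisk).differentiableAt
      (isOpen_unitDisk.mem_nhds (hD t ht))).hasDerivAt
    have h2 : HasDerivAt (fun t => circ t θ) e t := hasDerivAt_circ_left t θ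
    exact h1.comp t h2
  have hlog : ∀ t ∈ Icc 0 r, HasDerivAt (fun t => Real.log (‖deriv h (circ t θ)‖ ^ 2))
      (2 * (e * (deriv (deriv h) (circ t θ) / deriv h (circ t θ))).re) t := by
    intro t ht
    have h1 := (hu t ht).norm_sq.log (by have := hne t ht; positivity)
    convert h1 using 1
    have h2 : e * (deriv (deriv h) (circ t θ) / deriv h (circ t θ)) =
        (deriv (deriv h) (circ t θ) * e) * conj (deriv h (circ t θ)) /
          ((‖deriv h (circ t θ)‖ ^ 2 : ℝ) : ℂ) := by
      rw [← Complex.normSq_eq_norm_sq, ← Complex.mul_conj]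
      have := hne t ht
      have : conj (deriv h (circ t θ)) ≠ 0 := (map_ne_zero _).mpr this
      field_simp
    rw [h2, Complex.div_ofReal_re, Complex.inner]
    ring
  -- twice the logarithm of the quotient of the two sides; it decreases along the radius
  set Q : ℝ → ℝ := fun t => Real.log (‖deriv h (circ t θ)‖ ^ 2) -
    2 * ((α - 1) * Real.log (1 + t) - (α + 1) * Real.log (1 - t)) with hQ
  have hQd : ∀ t ∈ Icc 0 r, HasDerivAt Q
      (2 * (e * (deriv (deriv h) (circ t θ) / deriv h (circ t θ))).re -
        2 * ((α - 1) * (1 / (1 + t)) - (α + 1) * (-1 / (1 - t)))) t := by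
    intro t ht
    have h1 : HasDerivAt (fun t : ℝ => Real.log (1 + t)) (1 / (1 + t)) t :=
      ((hasDerivAt_id t).const_add 1).log (by have := ht.1; simp only [id]; linarith)
    have h2 : HasDerivAt (fun t : ℝ => Real.log (1 - t)) (-1 / (1 - t)) t :=
      ((hasDerivAt_id t).const_sub 1).log (by have := ht.2; simp only [id]; linarith)
    exact (hlog t ht).sub (((h1.const_mul (α - 1)).sub (h2.const_mul (α + 1))).const_mul 2)
  have hanti : AntitoneOn Q (Icc 0 r) := by
    refine antitoneOn_of_deriv_nonpos (convex_Icc 0 r)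
      (fun t ht => (hQd t ht).continuousAt.continuousWithinAt) ?_ ?_
    · intro t ht
      exact (hQd t (interior_subset ht)).differentiableAt.differentiableWithinAt
    · intro t ht
      have ht' := interior_subset ht
      rw [(hQd t ht').deriv]
      have h1 := hα _ (hD t ht')
      have hconj : conj (circ t θ) * circ t θ = ((t ^ 2 : ℝ) : ℂ) := by
        rw [mul_comm, Complex.mul_conj, Complex.normSq_eq_norm_sq, norm_circ, sq_abs]
      have hce : e * conj (circ t θ) = t := by
        have h4 : conj e * e = 1 := by
          rw [mul_comm, Complex.mul_conj, Complex.normSq_eq_norm_sq, hee]; simp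
        rw [circ, ← he, map_mul, Complex.conj_ofReal]
        linear_combination (t : ℂ) * h4
      set w := deriv (deriv h) (circ t θ) / deriv h (circ t θ) with hw
      have h2 : (e * ((1 - conj (circ t θ) * circ t θ) * w - 2 * conj (circ t θ))).re ≤ 2 * α := by
        refine (Complex.re_le_norm _).trans ?_
        rw [norm_mul, hee, one_mul]; exact h1
      have h3 : (e * ((1 - conj (circ t θ) * circ t θ) * w - 2 * conj (circ t θ))).re =
          (1 - t ^ 2) * (e * w).re - 2 * t := by
        have : e * ((1 - conj (circ t θ) * circ t θ) * w - 2 * conj (circ t θ)) =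
            ((1 - t ^ 2 : ℝ) : ℂ) * (e * w) - ((2 * t : ℝ) : ℂ) := by
          rw [hconj]; push_cast
          linear_combination (-2) * hce
        rw [this, Complex.sub_re, Complex.re_ofReal_mul, Complex.ofReal_re]
      rw [h3] at h2
      have ht0 : 0 < 1 + t := by linarith [ht'.1]
      have ht1 : 0 < 1 - t := by linarith [ht'.2]
      have h5 : (e * w).re ≤ (2 * α + 2 * t) / ((1 + t) * (1 - t)) := by
        rw [le_div_iff₀ (mul_pos ht0 ht1)]; linarith
      have h6 : (2 * α + 2 * t) / ((1 + t) * (1 - t)) =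
          (α - 1) * (1 / (1 + t)) - (α + 1) * (-1 / (1 - t)) := by
        field_simp; ring
      linarith
  have hfin := hanti (left_mem_Icc.mpr hr0) (right_mem_Icc.mpr hr0) hr0
  have h00 : circ 0 θ = 0 := by simp [circ]
  simp only [hQ, hθ, h00, hp.deriv_h_zero, norm_one, Real.log_one, add_zero, sub_zero,
    mul_zero, Real.log_pow] at hfin
  have hpos : 0 < ‖deriv h z‖ := by
    have := hne r (right_mem_Icc.mpr hr0)
    rw [hθ] at this
    exact norm_pos_iff.mpr this
  have h1 : 0 < 1 + r := by linarith
  have h2 : 0 < 1 - r := by linarith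
  rw [← Real.log_le_log_iff hpos (by positivity), Real.log_mul (by positivity) (by positivity),
    Real.log_rpow h1, Real.log_rpow h2]
  push_cast at hfin
  linarith

/-- The growth theorem of order `α`, by integration of the distortion theorem along a radius. -/
lemma UnivalentPair.norm_hmap_le (hp : UnivalentPair h g) {α : ℝ} (hα1 : 1 ≤ α)
    (hα : ∀ z ∈ unitDisk,
      ‖(1 - conj z * z) * (deriv (deriv h) z / deriv h z) - 2 * conj z‖ ≤ 2 * α)
    {z : ℂ} (hz : z ∈ unitDisk) :
    ‖hmap h g z‖ ≤ 2 ^ α * (1 - ‖z‖) ^ (-α) := by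
  obtain ⟨θ, hθ⟩ := exists_circ_eq z
  set r := ‖z‖ with hr
  have hr0 : 0 ≤ r := norm_nonneg z
  have hr1 : r < 1 := mem_unitDisk.mp hz
  have hD : ∀ t ∈ Icc 0 r, circ t θ ∈ unitDisk := fun t ht =>
    circ_mem_unitDisk ht.1 (ht.2.trans_lt hr1)
  set e : ℂ := Complex.exp (θ * Complex.I) with he
  have hu : ∀ t ∈ Icc 0 r, HasDerivAt (fun t => hmap h g (circ t θ))
      (wirtinger (deriv h (circ t θ)) (deriv g (circ t θ)) e) t := by
    intro t ht
    have h1 : HasDerivAt (fun t => circ t θ) e t := hasDerivAt_circ_left t θ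
    exact (hasFDerivAt_hmap hp.diff_h hp.diff_g (hD t ht)).comp_hasDerivAt t h1
  have hB : ∀ t ∈ Icc 0 r, HasDerivAt (fun t : ℝ => 2 ^ α * (1 - t) ^ (-α))
      (2 ^ α * (α * (1 - t) ^ (-(α + 1)))) t := by
    intro t ht
    have h1 : (1 - t) ≠ 0 := by have := ht.2; linarith
    have h2 := (((hasDerivAt_id t).const_sub 1).rpow_const (p := -α) (Or.inl h1)).const_mul
      ((2 : ℝ) ^ α)
    refine h2.congr_deriv ?_
    simp only [id]
    rw [show -α - 1 = -(α + 1) by ring]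
    ring
  have key := image_norm_le_of_norm_deriv_right_le_deriv_boundary'
    (f := fun t => hmap h g (circ t θ)) (a := 0) (b := r)
    (fun t ht => (hu t ht).continuousAt.continuousWithinAt)
    (fun t ht => (hu t (Ico_subset_Icc_self ht)).hasDerivWithinAt)
    (B := fun t : ℝ => 2 ^ α * (1 - t) ^ (-α)) ?_
    (fun t ht => (hB t ht).continuousAt.continuousWithinAt)
    (fun t ht => (hB t (Ico_subset_Icc_self ht)).hasDerivWithinAt) ?_ (right_mem_Icc.mpr hr0)
  · simpa [hθ] using key
  · have h00 : circ 0 θ = 0 := by simp [circ]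
    rw [h00, hp.hmap_zero, norm_zero, sub_zero]
    positivity
  · intro t ht
    have ht' := Ico_subset_Icc_self ht
    have ht0 := ht.1
    have ht1 : 0 < 1 - t := by linarith [ht.2]
    refine (norm_wirtinger_apply_le _ _ _).trans ?_
    rw [he, Complex.norm_exp_ofReal_mul_I, mul_one]
    have h1 := hp.norm_deriv_le hα (hD t ht')
    have h2 := (hp.lt _ (hD t ht')).le
    rw [norm_circ, abs_of_nonneg ht0] at h1
    have h3 : (1 + t) ^ (α - 1) ≤ 2 ^ (α - 1) :=
      Real.rpow_le_rpow (by linarith) (by linarith [ht.2]) (by linarith)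
    have h4 : (2 : ℝ) ^ α = 2 ^ (α - 1) * 2 := by
      rw [← Real.rpow_add_one two_ne_zero]; congr 1; ring
    have h5 : 0 ≤ (1 - t) ^ (-(α + 1)) := by positivity
    have h6 : (0 : ℝ) ≤ 2 ^ (α - 1) := by positivity
    calc _ ≤ 2 * ((1 + t) ^ (α - 1) * (1 - t) ^ (-(α + 1))) := by linarith
      _ ≤ 2 * (2 ^ (α - 1) * (1 - t) ^ (-(α + 1))) := by gcongr
      _ = 2 ^ α * (1 * (1 - t) ^ (-(α + 1))) := by rw [h4]; ring
      _ ≤ _ := by gcongr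

end Growth

/-! ### Integral means -/

section Means

variable {h g : ℂ → ℂ}

/-- `2π M_p(r, f)^p` for `f = h + \bar g`. -/
noncomputable def meanPow (h g : ℂ → ℂ) (p r : ℝ) : ℝ :=
  ∫ θ in (0 : ℝ)..(2 * Real.pi), ‖hmap h g (circ r θ)‖ ^ p

lemma UnivalentPair.hmap_circ_ne_zero (hp : UnivalentPair h g) {t : ℝ} (ht0 : 0 < t) (ht : t < 1)
    (θ : ℝ) : hmap h g (circ t θ) ≠ 0 := by
  refine hp.hmap_ne_zero (circ_mem_unitDisk ht0.le ht) (norm_pos_iff.mp ?_)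
  rw [norm_circ]; exact abs_pos.mpr ht0.ne'

lemma UnivalentPair.continuousOn_comp_norm (hp : UnivalentPair h g) {v : ℝ → ℝ}
    (hv : ContinuousOn v (Ioi 0)) {a b : ℝ} (ha : 0 < a) (hb : b < 1) :
    ContinuousOn (Function.uncurry fun t θ => v ‖hmap h g (circ t θ)‖) (Icc a b ×ˢ univ) := by
  refine hv.comp (continuousOn_circ_comp (continuousOn_hmap hp.diff_h hp.diff_g).norm ha.le hb) ?_
  rintro ⟨t, θ⟩ ⟨ht, -⟩
  exact norm_pos_iff.mpr (hp.hmap_circ_ne_zero (ha.trans_le ht.1) (ht.2.trans_lt hb) θ)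

lemma continuousOn_rpow_Ioi (q : ℝ) : ContinuousOn (fun s : ℝ => s ^ q) (Ioi 0) :=
  continuousOn_id.rpow_const fun _ hs => Or.inl (ne_of_gt hs)

/-- The area estimate for the density `|w|^{q - 2}` on `|w| ≤ M`. -/
lemma UnivalentPair.area_rpow_le (hp : UnivalentPair h g) {a b M q : ℝ} (ha : 0 < a) (hab : a ≤ b)
    (hb : b < 1) (hq : 0 < q) (hM : ∀ z, a ≤ ‖z‖ → ‖z‖ ≤ b → ‖hmap h g z‖ ≤ M) :
    ∫ t in a..b, ∫ θ in (0 : ℝ)..(2 * Real.pi),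
      t * (‖hmap h g (circ t θ)‖ ^ (q - 2) * jac h g (circ t θ)) ≤
        2 * Real.pi * (M ^ q / q) := by
  have hM0 : 0 ≤ M := (norm_nonneg _).trans
    (hM (circ a 0) (by rw [norm_circ, abs_of_pos ha]) (by rw [norm_circ, abs_of_pos ha]; exact hab))
  have hI : IntervalIntegrable (fun s : ℝ => s ^ (q - 1)) volume 0 M :=
    intervalIntegral.intervalIntegrable_rpow' (by linarith)
  refine polar_area_le hp ha hab hb (T := Ioc 0 M) measurableSet_Ioc ?_ (φ := fun s => s ^ (q - 2))
    ((continuousOn_rpow_Ioi _).mono Ioc_subset_Ioi_self)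
    (fun s hs => Real.rpow_nonneg hs.1.le _) (by positivity) ?_
  · intro z hz1 hz2
    refine ⟨norm_pos_iff.mpr (hp.hmap_ne_zero (mem_unitDisk.mpr (hz2.trans_lt hb)) ?_), hM z hz1 hz2⟩
    exact norm_pos_iff.mp (ha.trans_le hz1)
  · have h1 : M ^ q / q = ∫ s in Ioc 0 M, s ^ (q - 1) := by
      rw [← intervalIntegral.integral_of_le hM0, integral_rpow (Or.inl (by linarith)),
        sub_add_cancel, Real.zero_rpow hq.ne', sub_zero]
    rw [h1, ofReal_integral_eq_lintegral_ofReal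
      ((intervalIntegrable_iff_integrableOn_Ioc_of_le hM0).mp hI)
      (by filter_upwards [ae_restrict_mem measurableSet_Ioc] with s hs
          exact Real.rpow_nonneg hs.1.le _)]
    refine (lintegral_mono_set inter_subset_left).trans
      (setLIntegral_mono' measurableSet_Ioc fun s hs => ENNReal.ofReal_le_ofReal (le_of_eq ?_))
    rw [mul_comm, ← Real.rpow_add_one hs.1.ne']
    congr 1
    ring

/-- The increment of the integral mean, split by Cauchy's inequality into a part that can be
absorbed and an area integral. -/
lemma UnivalentPair.meanPow_sub_le (hp : UnivalentPair h g) {K A γ p β : ℝ}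
    (hA : 0 < A) (hγ : 0 < γ) (hp0 : 0 < p) (hβ : 0 < β) (hK0 : 0 ≤ K)
    (hK : ∀ z ∈ unitDisk, stretch h g z ^ 2 ≤ K * jac h g z)
    (hgrow : ∀ z ∈ unitDisk, ‖hmap h g z‖ ≤ A * (1 - ‖z‖) ^ (-γ))
    {r : ℝ} (hr : 1 / 2 ≤ r) (hr1 : r < 1) :
    2 * (meanPow h g p r - meanPow h g p (1 / 2)) ≤
      (∫ t in (1 / 2 : ℝ)..r, β / (1 - t) * meanPow h g p t) +
      2 * p ^ 2 * K * A ^ (1 / γ) / β * ∫ t in (1 / 2 : ℝ)..r, ∫ θ in (0 : ℝ)..(2 * Real.pi),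
        t * (‖hmap h g (circ t θ)‖ ^ (p - 1 / γ - 2) * jac h g (circ t θ)) := by
  have ha : (0 : ℝ) < 1 / 2 := by norm_num
  have h2pi : (0 : ℝ) ≤ 2 * Real.pi := by positivity
  set c : ℝ := 2 * p ^ 2 * K * A ^ (1 / γ) / β with hc
  have hVd : ∀ s : ℝ, 0 < s → HasDerivAt (fun s : ℝ => s ^ p) (p * s ^ (p - 1)) s := fun s hs =>
    Real.hasDerivAt_rpow_const (Or.inl hs.ne')
  have hvc : ContinuousOn (fun s : ℝ => p * s ^ (p - 1)) (Ioi 0) :=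
    continuousOn_const.mul (continuousOn_rpow_Ioi _)
  have hv0 : ∀ s : ℝ, 0 < s → 0 ≤ p * s ^ (p - 1) := fun s hs => by positivity
  have hJc := continuousOn_circ_comp (continuousOn_jac hp.diff_h hp.diff_g) ha.le hr1
  have hSc := continuousOn_circ_comp (continuousOn_stretch hp.diff_h hp.diff_g) ha.le hr1
  -- the three integrands
  set X : ℝ → ℝ → ℝ := fun t θ =>
    p * ‖hmap h g (circ t θ)‖ ^ (p - 1) * stretch h g (circ t θ) with hX
  set Y : ℝ → ℝ → ℝ := fun t θ => β / (1 - t) * ‖hmap h g (circ t θ)‖ ^ p with hY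
  set E : ℝ → ℝ → ℝ := fun t θ =>
    t * (‖hmap h g (circ t θ)‖ ^ (p - 1 / γ - 2) * jac h g (circ t θ)) with hE
  have hXc : ContinuousOn (Function.uncurry X) (Icc (1 / 2) r ×ˢ univ) :=
    (hp.continuousOn_comp_norm hvc ha hr1).mul hSc
  have hYc : ContinuousOn (Function.uncurry Y) (Icc (1 / 2) r ×ˢ univ) := by
    refine ContinuousOn.mul (ContinuousOn.div continuousOn_const (by fun_prop) ?_)
      (hp.continuousOn_comp_norm (continuousOn_rpow_Ioi p) ha hr1)
    rintro ⟨t, θ⟩ ⟨ht, -⟩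
    have : t ≤ r := ht.2
    simp only
    linarith
  have hEc : ContinuousOn (Function.uncurry E) (Icc (1 / 2) r ×ˢ univ) :=
    continuousOn_fst.mul ((hp.continuousOn_comp_norm (continuousOn_rpow_Ioi _) ha hr1).mul hJc)
  have hslice : ∀ {F : ℝ → ℝ → ℝ}, ContinuousOn (Function.uncurry F) (Icc (1 / 2) r ×ˢ univ) →
      ∀ θ, IntervalIntegrable (fun t => F t θ) volume (1 / 2) r := fun hF θ =>
    ContinuousOn.intervalIntegrable_of_Icc hr
      (hF.comp (f := fun t => (t, θ)) (by fun_prop) fun t ht => ⟨ht, mem_univ _⟩)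
  have hpt : ∀ t ∈ Icc (1 / 2) r, ∀ θ, 2 * X t θ ≤ Y t θ + c * E t θ := by
    intro t ht θ
    have ht0 : 0 < t := ha.trans_le ht.1
    have ht1 : 0 < 1 - t := by linarith [ht.2]
    have hD : circ t θ ∈ unitDisk := circ_mem_unitDisk ht0.le (ht.2.trans_lt hr1)
    have hJ := (hp.jac_pos hD).le
    have hs0 : 0 < ‖hmap h g (circ t θ)‖ :=
      norm_pos_iff.mpr (hp.hmap_circ_ne_zero ht0 (ht.2.trans_lt hr1) θ)
    have hg1 := hgrow _ hD
    rw [norm_circ, abs_of_pos ht0] at hg1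
    set s := ‖hmap h g (circ t θ)‖ with hs
    -- the growth bound, read as a bound for the distance to the boundary
    have hdist : 1 - t ≤ A ^ (1 / γ) * s ^ (-(1 / γ)) := by
      have h1 : (1 - t) ^ γ * s ≤ A := by
        calc (1 - t) ^ γ * s ≤ (1 - t) ^ γ * (A * (1 - t) ^ (-γ)) := by gcongr
          _ = A * ((1 - t) ^ γ * (1 - t) ^ (-γ)) := by ring
          _ = A := by rw [← Real.rpow_add ht1, add_neg_cancel, Real.rpow_zero, mul_one]
      have h2 := Real.rpow_le_rpow (by positivity) h1 (z := 1 / γ) (by positivity)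
      rw [Real.mul_rpow (by positivity) hs0.le, ← Real.rpow_mul ht1.le, mul_one_div_cancel hγ.ne',
        Real.rpow_one] at h2
      rw [Real.rpow_neg hs0.le, ← div_eq_mul_inv, le_div_iff₀ (by positivity)]
      exact h2
    have hc0 : 0 ≤ c := by rw [hc]; positivity
    refine two_mul_le_add_of_sq_le_mul (by simp only [hY]; positivity)
      (mul_nonneg hc0 (by simp only [hE]; positivity)) ?_
    have e1 : (s ^ (p - 1)) ^ 2 = s ^ p * s ^ (p - 2) := by
      rw [← Real.rpow_natCast, ← Real.rpow_mul hs0.le, ← Real.rpow_add hs0]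
      congr 1
      push_cast
      ring
    have e2 : s ^ (p - 1 / γ - 2) = s ^ (p - 2) * s ^ (-(1 / γ)) := by
      rw [← Real.rpow_add hs0]; congr 1; ring
    have hid : Y t θ * (c * E t θ) = (s ^ p * s ^ (p - 2)) * p ^ 2 * (K * jac h g (circ t θ)) *
        ((2 * t) * (A ^ (1 / γ) * s ^ (-(1 / γ))) / (1 - t)) := by
      simp only [hY, hE, hc, ← hs, e2]
      field_simp
    have hid2 : X t θ ^ 2 = (s ^ p * s ^ (p - 2)) * p ^ 2 * stretch h g (circ t θ) ^ 2 * 1 := by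
      simp only [hX, ← hs]
      rw [← e1]; ring
    rw [hid, hid2]
    -- the factor `2` in `c` compensates `t ≥ 1 / 2`
    have h4 : 1 ≤ (2 * t) * (A ^ (1 / γ) * s ^ (-(1 / γ))) / (1 - t) := by
      rw [le_div_iff₀ ht1, one_mul]
      have : 1 ≤ 2 * t := by linarith [ht.1]
      nlinarith
    have h5 := hK _ hD
    have : 0 ≤ K * jac h g (circ t θ) := by positivity
    gcongr
  have hray : ∀ θ : ℝ, 2 * (‖hmap h g (circ r θ)‖ ^ p - ‖hmap h g (circ (1 / 2) θ)‖ ^ p) ≤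
      (∫ t in (1 / 2 : ℝ)..r, Y t θ) + c * ∫ t in (1 / 2 : ℝ)..r, E t θ := by
    intro θ
    have h1 := (le_abs_self _).trans
      (hp.abs_sub_le_integral_radius ha hr hr1 hVd hvc hv0 θ)
    have h2 := intervalIntegral.integral_mono_on hr ((hslice hXc θ).const_mul 2)
      ((hslice hYc θ).add ((hslice hEc θ).const_mul c)) (fun t ht => hpt t ht θ)
    rw [intervalIntegral.integral_const_mul,
      intervalIntegral.integral_add (hslice hYc θ) ((hslice hEc θ).const_mul c),
      intervalIntegral.integral_const_mul] at h2
    exact (mul_le_mul_of_nonneg_left h1 zero_le_two).trans h2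
  have hmc : ∀ t ∈ Icc (1 / 2) r, Continuous fun θ => ‖hmap h g (circ t θ)‖ ^ p := fun t ht =>
    (hp.continuousOn_comp_norm (continuousOn_rpow_Ioi p) ha hr1).comp_continuous
      (f := fun θ => (t, θ)) (by fun_prop) fun θ => ⟨ht, mem_univ _⟩
  have hYi := (continuousOn_integral_strip' hr hYc).intervalIntegrable (μ := volume) 0 (2 * Real.pi)
  have hEi := (continuousOn_integral_strip' hr hEc).intervalIntegrable (μ := volume) 0 (2 * Real.pi)
  have hi1 := (hmc r ⟨hr, le_rfl⟩).intervalIntegrable (μ := volume) 0 (2 * Real.pi)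
  have hi2 := (hmc (1 / 2) ⟨le_rfl, hr⟩).intervalIntegrable (μ := volume) 0 (2 * Real.pi)
  have hmain := intervalIntegral.integral_mono_on h2pi ((hi1.sub hi2).const_mul 2)
    (hYi.add (hEi.const_mul c)) (fun θ _ => hray θ)
  rw [intervalIntegral.integral_const_mul, intervalIntegral.integral_sub hi1 hi2,
    intervalIntegral.integral_add hYi (hEi.const_mul c), intervalIntegral.integral_const_mul,
    integral_swap_strip hr h2pi hYc, integral_swap_strip hr h2pi hEc] at hmain
  simp only [hY, intervalIntegral.integral_const_mul] at hmain
  exact hmain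

lemma UnivalentPair.continuousOn_meanPow (hp : UnivalentPair h g) (p : ℝ) {a b : ℝ} (ha : 0 < a)
    (hab : a ≤ b) (hb : b < 1) : ContinuousOn (meanPow h g p) (Icc a b) :=
  continuousOn_integral_strip hab (hp.continuousOn_comp_norm (continuousOn_rpow_Ioi p) ha hb)

lemma integral_const_div_one_sub_rpow {β r : ℝ} (hr : 1 / 2 ≤ r) (hr1 : r < 1) :
    ∫ t in (1 / 2 : ℝ)..r, β * (1 - t) ^ (-β - 1) = (1 - r) ^ (-β) - (1 / 2) ^ (-β) := by
  have h1 := intervalIntegral.integral_eq_sub_of_hasDerivAt (a := 1 / 2) (b := r)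
    (f := fun t : ℝ => (1 - t) ^ (-β)) (f' := fun t => β * (1 - t) ^ (-β - 1)) ?_ ?_
  · rw [h1]; norm_num
  · intro t ht
    rw [uIcc_of_le hr] at ht
    have h2 : (1 - t) ≠ 0 := by linarith [ht.2]
    refine (((hasDerivAt_id t).const_sub 1).rpow_const (p := -β) (Or.inl h2)).congr_deriv ?_
    simp only [id]; ring
  · refine ContinuousOn.intervalIntegrable_of_Icc hr (continuousOn_const.mul ?_)
    refine ContinuousOn.rpow_const (by fun_prop) fun t ht => Or.inl ?_
    linarith [ht.2]

/-- Growth of the integral means of a quasiregular univalent harmonic mapping of order of growth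
`γ`. The maximum of `I(t) (1 - t)^{γp - 1}` on `[1/2, R]`, where `I(t) = 2π M_p(t, f)^p`, bounds
itself with a factor less than one. -/
lemma exists_meanPow_le {K A γ p : ℝ} (hA : 0 < A) (hγ : 0 < γ) (hγp : 1 < γ * p) (hK0 : 0 ≤ K) :
    ∃ C : ℝ, ∀ h g : ℂ → ℂ, UnivalentPair h g →
      (∀ z ∈ unitDisk, stretch h g z ^ 2 ≤ K * jac h g z) →
      (∀ z ∈ unitDisk, ‖hmap h g z‖ ≤ A * (1 - ‖z‖) ^ (-γ)) →
      ∀ r : ℝ, 1 / 2 ≤ r → r < 1 → meanPow h g p r ≤ C * (1 - r) ^ (-(γ * p - 1)) := by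
  -- the area integral has density `|w|^{q - 2}` and grows like `(1 - t)^{-γq} = (1 - t)^{-β}`
  set β := γ * p - 1 with hβ
  have hβ0 : 0 < β := by linarith
  have hp0 : 0 < p := pos_of_mul_pos_right (by linarith) hγ.le
  set q := p - 1 / γ with hq
  have hγq : γ * q = β := by rw [hq, hβ]; field_simp
  have hq0 : 0 < q := pos_of_mul_pos_right (by rw [hγq]; exact hβ0) hγ.le
  set c : ℝ := 2 * p ^ 2 * K * A ^ (1 / γ) / β with hc
  have hc0 : 0 ≤ c := by rw [hc]; positivity
  refine ⟨2 * (2 * Real.pi * (A * (1 / 2) ^ (-γ)) ^ p) + c * (2 * Real.pi * (A ^ q / q)),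
    fun h g hp hK hgrow R hR hR1 => ?_⟩
  have ha : (0 : ℝ) < 1 / 2 := by norm_num
  have hwc : ContinuousOn (fun t : ℝ => (1 - t) ^ β) (Icc (1 / 2) R) :=
    ContinuousOn.rpow_const (by fun_prop) fun t ht => Or.inr hβ0.le
  obtain ⟨T, hT, hmax⟩ := isCompact_Icc.exists_isMaxOn (nonempty_Icc.mpr hR)
    ((hp.continuousOn_meanPow p ha hR hR1).mul hwc)
  set S := meanPow h g p T * (1 - T) ^ β with hS
  have hT1 : T < 1 := hT.2.trans_lt hR1
  have h1T : 0 < 1 - T := by linarith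
  have hw : ∀ t : ℝ, t < 1 → (1 - t) ^ β * (1 - t) ^ (-β) = 1 := fun t ht => by
    rw [← Real.rpow_add (by linarith), add_neg_cancel, Real.rpow_zero]
  have hS0 : 0 ≤ S := by
    refine mul_nonneg (intervalIntegral.integral_nonneg (by positivity) fun θ _ => ?_) (by positivity)
    positivity
  have hmean : ∀ t ∈ Icc (1 / 2) R, meanPow h g p t ≤ S * (1 - t) ^ (-β) := by
    intro t ht
    have ht1 : 0 < 1 - t := by linarith [ht.2]
    calc meanPow h g p t = meanPow h g p t * (1 - t) ^ β * (1 - t) ^ (-β) := by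
          rw [mul_assoc, hw t (by linarith), mul_one]
      _ ≤ S * (1 - t) ^ (-β) := mul_le_mul_of_nonneg_right (hmax ht) (by positivity)
  have hinc := hp.meanPow_sub_le hA hγ hp0 hβ0 hK0 hK hgrow hT.1 hT1
  have harea := hp.area_rpow_le ha hT.1 hT1 hq0 (M := A * (1 - T) ^ (-γ)) (by
    intro z _ hz2
    have hz1 : ‖z‖ < 1 := hz2.trans_lt hT1
    refine (hgrow z (mem_unitDisk.mpr hz1)).trans ?_
    refine mul_le_mul_of_nonneg_left ?_ hA.le
    exact Real.rpow_le_rpow_of_nonpos h1T (by linarith) (by linarith))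
  have hMq : (A * (1 - T) ^ (-γ)) ^ q = A ^ q * (1 - T) ^ (-β) := by
    rw [Real.mul_rpow hA.le (by positivity), ← Real.rpow_mul h1T.le]
    congr 2
    rw [← hγq]; ring
  rw [hMq] at harea
  -- the integral to be absorbed is at most `S (1 - T)^{-β} = I(T)`, half of the left-hand side
  have habs : ∫ t in (1 / 2 : ℝ)..T, β / (1 - t) * meanPow h g p t ≤ S * (1 - T) ^ (-β) := by
    have h1 : ∫ t in (1 / 2 : ℝ)..T, β / (1 - t) * meanPow h g p t ≤
        ∫ t in (1 / 2 : ℝ)..T, S * (β * (1 - t) ^ (-β - 1)) := by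
      refine intervalIntegral.integral_mono_on hT.1 ?_ ?_ fun t ht => ?_
      · refine ContinuousOn.intervalIntegrable_of_Icc hT.1 (ContinuousOn.mul
          (ContinuousOn.div continuousOn_const (by fun_prop) fun t ht => ?_)
          (hp.continuousOn_meanPow p ha hT.1 hT1))
        linarith [ht.2]
      · refine ContinuousOn.intervalIntegrable_of_Icc hT.1 (continuousOn_const.mul
          (continuousOn_const.mul (ContinuousOn.rpow_const (by fun_prop) fun t ht => Or.inl ?_)))
        linarith [ht.2]
      · have ht1 : 0 < 1 - t := by linarith [ht.2]
        have h2 := hmean t ⟨ht.1, ht.2.trans hT.2⟩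
        calc β / (1 - t) * meanPow h g p t ≤ β / (1 - t) * (S * (1 - t) ^ (-β)) := by gcongr
          _ = _ := by rw [Real.rpow_sub_one ht1.ne']; ring
    rw [intervalIntegral.integral_const_mul, integral_const_div_one_sub_rpow hT.1 hT1] at h1
    refine h1.trans (mul_le_mul_of_nonneg_left ?_ hS0)
    have : (0 : ℝ) ≤ (1 / 2) ^ (-β) := by positivity
    linarith
  have hhalf : meanPow h g p (1 / 2) ≤ 2 * Real.pi * (A * (1 / 2) ^ (-γ)) ^ p := by
    have h1 := intervalIntegral.integral_mono_on (μ := volume) (a := 0) (b := 2 * Real.pi)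
      (f := fun θ => ‖hmap h g (circ (1 / 2) θ)‖ ^ p) (g := fun _ => (A * (1 / 2) ^ (-γ)) ^ p)
      (by positivity) (Continuous.intervalIntegrable
        ((hp.continuousOn_comp_norm (continuousOn_rpow_Ioi p) ha hR1).comp_continuous
          (f := fun θ => (1 / 2, θ)) (by fun_prop) fun θ => ⟨⟨le_rfl, hR⟩, mem_univ _⟩) _ _)
      intervalIntegrable_const (fun θ _ => by
        refine Real.rpow_le_rpow (norm_nonneg _) ?_ hp0.le
        have h2 := hgrow (circ (1 / 2) θ) (circ_mem_unitDisk ha.le (by norm_num))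
        rw [norm_circ, abs_of_pos ha] at h2
        norm_num at h2 ⊢
        exact h2)
    rw [intervalIntegral.integral_const, smul_eq_mul, sub_zero] at h1
    exact h1
  have hTβ1 : (1 - T) ^ β ≤ 1 := Real.rpow_le_one h1T.le (by linarith [hT.1]) hβ0.le
  have hhalf0 : (0 : ℝ) ≤ 2 * Real.pi * (A * (1 / 2) ^ (-γ)) ^ p := by positivity
  have h3 : 2 * meanPow h g p T ≤ 2 * (2 * Real.pi * (A * (1 / 2) ^ (-γ)) ^ p) +
      (S + c * (2 * Real.pi * (A ^ q / q))) * (1 - T) ^ (-β) := by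
    have h4 := mul_le_mul_of_nonneg_left harea hc0
    have h5 : c * (2 * Real.pi * (A ^ q * (1 - T) ^ (-β) / q)) =
        c * (2 * Real.pi * (A ^ q / q)) * (1 - T) ^ (-β) := by ring
    linarith
  have hTβ0 : 0 < (1 - T) ^ β := by positivity
  have h6 : 2 * S ≤ 2 * (2 * Real.pi * (A * (1 / 2) ^ (-γ)) ^ p) +
      (S + c * (2 * Real.pi * (A ^ q / q))) := by
    have h7 := mul_le_mul_of_nonneg_right h3 hTβ0.le
    rw [add_mul, mul_assoc (S + _), mul_comm ((1 - T) ^ (-β)), hw T hT1, mul_one] at h7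
    nlinarith
  refine (hmean R ⟨hR, le_rfl⟩).trans (mul_le_mul_of_nonneg_right (by linarith) ?_)
  have : 0 < 1 - R := by linarith
  positivity

end Means

/-! ### The second coefficient of an analytic univalent function -/

section Bieberbach

/-- A zero-free analytic function on the disk with value `1` at the origin has an analytic inverse
square root. -/
lemma exists_inv_sqrt {u : ℂ → ℂ} (du : DifferentiableOn ℂ u unitDisk)
    (hu : ∀ z ∈ unitDisk, u z ≠ 0) (hu0 : u 0 = 1) :
    ∃ s : ℂ → ℂ, DifferentiableOn ℂ s unitDisk ∧ s 0 = 1 ∧ ∀ z ∈ unitDisk, s z ^ 2 * u z = 1 := by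
  have hd : DifferentiableOn ℂ (fun z => deriv u z / u z) (Metric.ball 0 1) :=
    (du.deriv isOpen_unitDisk).div du hu
  obtain ⟨l, hl0, hl⟩ := hd.isExactOn_ball.with_val_at 0 0
  have hW : ∀ z ∈ unitDisk, HasDerivAt (fun z => Complex.exp (-l z / 2) ^ 2 * u z) 0 z := by
    intro z hz
    have h1 := (((hl z hz).neg.div_const 2).cexp.pow 2).mul
      (du.differentiableAt (isOpen_unitDisk.mem_nhds hz)).hasDerivAt
    refine h1.congr_deriv ?_
    have := hu z hz
    simp only [Pi.pow_apply]
    field_simp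
    push_cast
    ring
  refine ⟨fun z => Complex.exp (-l z / 2), fun z hz => ?_, by simp [hl0], fun z hz => ?_⟩
  · exact ((hl z hz).neg.div_const 2).cexp.differentiableAt.differentiableWithinAt
  · have := isOpen_unitDisk.is_const_of_deriv_eq_zero (convex_ball (0 : ℂ) 1).isPreconnected
      (fun w hw => (hW w hw).differentiableAt.differentiableWithinAt)
      (fun w hw => (hW w hw).deriv) hz zero_mem_unitDisk
    simpa [hl0, hu0] using this

/-- The functions `s = (h(z)/z)^{-1/2}` and `q = s - 2 z s'`. The identity `h' s³ = q` comes from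
differentiating `h s² = z`. -/
lemma exists_sqrt_transform {h : ℂ → ℂ} (hp : UnivalentPair h 0) :
    ∃ s q : ℂ → ℂ, DifferentiableOn ℂ s unitDisk ∧ DifferentiableOn ℂ q unitDisk ∧
      s 0 = 1 ∧ q 0 = 1 ∧ deriv s 0 = -deriv q 0 ∧ deriv (deriv h) 0 = 4 * deriv q 0 ∧
      (∀ z ∈ unitDisk, h z * s z ^ 2 = z) ∧ ∀ z ∈ unitDisk, deriv h z * s z ^ 3 = q z := by
  have hnhds := isOpen_unitDisk.mem_nhds zero_mem_unitDisk
  have hu : ∀ z, z * dslope h 0 z = h z := fun z => by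
    have := sub_smul_dslope h 0 z
    simpa [hp.h_zero] using this
  have hhm : ∀ z, hmap h 0 z = h z := fun z => by simp [hmap]
  obtain ⟨s, ds, s0, hs⟩ := exists_inv_sqrt (u := dslope h 0)
    ((Complex.differentiableOn_dslope hnhds).mpr hp.diff_h) (fun z hz hcon => by
      rcases eq_or_ne z 0 with rfl | hz0
      · rw [dslope_same, hp.deriv_h_zero] at hcon
        exact one_ne_zero hcon
      · refine hp.hmap_ne_zero hz hz0 ?_
        rw [hhm, ← hu z, hcon, mul_zero]) (by rw [dslope_same, hp.deriv_h_zero])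
  have hsz : ∀ z ∈ unitDisk, h z * s z ^ 2 = z := fun z hz => by
    rw [← hu z]
    linear_combination z * hs z hz
  have hs0 : ∀ z ∈ unitDisk, s z ≠ 0 := fun z hz hcon => by
    have := hs z hz
    rw [hcon] at this
    simp at this
  have dds := ds.deriv isOpen_unitDisk
  have dq : DifferentiableOn ℂ (fun z => s z - 2 * z * deriv s z) unitDisk :=
    ds.sub (((differentiableOn_const 2).mul differentiableOn_id).mul dds)
  have hq : ∀ z ∈ unitDisk, deriv h z * s z ^ 3 = s z - 2 * z * deriv s z := by
    intro z hz
    have hzn := isOpen_unitDisk.mem_nhds hz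
    have h1 := (hp.diff_h.differentiableAt hzn).hasDerivAt.mul
      ((ds.differentiableAt hzn).hasDerivAt.pow 2)
    have h2 : HasDerivAt (h * s ^ 2) 1 z := by
      refine (hasDerivAt_id z).congr_of_eventuallyEq ?_
      filter_upwards [hzn] with w hw
      simpa using hsz w hw
    have h3 := h1.unique h2
    simp only [Pi.pow_apply] at h3
    push_cast at h3
    linear_combination (s z) * h3 - 2 * deriv s z * hsz z hz
  have dq0 : deriv (fun z => s z - 2 * z * deriv s z) 0 = -deriv s 0 := by
    have h1 := (ds.differentiableAt hnhds).hasDerivAt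
    have h2 := (((hasDerivAt_id (0 : ℂ)).const_mul 2).mul (dds.differentiableAt hnhds).hasDerivAt)
    refine (h1.sub h2).deriv.trans ?_
    simp
    ring
  refine ⟨s, fun z => s z - 2 * z * deriv s z, ds, dq, s0, by simp [s0], by rw [dq0, neg_neg], ?_,
    hsz, hq⟩
  have h1 := (((hp.diff_h.deriv isOpen_unitDisk).differentiableAt hnhds).hasDerivAt.mul
    ((ds.differentiableAt hnhds).hasDerivAt.pow 3))
  have h2 : HasDerivAt (deriv h * s ^ 3) (deriv (fun z => s z - 2 * z * deriv s z) 0) 0 := by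
    refine (dq.differentiableAt hnhds).hasDerivAt.congr_of_eventuallyEq ?_
    filter_upwards [hnhds] with w hw
    simpa using hq w hw
  have h3 := h1.unique h2
  simp only [Pi.pow_apply, s0, hp.deriv_h_zero, dq0] at h3
  rw [dq0]
  push_cast at h3
  linear_combination h3

/-- Expansions near the origin of `|s|²` and `|q|²`. -/
lemma exists_local_estimates {s q : ℂ → ℂ} {κ : ℂ} (ds : DifferentiableOn ℂ s unitDisk)
    (dq : DifferentiableOn ℂ q unitDisk) (s0 : s 0 = 1) (q0 : q 0 = 1) (hκ : deriv s 0 = -κ) :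
    ∃ t₀ C : ℝ, 0 < t₀ ∧ t₀ < 1 ∧ 0 ≤ C ∧ ∀ z : ℂ, ‖z‖ ≤ t₀ →
      ‖s z‖ ^ 2 ≤ 1 - 2 * (κ * z).re + C * ‖z‖ ^ 2 ∧ ‖s z‖ ^ 2 ≤ 3 / 2 ∧
      1 - C * ‖z‖ ≤ ‖q z‖ ^ 2 := by
  have hnhds := isOpen_unitDisk.mem_nhds zero_mem_unitDisk
  have h1 := (((Complex.differentiableOn_dslope hnhds).mpr ds).differentiableAt hnhds).isBigO_sub
  obtain ⟨C₁, hC₁0, hC₁⟩ := h1.exists_pos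
  have h2 := (dq.differentiableAt hnhds).isBigO_sub
  obtain ⟨C₂, hC₂0, hC₂⟩ := h2.exists_pos
  have h3 : ∀ᶠ z in 𝓝 (0 : ℂ), ‖s z‖ ^ 2 < 3 / 2 := by
    have : Tendsto (fun z => ‖s z‖ ^ 2) (𝓝 0) (𝓝 (‖s 0‖ ^ 2)) :=
      (ds.differentiableAt hnhds).continuousAt.norm.pow 2
    rw [s0, norm_one, one_pow] at this
    exact this.eventually_lt_const (by norm_num)
  obtain ⟨r, hr, hball⟩ := Metric.eventually_nhds_iff_ball.mp
    ((hC₁.bound.and hC₂.bound).and h3)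
  refine ⟨min (r / 2) (1 / 2), 2 * C₂ + (‖κ‖ ^ 2 + 2 * (1 + ‖κ‖) * C₁ + C₁ ^ 2), by positivity,
    (min_le_right _ _).trans_lt (by norm_num), by positivity, fun z hz => ?_⟩
  have hz1 : ‖z‖ ≤ 1 := (hz.trans (min_le_right _ _)).trans (by norm_num)
  have hzr : z ∈ Metric.ball (0 : ℂ) r := by
    rw [mem_ball_zero_iff]
    exact (hz.trans (min_le_left _ _)).trans_lt (by linarith)
  obtain ⟨⟨h4, h5⟩, h6⟩ := hball z hzr
  rw [dslope_same, hκ, sub_zero] at h4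
  rw [q0, sub_zero] at h5
  have hz0 := norm_nonneg z
  have hκ0 := norm_nonneg κ
  refine ⟨?_, h6.le, ?_⟩
  · set e := z * (dslope s 0 z - -κ) with he
    have hse : s z = (1 - κ * z) + e := by
      have h7 := sub_smul_dslope s 0 z
      simp only [sub_zero, smul_eq_mul, s0] at h7
      rw [he]
      linear_combination -h7
    have hee : ‖e‖ ≤ C₁ * ‖z‖ ^ 2 := by
      rw [he, norm_mul]
      nlinarith
    have hn1 : ‖1 - κ * z‖ ≤ 1 + ‖κ‖ := by
      refine (norm_sub_le _ _).trans ?_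
      rw [norm_one, norm_mul]
      nlinarith
    have hsq : ‖1 - κ * z‖ ^ 2 = 1 - 2 * (κ * z).re + ‖κ‖ ^ 2 * ‖z‖ ^ 2 := by
      rw [← mul_pow, ← norm_mul, Complex.sq_norm, Complex.sq_norm, Complex.normSq_sub]
      simp
      ring
    have hs1 : ‖s z‖ ≤ ‖1 - κ * z‖ + ‖e‖ := by rw [hse]; exact norm_add_le _ _
    have hz4 : ‖z‖ ^ 2 * ‖z‖ ^ 2 ≤ 1 * ‖z‖ ^ 2 := by
      refine mul_le_mul_of_nonneg_right ?_ (sq_nonneg _)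
      nlinarith
    have he2 : ‖e‖ ^ 2 ≤ C₁ ^ 2 * ‖z‖ ^ 2 := by
      calc ‖e‖ ^ 2 ≤ (C₁ * ‖z‖ ^ 2) ^ 2 := by gcongr
        _ = C₁ ^ 2 * (‖z‖ ^ 2 * ‖z‖ ^ 2) := by ring
        _ ≤ C₁ ^ 2 * (1 * ‖z‖ ^ 2) := by gcongr
        _ = _ := by ring
    have hne : ‖1 - κ * z‖ * ‖e‖ ≤ (1 + ‖κ‖) * (C₁ * ‖z‖ ^ 2) := by gcongr
    calc ‖s z‖ ^ 2 ≤ (‖1 - κ * z‖ + ‖e‖) ^ 2 := by gcongr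
      _ = ‖1 - κ * z‖ ^ 2 + 2 * (‖1 - κ * z‖ * ‖e‖) + ‖e‖ ^ 2 := by ring
      _ ≤ _ := by
        have : 0 ≤ 2 * C₂ * ‖z‖ ^ 2 := by positivity
        rw [hsq]
        linarith
  · have h7 := norm_sub_norm_le (1 : ℂ) (q z)
    rw [norm_one, norm_sub_rev] at h7
    have h8 : 0 ≤ (‖κ‖ ^ 2 + 2 * (1 + ‖κ‖) * C₁ + C₁ ^ 2) * ‖z‖ := by positivity
    nlinarith [sq_nonneg (‖q z‖ - 1)]

/-- The first two terms of Parseval's identity. -/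
lemma parseval_le {q : ℂ → ℂ} (dq : DifferentiableOn ℂ q unitDisk) (q0 : q 0 = 1) {t : ℝ}
    (ht0 : 0 ≤ t) (ht : t < 1) :
    2 * Real.pi * (1 + ‖deriv q 0‖ ^ 2 * t ^ 2) ≤
      ∫ θ in (-Real.pi)..Real.pi, ‖q (circ t θ)‖ ^ 2 := by
  have hper : ∫ θ in (-Real.pi)..Real.pi, ‖q (circ t θ)‖ ^ 2 =
      ∫ θ in (0 : ℝ)..(2 * Real.pi), ‖q (circ t θ)‖ ^ 2 := by
    have hP : Function.Periodic (fun θ => ‖q (circ t θ)‖ ^ 2) (2 * Real.pi) := fun θ => by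
      simp only [circ_periodic t θ]
    have := hP.intervalIntegral_add_eq (-Real.pi) 0
    rw [zero_add] at this
    rw [← this]
    congr 1
    ring
  rw [hper]
  set κ := deriv q 0 with hκ
  have hcc : Continuous fun θ => circ t θ := by unfold circ; fun_prop
  have hqc : Continuous fun θ => q (circ t θ) :=
    dq.continuousOn.comp_continuous hcc fun θ => circ_mem_unitDisk ht0 ht
  have ha := hasTaylorCoeffs_taylor dq
  have i0 := ha.integral_circ_nat ht0 ht 0
  have i1 := ha.integral_circ_nat ht0 ht 1
  have i2 := integral_exp_int 1
  simp [q0, iteratedDeriv_zero, iteratedDeriv_one] at i0 i1 i2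
  rw [← hκ] at i1
  -- `|q|² ≥ 2 Re (q conj Q) - |Q|²` with `Q = 1 + κ z`
  have hpt : ∀ θ : ℝ, (2 * (q (circ t θ) + conj κ * t * (q (circ t θ) *
      Complex.exp (-(Complex.I * θ)))) - 2 * (κ * t * Complex.exp (Complex.I * θ))).re -
      (1 + ‖κ‖ ^ 2 * t ^ 2) ≤ ‖q (circ t θ)‖ ^ 2 := by
    intro θ
    set Q : ℂ := 1 + κ * circ t θ with hQ
    have h1 : 0 ≤ ‖q (circ t θ) - Q‖ ^ 2 := sq_nonneg _
    rw [Complex.sq_norm, Complex.normSq_sub, ← Complex.sq_norm, ← Complex.sq_norm] at h1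
    have hce : circ t θ = t * Complex.exp (Complex.I * θ) := by rw [circ, mul_comm (θ : ℂ)]
    have hcc : conj (circ t θ) = t * Complex.exp (-(Complex.I * θ)) := by
      rw [hce, map_mul, ← Complex.exp_conj, map_mul, Complex.conj_I, Complex.conj_ofReal,
        Complex.conj_ofReal, neg_mul]
    have hQ2 : ‖Q‖ ^ 2 = 1 + ‖κ‖ ^ 2 * t ^ 2 + 2 * (κ * t * Complex.exp (Complex.I * θ)).re := by
      rw [hQ, Complex.sq_norm, Complex.normSq_add, ← Complex.sq_norm, ← Complex.sq_norm, norm_mul,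
        norm_circ, mul_pow, sq_abs, hce]
      simp [mul_assoc]
    have hqQ : (q (circ t θ) * conj Q).re = (q (circ t θ) + conj κ * t * (q (circ t θ) *
        Complex.exp (-(Complex.I * θ)))).re := by
      rw [hQ, map_add, map_mul, map_one, hcc]
      congr 1
      ring
    rw [hQ2, hqQ] at h1
    have e1 : ∀ A B : ℂ, (2 * A - 2 * B).re = 2 * A.re - 2 * B.re := fun A B => by
      simp
    rw [e1]
    linarith
  have c1 : IntervalIntegrable (fun θ : ℝ => q (circ t θ)) volume 0 (2 * Real.pi) :=
    hqc.intervalIntegrable _ _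
  have c2 : IntervalIntegrable (fun θ : ℝ => q (circ t θ) * Complex.exp (-(Complex.I * θ))) volume 0
      (2 * Real.pi) := (hqc.mul (by fun_prop)).intervalIntegrable _ _
  have c3 : IntervalIntegrable (fun θ : ℝ => κ * t * Complex.exp (Complex.I * θ)) volume 0
      (2 * Real.pi) := Continuous.intervalIntegrable (by fun_prop) _ _
  have c4 := ((c1.add (c2.const_mul (conj κ * t))).const_mul 2).sub (c3.const_mul 2)
  have hval : ∫ θ in (0 : ℝ)..(2 * Real.pi), (2 * (q (circ t θ) + conj κ * t * (q (circ t θ) *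
      Complex.exp (-(Complex.I * θ)))) - 2 * (κ * t * Complex.exp (Complex.I * θ))) =
      ((2 * (2 * Real.pi) * (1 + ‖κ‖ ^ 2 * t ^ 2) : ℝ) : ℂ) := by
    rw [intervalIntegral.integral_sub ((c1.add (c2.const_mul (conj κ * t))).const_mul 2)
      (c3.const_mul 2), intervalIntegral.integral_const_mul, intervalIntegral.integral_const_mul,
      intervalIntegral.integral_const_mul, intervalIntegral.integral_add c1
      (c2.const_mul (conj κ * t)), intervalIntegral.integral_const_mul, i0, i1, i2]
    have : (‖κ‖ ^ 2 : ℂ) = κ * conj κ := by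
      rw [Complex.mul_conj, Complex.normSq_eq_norm_sq]; push_cast; rfl
    push_cast
    rw [this]
    ring
  have hre := intervalIntegral.intervalIntegral_re c4
  have hc4 : IntervalIntegrable (fun θ : ℝ => (2 * (q (circ t θ) + conj κ * t * (q (circ t θ) *
      Complex.exp (-(Complex.I * θ)))) - 2 * (κ * t * Complex.exp (Complex.I * θ))).re) volume 0
      (2 * Real.pi) :=
    Continuous.intervalIntegrable (Complex.continuous_re.comp ((continuous_const.mul
      (hqc.add (continuous_const.mul (hqc.mul (by fun_prop))))).sub (by fun_prop))) _ _
  have hmain := intervalIntegral.integral_mono_on (μ := volume) (a := 0) (b := 2 * Real.pi)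
    (by positivity) (hc4.sub intervalIntegrable_const)
    ((hqc.norm.pow 2).intervalIntegrable _ _) (fun θ _ => hpt θ)
  rw [intervalIntegral.integral_sub hc4 intervalIntegrable_const,
    intervalIntegral.integral_const] at hmain
  have hre' : ∫ θ in (0 : ℝ)..(2 * Real.pi), (2 * (q (circ t θ) + conj κ * t * (q (circ t θ) *
      Complex.exp (-(Complex.I * θ)))) - 2 * (κ * t * Complex.exp (Complex.I * θ))).re =
      2 * (2 * Real.pi) * (1 + ‖κ‖ ^ 2 * t ^ 2) := by
    refine Eq.trans hre ?_
    refine (congrArg Complex.re hval).trans ?_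
    exact Complex.ofReal_re _
  rw [hre', smul_eq_mul, sub_zero] at hmain
  refine le_trans (le_of_eq ?_) hmain
  ring

lemma integral_inv_sq {a b : ℝ} (ha : 0 < a) (hab : a ≤ b) :
    ∫ t in a..b, (t ^ 2)⁻¹ = a⁻¹ - b⁻¹ := by
  have h1 := intervalIntegral.integral_eq_sub_of_hasDerivAt (a := a) (b := b)
    (f := fun t : ℝ => -t⁻¹) (f' := fun t => (t ^ 2)⁻¹) ?_ ?_
  · rw [h1]; ring
  · intro t ht
    rw [uIcc_of_le hab] at ht
    refine (hasDerivAt_inv (ha.trans_le ht.1).ne').neg.congr_deriv (neg_neg _)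
  · refine ContinuousOn.intervalIntegrable_of_Icc hab (ContinuousOn.inv₀ (by fun_prop) ?_)
    exact fun t ht => pow_ne_zero 2 (ha.trans_le ht.1).ne'

lemma lintegral_truncated_inv_cube {σ : ℝ} (hσ : 0 < σ) :
    ∫⁻ s in Ioi (0 : ℝ), ENNReal.ofReal s *
      (Ioi σ).indicator (fun s => ENNReal.ofReal (s ^ 3)⁻¹) s = ENNReal.ofReal σ⁻¹ := by
  have hd : ∀ s ∈ Ici σ, HasDerivAt (fun t : ℝ => -t⁻¹) ((s ^ 2)⁻¹) s := fun s hs =>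
    (hasDerivAt_inv (hσ.trans_le hs).ne').neg.congr_deriv (neg_neg _)
  have hl : Tendsto (fun t : ℝ => -t⁻¹) atTop (𝓝 0) := by
    simpa using tendsto_inv_atTop_zero.neg (G := ℝ)
  have h0 : ∀ s ∈ Ioi σ, (0 : ℝ) ≤ (s ^ 2)⁻¹ := fun s _ => by positivity
  have heq := integral_Ioi_of_hasDerivAt_of_nonneg' hd h0 hl
  rw [zero_sub, neg_neg] at heq
  rw [← heq, ofReal_integral_eq_lintegral_ofReal (integrableOn_Ioi_deriv_of_nonneg' hd h0 hl)
    (by filter_upwards [ae_restrict_mem measurableSet_Ioi] with s hs using h0 s hs)]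
  have h1 : ∀ s : ℝ, ENNReal.ofReal s * (Ioi σ).indicator (fun s => ENNReal.ofReal (s ^ 3)⁻¹) s =
      (Ioi σ).indicator (fun s => ENNReal.ofReal (s ^ 2)⁻¹) s := by
    intro s
    by_cases hs : s ∈ Ioi σ
    · have hs0 : 0 < s := hσ.trans hs
      rw [indicator_of_mem hs, indicator_of_mem hs, ← ENNReal.ofReal_mul hs0.le]
      congr 1
      field_simp
    · rw [indicator_of_notMem hs, indicator_of_notMem hs, mul_zero]
  simp only [h1]
  rw [setLIntegral_indicator measurableSet_Ioi, inter_eq_self_of_subset_left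
    (Ioi_subset_Ioi hσ.le)]

lemma integral_re_mul_exp (κ : ℂ) :
    ∫ θ in (-Real.pi)..Real.pi, (κ * Complex.exp (θ * Complex.I)).re = 0 := by
  have hP : Function.Periodic (fun θ : ℝ => (κ * Complex.exp (θ * Complex.I)).re)
      (2 * Real.pi) := by
    intro θ
    have := circ_periodic 1 θ
    simp only [circ, Complex.ofReal_one, one_mul] at this
    simp only [this]
  have h1 := hP.intervalIntegral_add_eq (-Real.pi) 0
  rw [zero_add, show -Real.pi + 2 * Real.pi = Real.pi by ring] at h1
  rw [h1]
  have hc : IntervalIntegrable (fun θ : ℝ => κ * Complex.exp (θ * Complex.I)) volume 0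
      (2 * Real.pi) := Continuous.intervalIntegrable (by fun_prop) _ _
  refine (intervalIntegral.intervalIntegral_re hc).trans ?_
  have h2 := integral_exp_int 1
  simp only [Int.cast_one, one_mul, one_ne_zero, if_false] at h2
  simp only [mul_comm _ Complex.I]
  rw [intervalIntegral.integral_const_mul, h2, mul_zero]
  rfl

/-- The area inequality behind Bieberbach's theorem, before passing to the limit. The area of
`{|w| > σ}` in the metric `|w|^{-3/2} |dw|` is `2π / σ`, and the part of it covered by the image of
the disk of radius `r` is bounded below through the Fourier expansion of `q`. Both sides have the
leading term `2π / σ`, so the inverse inner radius of `{|h| > σ}` has to be known, in each direction,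
up to an error of order `σ`. -/
lemma area_inequality {h s q : ℂ → ℂ} {κ : ℂ} {t₀ C : ℝ} (hp : UnivalentPair h 0)
    (dq : DifferentiableOn ℂ q unitDisk) (q0 : q 0 = 1) (hκ : deriv q 0 = κ)
    (hs : ∀ z ∈ unitDisk, h z * s z ^ 2 = z) (hq : ∀ z ∈ unitDisk, deriv h z * s z ^ 3 = q z)
    (ht₀ : 0 < t₀) (ht₀1 : t₀ < 1) (hC : 0 ≤ C)
    (hloc : ∀ z : ℂ, ‖z‖ ≤ t₀ → ‖s z‖ ^ 2 ≤ 1 - 2 * (κ * z).re + C * ‖z‖ ^ 2 ∧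
      ‖s z‖ ^ 2 ≤ 3 / 2 ∧ 1 - C * ‖z‖ ≤ ‖q z‖ ^ 2)
    {σ r : ℝ} (hσ : 0 < σ) (hσ1 : σ ≤ 1) (hσt : 2 * σ ≤ t₀) (hσr : 2 * σ ≤ r) (hr : r < 1)
    (hσC : σ * (4 * ‖κ‖ + 4 * C) ≤ 1) :
    ‖κ‖ ^ 2 * (r - 2 * σ) ≤ 1 / r + σ * (2 * C + 4 * C * ‖κ‖) := by
  have hκ0 := norm_nonneg κ
  have hpi := Real.pi_pos
  have hpile : -Real.pi ≤ Real.pi := by linarith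
  have hr0 : 0 < r := by linarith
  -- `x θ` is the reciprocal of the inner radius of the region, `y` a lower bound for it
  set x : ℝ → ℝ := fun θ => σ⁻¹ + 2 * (κ * Complex.exp (θ * Complex.I)).re - 2 * C * σ with hx
  set y : ℝ := σ⁻¹ - 2 * ‖κ‖ - 2 * C * σ with hy
  have hxc : Continuous x := by rw [hx]; fun_prop
  have hyσ : (2 * σ)⁻¹ ≤ y := by
    have h1 : (2 * σ)⁻¹ = σ⁻¹ / 2 := by rw [mul_inv]; ring
    have h2 : (4 * ‖κ‖ + 4 * C) ≤ σ⁻¹ := by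
      rw [← one_div, le_div_iff₀ hσ, mul_comm]; exact hσC
    have h3 : C * σ ≤ C * 1 := by gcongr
    rw [h1, hy]
    linarith
  have hy0 : 0 < y := lt_of_lt_of_le (by positivity) hyσ
  have hyx : ∀ θ, y ≤ x θ := fun θ => by
    have h1 := (abs_le.mp (Complex.abs_re_le_norm (κ * Complex.exp (θ * Complex.I)))).1
    rw [norm_mul, Complex.norm_exp_ofReal_mul_I, mul_one] at h1
    simp only [hx, hy]
    linarith
  have hx0 : ∀ θ, 0 < x θ := fun θ => hy0.trans_le (hyx θ)
  set τ := y⁻¹ with hτ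
  have hτ0 : 0 < τ := inv_pos.mpr hy0
  have hτσ : τ ≤ 2 * σ := by
    rw [hτ]; exact inv_le_of_inv_le₀ (by positivity) hyσ
  have hτr : τ ≤ r := hτσ.trans hσr
  have hρτ : ∀ θ, (x θ)⁻¹ ≤ τ := fun θ => inv_anti₀ hy0 (hyx θ)
  have hρ0 : ∀ θ, 0 < (x θ)⁻¹ := fun θ => inv_pos.mpr (hx0 θ)
  have hhm : ∀ z, hmap h 0 z = h z := fun z => by simp [hmap]
  have hnh : ∀ z ∈ unitDisk, ‖h z‖ * ‖s z‖ ^ 2 = ‖z‖ := fun z hz => by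
    rw [← norm_pow, ← norm_mul, hs z hz]
  -- on the region, `|h| > σ`
  have hbig : ∀ θ t, (x θ)⁻¹ < t → t ≤ r → σ < ‖h (circ t θ)‖ := by
    intro θ t hxt htr
    have ht0 : 0 < t := (hρ0 θ).trans hxt
    have hD : circ t θ ∈ unitDisk := circ_mem_unitDisk ht0.le (htr.trans_lt hr)
    have hnorm : ‖circ t θ‖ = t := by rw [norm_circ, abs_of_pos ht0]
    rcases le_or_gt t t₀ with htt | htt
    · have h1 := hnh _ hD
      obtain ⟨h2, h3, -⟩ := hloc (circ t θ) (by rw [hnorm]; exact htt)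
      rw [hnorm] at h1 h2
      have hs2 : 0 ≤ ‖s (circ t θ)‖ ^ 2 := sq_nonneg _
      by_contra! hcon
      have h4 : t ≤ σ * ‖s (circ t θ)‖ ^ 2 :=
        h1.symm.le.trans (mul_le_mul_of_nonneg_right hcon hs2)
      have ht2σ : t ≤ 2 * σ := by nlinarith
      have hre : (κ * circ t θ).re = t * (κ * Complex.exp (θ * Complex.I)).re := by
        rw [circ, ← Complex.re_ofReal_mul]; congr 1; ring
      rw [hre] at h2
      have h5 : 1 < t * x θ := by
        rwa [inv_lt_iff_one_lt_mul₀ (hx0 θ)] at hxt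
      simp only [hx] at h5
      set k := (κ * Complex.exp (θ * Complex.I)).re with hk
      have h6 : σ * 1 < t + 2 * (σ * t * k) - 2 * C * (σ * (σ * t)) := by
        have h7 := mul_lt_mul_of_pos_left h5 hσ
        have h8 : σ * (t * (σ⁻¹ + 2 * k - 2 * C * σ)) =
            t + 2 * (σ * t * k) - 2 * C * (σ * (σ * t)) := by
          field_simp
        rwa [h8] at h7
      have h9 : σ * ‖s (circ t θ)‖ ^ 2 ≤ σ * (1 - 2 * (t * k) + C * t ^ 2) := by gcongr
      have h10 : C * (σ * t * t) ≤ C * (σ * t * (2 * σ)) := by gcongr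
      nlinarith
    · have h1 := hp.le_norm_of_le_norm_sphere ht₀ ht₀1 (m := 2 / 3 * t₀) (fun z hz => ?_) hD
        (by rw [hnorm]; exact htt.le)
      · rw [hhm] at h1
        linarith
      · have hzD : z ∈ unitDisk := mem_unitDisk.mpr (by rw [hz]; exact ht₀1)
        have h2 := hnh z hzD
        have h3 := (hloc z hz.le).2.1
        rw [hhm]
        rw [hz] at h2
        nlinarith [norm_nonneg (h z)]
  -- the area inequality in polar coordinates
  set S : Set ℂ := Metric.closedBall 0 r with hS
  set φ : ℝ → ENNReal := (Ioi σ).indicator fun s => ENNReal.ofReal (s ^ 3)⁻¹ with hφ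
  have hφm : Measurable φ := by
    refine Measurable.indicator ?_ measurableSet_Ioi
    exact ENNReal.measurable_ofReal.comp (by fun_prop)
  have harea := lintegral_polar_area_le hp (S := S) measurableSet_closedBall
    (closedBall_subset_unitDisk hr) hφm
  rw [hφ, lintegral_truncated_inv_cube hσ, ← hφ, ← ENNReal.ofReal_mul (by positivity)] at harea
  set F : ℝ → ℝ → ℝ := fun t θ => (t ^ 2)⁻¹ * ‖q (circ t θ)‖ ^ 2 with hF
  have hFc : ∀ a, 0 < a → ContinuousOn (Function.uncurry F) (Icc a r ×ˢ univ) := fun a ha => by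
    refine ContinuousOn.mul (ContinuousOn.inv₀ (continuousOn_fst.pow 2) ?_)
      ((continuousOn_circ_comp dq.continuousOn.norm ha.le hr).pow 2)
    rintro ⟨t, θ⟩ ⟨ht, -⟩
    exact pow_ne_zero 2 (ha.trans_le ht.1).ne'
  have hFi : ∀ θ a b, 0 < a → a ≤ b → b ≤ r →
      IntervalIntegrable (fun t => F t θ) volume a b := fun θ a b ha hab hb =>
    ContinuousOn.intervalIntegrable_of_Icc hab ((hFc a ha).comp (f := fun t => (t, θ))
      (by fun_prop) fun t ht => ⟨⟨ht.1, ht.2.trans hb⟩, mem_univ _⟩)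
  have hF0 : ∀ t θ, 0 ≤ F t θ := fun t θ => by simp only [hF]; positivity
  set P : ℝ → ℝ := fun θ => (∫ t in τ..r, F t θ) + (1 - 2 * C * σ) * (x θ - y) with hP
  have hPc : Continuous P :=
    (continuousOn_integral_strip' hτr (hFc τ hτ0)).add
      (continuous_const.mul (hxc.sub continuous_const))
  have hCσ : 0 ≤ 1 - 2 * C * σ := by nlinarith
  have hP0 : ∀ θ, 0 ≤ P θ := fun θ =>
    add_nonneg (intervalIntegral.integral_nonneg hτr fun t _ => hF0 t θ)
      (mul_nonneg hCσ (sub_nonneg.mpr (hyx θ)))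
  -- the contribution of one ray; between `1 / x θ` and `τ` the bound `|q|² ≥ 1 - O(σ)` is enough
  have hray : ∀ θ, ENNReal.ofReal (P θ) ≤ ∫⁻ t in Ioi (0 : ℝ), ENNReal.ofReal t *
      S.indicator (fun z => ENNReal.ofReal (jac h 0 z) * φ ‖hmap h 0 z‖) (circ t θ) := by
    intro θ
    have hρr := (hρτ θ).trans hτr
    have h1 : P θ ≤ ∫ t in (x θ)⁻¹..r, F t θ := by
      rw [← intervalIntegral.integral_add_adjacent_intervals
        (hFi θ _ _ (hρ0 θ) (hρτ θ) hτr) (hFi θ _ _ hτ0 hτr le_rfl), add_comm]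
      simp only [hP]
      refine add_le_add_right ?_ _
      have h2 : ∫ t in (x θ)⁻¹..τ, (1 - 2 * C * σ) * (t ^ 2)⁻¹ ≤ ∫ t in (x θ)⁻¹..τ, F t θ := by
        refine intervalIntegral.integral_mono_on (hρτ θ) ?_ (hFi θ _ _ (hρ0 θ) (hρτ θ) hτr) ?_
        · refine ContinuousOn.intervalIntegrable_of_Icc (hρτ θ)
            (continuousOn_const.mul (ContinuousOn.inv₀ (by fun_prop) ?_))
          exact fun t ht => pow_ne_zero 2 ((hρ0 θ).trans_le ht.1).ne'
        · intro t ht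
          have ht0 : 0 < t := (hρ0 θ).trans_le ht.1
          have hnorm : ‖circ t θ‖ = t := by rw [norm_circ, abs_of_pos ht0]
          have ht2 : t ≤ 2 * σ := ht.2.trans hτσ
          have h3 := (hloc (circ t θ) (by rw [hnorm]; exact ht2.trans hσt)).2.2
          rw [hnorm] at h3
          simp only [hF]
          rw [mul_comm]
          refine mul_le_mul_of_nonneg_left (le_trans ?_ h3) (by positivity)
          nlinarith
      rw [intervalIntegral.integral_const_mul, integral_inv_sq (hρ0 θ) (hρτ θ), inv_inv, hτ,
        inv_inv] at h2
      exact h2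
    refine (ENNReal.ofReal_le_ofReal h1).trans ?_
    rw [intervalIntegral.integral_of_le hρr, ofReal_integral_eq_lintegral_ofReal
      ((intervalIntegrable_iff_integrableOn_Ioc_of_le hρr).mp (hFi θ _ _ (hρ0 θ) hρr le_rfl))
      (ae_of_all _ fun t => hF0 t θ)]
    refine (setLIntegral_mono' measurableSet_Ioc fun t ht => ?_).trans
      (lintegral_mono_set fun t ht => mem_Ioi.mpr ((hρ0 θ).trans ht.1))
    have ht0 : 0 < t := (hρ0 θ).trans ht.1
    have hnorm : ‖circ t θ‖ = t := by rw [norm_circ, abs_of_pos ht0]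
    have hzS : circ t θ ∈ S := mem_closedBall_zero_iff.mpr (by rw [hnorm]; exact ht.2)
    have hD : circ t θ ∈ unitDisk := closedBall_subset_unitDisk hr hzS
    have hb := hbig θ t ht.1 ht.2
    have hb0 : 0 < ‖h (circ t θ)‖ := hσ.trans hb
    rw [indicator_of_mem hzS, hhm, hφ, indicator_of_mem (mem_Ioi.mpr hb),
      ← ENNReal.ofReal_mul (hp.jac_pos hD).le, ← ENNReal.ofReal_mul ht0.le]
    refine ENNReal.ofReal_le_ofReal (le_of_eq ?_)
    have e1 := hnh _ hD
    rw [hnorm] at e1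
    have e2 : ‖q (circ t θ)‖ = ‖deriv h (circ t θ)‖ * ‖s (circ t θ)‖ ^ 3 := by
      rw [← hq _ hD, norm_mul, norm_pow]
    have e3 : jac h 0 (circ t θ) = ‖deriv h (circ t θ)‖ ^ 2 := by
      have : deriv (0 : ℂ → ℂ) = 0 := by ext z; exact deriv_const z (0 : ℂ)
      simp [jac, this]
    have hsp : 0 < ‖s (circ t θ)‖ := by
      by_contra! hcon
      have : ‖s (circ t θ)‖ = 0 := le_antisymm hcon (norm_nonneg _)
      rw [this] at e1
      simp at e1
      linarith
    simp only [hF]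
    rw [e2, e3]
    generalize ‖h (circ t θ)‖ = A at *
    generalize ‖s (circ t θ)‖ = B at *
    rw [inv_mul_eq_iff_eq_mul₀ (by positivity)]
    field_simp
    linear_combination ‖deriv h (circ t θ)‖ ^ 2 *
      (t ^ 2 + t * (A * B ^ 2) + (A * B ^ 2) ^ 2) * e1
  have htotal : ∫ θ in (-Real.pi)..Real.pi, P θ ≤ 2 * Real.pi * σ⁻¹ := by
    rw [← ENNReal.ofReal_le_ofReal_iff (by positivity), intervalIntegral.integral_of_le hpile,
      ofReal_integral_eq_lintegral_ofReal hPc.integrableOn_Ioc (ae_of_all _ hP0),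
      setLIntegral_congr Ioo_ae_eq_Ioc.symm]
    exact (lintegral_mono fun θ => hray θ).trans harea
  -- on `t ≥ τ`, Parseval's inequality for `q`
  have hA : 2 * Real.pi * (y - r⁻¹ + ‖κ‖ ^ 2 * (r - τ)) ≤
      ∫ θ in (-Real.pi)..Real.pi, ∫ t in τ..r, F t θ := by
    rw [integral_swap_strip hτr hpile (hFc τ hτ0)]
    have hii : IntervalIntegrable (fun t : ℝ => (t ^ 2)⁻¹) volume τ r := by
      refine ContinuousOn.intervalIntegrable_of_Icc hτr (ContinuousOn.inv₀ (by fun_prop) ?_)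
      exact fun t ht => pow_ne_zero 2 (hτ0.trans_le ht.1).ne'
    have h1 : ∫ t in τ..r, 2 * Real.pi * ((t ^ 2)⁻¹ + ‖κ‖ ^ 2) ≤
        ∫ t in τ..r, ∫ θ in (-Real.pi)..Real.pi, F t θ := by
      refine intervalIntegral.integral_mono_on hτr
        ((hii.add intervalIntegrable_const).const_mul _)
        ((continuousOn_integral_strip hτr (hFc τ hτ0)).intervalIntegrable_of_Icc hτr) ?_
      intro t ht
      have ht0 : 0 < t := hτ0.trans_le ht.1
      have h2 := parseval_le dq q0 ht0.le (ht.2.trans_lt hr)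
      rw [hκ] at h2
      simp only [hF]
      rw [intervalIntegral.integral_const_mul]
      calc _ = (t ^ 2)⁻¹ * (2 * Real.pi * (1 + ‖κ‖ ^ 2 * t ^ 2)) := by field_simp
        _ ≤ _ := by gcongr
    refine le_trans (le_of_eq ?_) h1
    rw [intervalIntegral.integral_const_mul, intervalIntegral.integral_add hii
      intervalIntegrable_const, integral_inv_sq hτ0 hτr, intervalIntegral.integral_const, hτ,
      inv_inv, smul_eq_mul]
    ring
  -- the angular part of `x θ` has mean zero
  have hB : ∫ θ in (-Real.pi)..Real.pi, (1 - 2 * C * σ) * (x θ - y) =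
      2 * Real.pi * ((1 - 2 * C * σ) * (2 * ‖κ‖)) := by
    have h1 : ∀ θ, x θ - y = 2 * (κ * Complex.exp (θ * Complex.I)).re + 2 * ‖κ‖ := fun θ => by
      simp only [hx, hy]; ring
    simp only [h1]
    rw [intervalIntegral.integral_const_mul, intervalIntegral.integral_add
      (Continuous.intervalIntegrable (by fun_prop) _ _) intervalIntegrable_const,
      intervalIntegral.integral_const_mul, integral_re_mul_exp, intervalIntegral.integral_const,
      smul_eq_mul]
    ring
  have hPint : ∫ θ in (-Real.pi)..Real.pi, P θ =
      (∫ θ in (-Real.pi)..Real.pi, ∫ t in τ..r, F t θ) +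
        ∫ θ in (-Real.pi)..Real.pi, (1 - 2 * C * σ) * (x θ - y) :=
    intervalIntegral.integral_add
      ((continuousOn_integral_strip' hτr (hFc τ hτ0)).intervalIntegrable _ _)
      ((continuous_const.mul (hxc.sub continuous_const)).intervalIntegrable _ _)
  rw [hPint, hB] at htotal
  have hfin : (y - r⁻¹ + ‖κ‖ ^ 2 * (r - τ)) + (1 - 2 * C * σ) * (2 * ‖κ‖) ≤ σ⁻¹ := by
    refine le_of_mul_le_mul_left (a := 2 * Real.pi) ?_ (by positivity)
    linarith
  have h7 : ‖κ‖ ^ 2 * (r - 2 * σ) ≤ ‖κ‖ ^ 2 * (r - τ) := by gcongr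
  rw [hy] at hfin
  rw [one_div]
  linarith

/-- **Bieberbach's theorem** on the second coefficient: in the area inequality `σ → 0` and then
`r → 1`. -/
theorem UnivalentPair.norm_deriv_deriv_le_four {h : ℂ → ℂ} (hp : UnivalentPair h 0) :
    ‖deriv (deriv h) 0‖ ≤ 4 := by
  obtain ⟨s, q, ds, dq, s0, q0, hsq, hhq, hs, hq⟩ := exists_sqrt_transform hp
  obtain ⟨t₀, C, ht₀, ht₀1, hC, hloc⟩ := exists_local_estimates ds dq s0 q0 hsq
  set κ := deriv q 0 with hκ
  have hr : ∀ r : ℝ, 0 < r → r < 1 → ‖κ‖ ^ 2 * r ≤ 1 / r := by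
    intro r hr0 hr1
    have hev : ∀ᶠ σ in 𝓝[>] (0 : ℝ),
        ‖κ‖ ^ 2 * (r - 2 * σ) ≤ 1 / r + σ * (2 * C + 4 * C * ‖κ‖) := by
      have e1 : ∀ᶠ σ in 𝓝[>] (0 : ℝ), σ < 1 := by
        exact (eventually_lt_nhds one_pos).filter_mono nhdsWithin_le_nhds
      have e2 : ∀ᶠ σ in 𝓝[>] (0 : ℝ), σ < t₀ / 2 :=
        (eventually_lt_nhds (by positivity)).filter_mono nhdsWithin_le_nhds
      have e3 : ∀ᶠ σ in 𝓝[>] (0 : ℝ), σ < r / 2 :=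
        (eventually_lt_nhds (by positivity)).filter_mono nhdsWithin_le_nhds
      have e4 : ∀ᶠ σ in 𝓝[>] (0 : ℝ), σ < 1 / (4 * ‖κ‖ + 4 * C + 1) :=
        (eventually_lt_nhds (by positivity)).filter_mono nhdsWithin_le_nhds
      filter_upwards [self_mem_nhdsWithin, e1, e2, e3, e4] with σ hσ h1 h2 h3 h4
      have hσ0 : 0 < σ := hσ
      refine area_inequality hp dq q0 rfl hs hq ht₀ ht₀1 hC hloc hσ0 h1.le (by linarith)
        (by linarith) hr1 ?_
      rw [lt_div_iff₀ (by positivity)] at h4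
      linarith
    have hl : Tendsto (fun σ : ℝ => ‖κ‖ ^ 2 * (r - 2 * σ)) (𝓝[>] 0) (𝓝 (‖κ‖ ^ 2 * r)) := by
      have : Continuous fun σ : ℝ => ‖κ‖ ^ 2 * (r - 2 * σ) := by fun_prop
      simpa using (this.tendsto 0).mono_left nhdsWithin_le_nhds
    have hl2 : Tendsto (fun σ : ℝ => 1 / r + σ * (2 * C + 4 * C * ‖κ‖)) (𝓝[>] 0) (𝓝 (1 / r)) := by
      have : Continuous fun σ : ℝ => 1 / r + σ * (2 * C + 4 * C * ‖κ‖) := by fun_prop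
      simpa using (this.tendsto 0).mono_left nhdsWithin_le_nhds
    exact le_of_tendsto_of_tendsto hl hl2 hev
  have hκ1 : ‖κ‖ ^ 2 * 1 ≤ 1 / 1 := by
    have hev : ∀ᶠ r in 𝓝[<] (1 : ℝ), ‖κ‖ ^ 2 * r ≤ 1 / r := by
      filter_upwards [self_mem_nhdsWithin,
        (eventually_gt_nhds (zero_lt_one (α := ℝ))).filter_mono nhdsWithin_le_nhds] with r h1 h2
      exact hr r h2 h1
    refine le_of_tendsto_of_tendsto (b := 𝓝[<] (1 : ℝ)) ?_ ?_ hev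
    · exact (tendsto_const_nhds.mul tendsto_id).mono_left nhdsWithin_le_nhds
    · exact (tendsto_const_nhds.div tendsto_id one_ne_zero).mono_left nhdsWithin_le_nhds
  have hκ2 : ‖κ‖ ≤ 1 := by
    rw [mul_one, div_one] at hκ1
    exact (sq_le_one_iff₀ (norm_nonneg _)).mp hκ1
  rw [hhq, norm_mul, Complex.norm_ofNat]
  linarith

end Bieberbach

/-! ### The quasiregular classes and the Koebe function -/

/-- A function whose real derivative is bounded on compact subsets is Lipschitz on rectangles, hence
absolutely continuous on all their horizontal and vertical segments. -/
lemma isACL_of_hasFDerivAt {f : ℂ → ℂ} {f' : ℂ → ℂ →L[ℝ] ℂ} {Ω : Set ℂ}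
    (hf : ∀ z ∈ Ω, HasFDerivAt f (f' z) z)
    (hb : ∀ Q ⊆ Ω, IsCompact Q → ∃ C : NNReal, ∀ z ∈ Q, ‖f' z‖₊ ≤ C) : IsACL f Ω := by
  intro a b c d hab hcd hQ
  have hQc : IsCompact (Icc a b ×ℂ Icc c d) := isCompact_Icc.reProdIm isCompact_Icc
  obtain ⟨C, hC⟩ := hb _ hQ hQc
  have hconv : Convex ℝ (Icc a b ×ℂ Icc c d) := by
    exact ((convex_Icc a b).linear_preimage Complex.reLm).inter
      ((convex_Icc c d).linear_preimage Complex.imLm)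
  have hlip : LipschitzOnWith C f (Icc a b ×ℂ Icc c d) :=
    hconv.lipschitzOnWith_of_nnnorm_hasFDerivWithin_le
      (fun z hz => (hf z (hQ hz)).hasFDerivWithinAt) hC
  refine ⟨ae_of_all _ fun y hy => ?_, ae_of_all _ fun x hx => ?_⟩
  · refine LipschitzOnWith.absolutelyContinuousOnInterval (K := C) ?_
    rw [uIcc_of_le hab]
    intro s hs t ht
    exact (hlip (x := ⟨s, y⟩) ⟨hs, hy⟩ (y := ⟨t, y⟩) ⟨ht, hy⟩).trans_eq
      (congrArg _ (Complex.edist_of_im_eq rfl))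
  · refine LipschitzOnWith.absolutelyContinuousOnInterval (K := C) ?_
    rw [uIcc_of_le hcd]
    intro s hs t ht
    exact (hlip (x := ⟨x, s⟩) ⟨hx, hs⟩ (y := ⟨x, t⟩) ⟨hx, ht⟩).trans_eq
      (congrArg _ (Complex.edist_of_re_eq rfl))

lemma memLp_two_of_continuousOn {F : ℂ → ℂ} {Q : Set ℂ} (hF : ContinuousOn F Q)
    (hQ : IsCompact Q) : MemLp F 2 (volume.restrict Q) := by
  obtain ⟨C, hC⟩ := hQ.exists_bound_of_continuousOn hF
  have : IsFiniteMeasure (volume.restrict Q) := ⟨by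
    rw [Measure.restrict_apply_univ]; exact hQ.measure_lt_top⟩
  exact MemLp.of_bound (hF.aestronglyMeasurable hQ.measurableSet) C
    (ae_restrict_of_forall_mem hQ.measurableSet hC)

/-- A pair whose dilatation is bounded pointwise gives a member of `S_H(K)`. -/
lemma UnivalentPair.mem_SHK {h g : ℂ → ℂ} {K : ℝ} (hp : UnivalentPair h g)
    (hK : ∀ z ∈ unitDisk, stretch h g z ^ 2 ≤ K * jac h g z) : hmap h g ∈ SHK K := by
  have dh := continuousOn_deriv hp.diff_h
  have dg := continuousOn_deriv hp.diff_g
  have hmeq : ∀ z ∈ unitDisk, hmap h g z = h z + conj (g z) := fun _ _ => rfl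
  refine ⟨hp.mem_SH, ⟨?_, fun Q hQ hQc => ⟨?_, ?_⟩⟩, ae_of_all _ fun z hz => ?_,
    ae_of_all _ fun z hz => ?_⟩
  · refine isACL_of_hasFDerivAt (fun z hz => hasFDerivAt_hmap hp.diff_h hp.diff_g hz)
      fun Q hQ hQc => ?_
    obtain ⟨C, hC⟩ := hQc.exists_bound_of_continuousOn (f := stretch h g)
      ((dh.norm.add dg.norm).mono hQ)
    refine ⟨C.toNNReal, fun z hz => ?_⟩
    rw [← NNReal.coe_le_coe, coe_nnnorm]
    refine le_trans ?_ (Real.le_coe_toNNReal C)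
    refine le_trans ?_ ((le_abs_self _).trans (hC z hz))
    exact ContinuousLinearMap.opNorm_le_bound _ (by unfold stretch; positivity)
      fun v => norm_wirtinger_apply_le _ _ v
  · refine memLp_two_of_continuousOn ?_ hQc
    refine ContinuousOn.congr (f := fun z => deriv h z + conj (deriv g z)) ?_
      fun z hz => partialX_eq hp.diff_h hp.diff_g hmeq (hQ hz)
    exact (dh.add (Complex.continuous_conj.comp_continuousOn dg)).mono hQ
  · refine memLp_two_of_continuousOn ?_ hQc
    refine ContinuousOn.congr
      (f := fun z => deriv h z * Complex.I + conj (deriv g z * Complex.I)) ?_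
      fun z hz => partialY_eq hp.diff_h hp.diff_g hmeq (hQ hz)
    exact ((dh.mul continuousOn_const).add
      (Complex.continuous_conj.comp_continuousOn (dg.mul continuousOn_const))).mono hQ
  · rw [jacobian_eq hp.diff_h hp.diff_g hmeq hz]
    exact (hp.jac_pos hz).le
  · rw [jacobian_eq hp.diff_h hp.diff_g hmeq hz, bigLambda_eq hp.diff_h hp.diff_g hmeq hz, add_zero]
    exact hK z hz

/-- The Koebe function `z / (1 - z)²`, whose Taylor coefficients are `n`. -/
noncomputable def koebe (z : ℂ) : ℂ := z / (1 - z) ^ 2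

lemma one_sub_ne_zero_of_mem_unitDisk {z : ℂ} (hz : z ∈ unitDisk) : 1 - z ≠ 0 := fun h => by
  rw [mem_unitDisk, ← sub_eq_zero.mp h, norm_one] at hz
  exact lt_irrefl _ hz

lemma hasDerivAt_koebe {z : ℂ} (hz : z ∈ unitDisk) :
    HasDerivAt koebe ((1 + z) / (1 - z) ^ 3) z := by
  have h1 := one_sub_ne_zero_of_mem_unitDisk hz
  have h2 : HasDerivAt (fun w : ℂ => (1 - w) ^ 2) (2 * (1 - z) * (-1)) z :=
    (((hasDerivAt_id z).const_sub 1).pow 2).congr_deriv (by simp)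
  refine ((hasDerivAt_id z).div h2 (pow_ne_zero 2 h1)).congr_deriv ?_
  simp only [id]
  field_simp
  ring

lemma deriv_koebe {z : ℂ} (hz : z ∈ unitDisk) : deriv koebe z = (1 + z) / (1 - z) ^ 3 :=
  (hasDerivAt_koebe hz).deriv

lemma deriv_deriv_koebe_zero : deriv (deriv koebe) 0 = 4 := by
  have he : deriv koebe =ᶠ[𝓝 0] fun z => (1 + z) / (1 - z) ^ 3 :=
    Filter.eventually_of_mem (isOpen_unitDisk.mem_nhds zero_mem_unitDisk) fun z => deriv_koebe
  have h1 : HasDerivAt (fun w : ℂ => 1 + w) 1 0 := (hasDerivAt_id 0).const_add 1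
  have h2 : HasDerivAt (fun w : ℂ => (1 - w) ^ 3) (-3) 0 :=
    (((hasDerivAt_id (0 : ℂ)).const_sub 1).pow 3).congr_deriv (by simp)
  rw [he.deriv_eq]
  refine ((h1.div h2 (by simp)).congr_deriv ?_).deriv
  norm_num

lemma univalentPair_koebe : UnivalentPair koebe 0 where
  diff_h := fun _ hz => (hasDerivAt_koebe hz).differentiableAt.differentiableWithinAt
  diff_g := differentiableOn_const 0
  inj := by
    intro z hz w hw hzw
    simp only [hmap, Pi.zero_apply, map_zero, add_zero, koebe] at hzw
    rw [div_eq_div_iff (pow_ne_zero 2 (one_sub_ne_zero_of_mem_unitDisk hz))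
      (pow_ne_zero 2 (one_sub_ne_zero_of_mem_unitDisk hw))] at hzw
    have h1 : (z - w) * (1 - z * w) = 0 := by linear_combination hzw
    have h2 : z * w ∈ unitDisk := by
      rw [mem_unitDisk] at *
      rw [norm_mul]
      nlinarith [norm_nonneg z, norm_nonneg w]
    exact sub_eq_zero.mp ((mul_eq_zero.mp h1).resolve_right (one_sub_ne_zero_of_mem_unitDisk h2))
  lt := fun z hz => by
    have h1 : deriv (0 : ℂ → ℂ) z = 0 := deriv_const z (0 : ℂ)
    have h2 : (1 : ℂ) + z ≠ 0 := by
      have := one_sub_ne_zero_of_mem_unitDisk (z := -z) (by rwa [mem_unitDisk, norm_neg,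
        ← mem_unitDisk])
      rwa [sub_neg_eq_add] at this
    rw [h1, norm_zero, norm_pos_iff, deriv_koebe hz]
    exact div_ne_zero h2 (pow_ne_zero 3 (one_sub_ne_zero_of_mem_unitDisk hz))
  h_zero := by simp [koebe]
  g_zero := rfl
  deriv_h_zero := by rw [deriv_koebe zero_mem_unitDisk]; simp

lemma hasTaylorCoeffs_koebe : HasTaylorCoeffs koebe (fun n => (n : ℂ)) := fun _ hz =>
  hasSum_coe_mul_geometric_of_norm_lt_one (mem_unitDisk.mp hz)

lemma koebe_mem_SHK_one : hmap koebe 0 ∈ SHK 1 :=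
  univalentPair_koebe.mem_SHK fun z _ => by
    have h1 : deriv (0 : ℂ → ℂ) z = 0 := deriv_const z (0 : ℂ)
    simp [stretch, jac, h1]

/-! ### The suprema of the second coefficients -/

/-- The co-analytic part of a member of `S_H(1)` vanishes, because `(|h'| + |g'|)² ≤ |h'|² - |g'|²`
forces `g' = 0`. -/
lemma eq_zero_of_mem_SHK_one {f h g : ℂ → ℂ} (hf : f ∈ SHK 1) (hd : IsNormalizedDecomp f h g) :
    ∀ z ∈ unitDisk, g z = 0 := by
  have h1 : ∀ z ∈ unitDisk, deriv g z = 0 := fun z hz => by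
    have := dilatation_le_of_mem_SHK hf hd z hz
    simp only [jac, one_mul] at this
    have h2 := norm_nonneg (deriv g z)
    have h3 := norm_nonneg (deriv h z)
    exact norm_eq_zero.mp (by nlinarith)
  intro z hz
  have hconv : Convex ℝ unitDisk := convex_ball 0 1
  have := hconv.norm_image_sub_le_of_norm_deriv_le (f := g) (C := 0)
    (fun w hw => hd.analytic_g.differentiableAt (isOpen_unitDisk.mem_nhds hw))
    (fun w hw => by rw [h1 w hw, norm_zero]) zero_mem_unitDisk hz
  simpa [hd.g_zero] using this

/-- The analytic part of a pair with vanishing co-analytic part is univalent. -/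
lemma UnivalentPair.analytic_part {h g : ℂ → ℂ} (hp : UnivalentPair h g)
    (hg : ∀ z ∈ unitDisk, g z = 0) : UnivalentPair h 0 where
  diff_h := hp.diff_h
  diff_g := differentiableOn_const 0
  inj := hp.inj.congr fun z hz => by simp [hmap, hg z hz]
  lt := fun z hz => by
    have h1 : deriv (0 : ℂ → ℂ) z = 0 := deriv_const z (0 : ℂ)
    rw [h1, norm_zero]
    exact (norm_nonneg _).trans_lt (hp.lt z hz)
  h_zero := hp.h_zero
  g_zero := rfl
  deriv_h_zero := hp.deriv_h_zero

lemma bddAbove_secondCoeffs : BddAbove (secondCoeffs SH) := by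
  refine ⟨64 * Real.exp (20 + 56 * Real.pi ^ 2) / 2, ?_⟩
  rintro _ ⟨f, hf, rfl⟩
  obtain ⟨h, g, hd⟩ := hf.1
  dsimp only
  rw [dz_dz_zero hd.analytic_h hd.analytic_g hd.eq_add_conj]
  have := (UnivalentPair.of_mem_SH hf hd).norm_deriv_deriv_le
  gcongr

lemma UnivalentPair.norm_deriv_deriv_le_secondCoeffSup {h g : ℂ → ℂ} (hp : UnivalentPair h g) :
    ‖deriv (deriv h) 0‖ ≤ 2 * secondCoeffSup SH := by
  have := le_csSup bddAbove_secondCoeffs ⟨hmap h g, hp.mem_SH, rfl⟩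
  dsimp only at this
  rw [dz_dz_zero (f := hmap h g) hp.diff_h hp.diff_g (fun _ _ => rfl)] at this
  unfold secondCoeffSup
  linarith

lemma two_le_secondCoeffSup : 2 ≤ secondCoeffSup SH := by
  have := univalentPair_koebe.norm_deriv_deriv_le_secondCoeffSup
  rw [deriv_deriv_koebe_zero] at this
  norm_num at this
  linarith

/-- The supremum over `S_H(1)` is attained by the Koebe function. -/
lemma secondCoeffSup_SHK_one : secondCoeffSup (SHK 1) = 2 := by
  refine IsGreatest.csSup_eq ⟨⟨hmap koebe 0, koebe_mem_SHK_one, ?_⟩, ?_⟩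
  · dsimp only
    rw [dz_dz_zero (f := hmap koebe 0) univalentPair_koebe.diff_h
      univalentPair_koebe.diff_g (fun _ _ => rfl),
      deriv_deriv_koebe_zero]
    norm_num
  · rintro _ ⟨f, hf, rfl⟩
    obtain ⟨h, g, hd⟩ := hf.1.1
    dsimp only
    rw [dz_dz_zero hd.analytic_h hd.analytic_g hd.eq_add_conj]
    have := ((UnivalentPair.of_mem_SH hf.1 hd).analytic_part
      (eq_zero_of_mem_SHK_one hf hd)).norm_deriv_deriv_le_four
    linarith

/-! ### Growth, integral means and coefficients -/

/-- Growth of a univalent harmonic mapping: the Koebe transform carries the bound on second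
coefficients from the origin to every point of the disk. -/
lemma UnivalentPair.norm_hmap_le_secondCoeffSup {h g : ℂ → ℂ} (hp : UnivalentPair h g) :
    ∀ z ∈ unitDisk, ‖hmap h g z‖ ≤
      2 ^ secondCoeffSup SH * (1 - ‖z‖) ^ (-secondCoeffSup SH) := by
  intro z hz
  refine hp.norm_hmap_le (by linarith [two_le_secondCoeffSup]) (fun a ha => ?_) hz
  obtain ⟨H, G, hHG, he, -⟩ := hp.koebeTransform ha
  rw [← he]
  exact hHG.norm_deriv_deriv_le_secondCoeffSup

/-- Growth of an analytic univalent function, with the exponent given by Bieberbach's theorem. -/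
lemma UnivalentPair.norm_hmap_le_of_eq_zero {h g : ℂ → ℂ} (hp : UnivalentPair h g)
    (hg : ∀ z ∈ unitDisk, g z = 0) :
    ∀ z ∈ unitDisk, ‖hmap h g z‖ ≤ 2 ^ (2 : ℝ) * (1 - ‖z‖) ^ (-(2 : ℝ)) := by
  intro z hz
  refine hp.norm_hmap_le (by norm_num) (fun a ha => ?_) hz
  obtain ⟨H, G, hHG, he, hG⟩ := hp.koebeTransform ha
  rw [← he]
  exact (hHG.analytic_part (hG hg)).norm_deriv_deriv_le_four.trans (by norm_num)

lemma integralMean_eq_meanPow {f h g : ℂ → ℂ} {p r : ℝ} (hr0 : 0 ≤ r) (hr : r < 1)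
    (hf : ∀ z ∈ unitDisk, f z = h z + conj (g z)) :
    integralMean p r f = (1 / (2 * Real.pi) * meanPow h g p r) ^ (1 / p) := by
  have : ∀ θ : ℝ, ‖f (r * Complex.exp (θ * Complex.I))‖ = ‖hmap h g (circ r θ)‖ := fun θ =>
    congrArg norm (hf _ (circ_mem_unitDisk hr0 hr))
  simp only [integralMean, meanPow, this]

lemma isBigO_integralMean {f h g : ℂ → ℂ} {p γ C : ℝ} (hp : 0 < p)
    (hf : ∀ z ∈ unitDisk, f z = h z + conj (g z))
    (hC : ∀ r, 1 / 2 ≤ r → r < 1 → meanPow h g p r ≤ C * (1 - r) ^ (-(γ * p - 1))) :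
    (fun r : ℝ => integralMean p r f) =O[𝓝[<] (1 : ℝ)]
      (fun r : ℝ => 1 / (1 - r) ^ (γ - 1 / p)) := by
  have hev : ∀ᶠ r in 𝓝[<] (1 : ℝ), r ∈ Ico (1 / 2 : ℝ) 1 := by
    have := Ioo_mem_nhdsLT (show (1 / 2 : ℝ) < 1 by norm_num)
    filter_upwards [this] with r hr using ⟨hr.1.le, hr.2⟩
  refine IsBigO.of_bound ((1 / (2 * Real.pi) * |C|) ^ (1 / p)) ?_
  filter_upwards [hev] with r hr
  have h1r : 0 < 1 - r := sub_pos.mpr hr.2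
  have hpi := Real.pi_pos
  have hm0 : 0 ≤ meanPow h g p r := by
    refine intervalIntegral.integral_nonneg (by positivity) fun θ _ => by positivity
  have h1 : meanPow h g p r ≤ |C| * (1 - r) ^ (-(γ * p - 1)) :=
    (hC r hr.1 hr.2).trans (by gcongr; exact le_abs_self C)
  rw [integralMean_eq_meanPow (by linarith [hr.1]) hr.2 hf, Real.norm_of_nonneg (by positivity),
    Real.norm_of_nonneg (by positivity)]
  calc (1 / (2 * Real.pi) * meanPow h g p r) ^ (1 / p)
      ≤ (1 / (2 * Real.pi) * |C| * (1 - r) ^ (-(γ * p - 1))) ^ (1 / p) := by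
        rw [mul_assoc]
        gcongr
    _ = (1 / (2 * Real.pi) * |C|) ^ (1 / p) * (1 / (1 - r) ^ (γ - 1 / p)) := by
        rw [Real.mul_rpow (by positivity) (by positivity), ← Real.rpow_mul h1r.le,
          one_div (_ ^ _), ← Real.rpow_neg h1r.le]
        congr 2
        field_simp

/-- Cauchy's estimate on the circle of radius `1 - 1 / n`, where `1 - r = 1 / n` and
`r^n ≥ 1/4`. -/
lemma norm_coeff_le_of_meanPow_one_le {h g : ℂ → ℂ} {a : ℕ → ℂ} {γ C : ℝ}
    (hp : UnivalentPair h g) (ha : HasTaylorCoeffs h a)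
    (hC : ∀ r, 1 / 2 ≤ r → r < 1 → meanPow h g 1 r ≤ C * (1 - r) ^ (-(γ * 1 - 1)))
    {n : ℕ} (hn : 2 ≤ n) : ‖a n‖ ≤ C * (n : ℝ) ^ (γ - 1) := by
  have hn' : (2 : ℝ) ≤ n := by exact_mod_cast hn
  have hn0 : (0 : ℝ) < n := by linarith
  have hinv : (n : ℝ)⁻¹ ≤ 1 / 2 := by
    rw [one_div]; exact inv_anti₀ two_pos hn'
  have hinv0 : 0 < (n : ℝ)⁻¹ := inv_pos.mpr hn0
  set r : ℝ := 1 - (n : ℝ)⁻¹ with hr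
  have h1 := norm_coeff_mul_pow_le hp.diff_h hp.diff_g ha (r := r) (by linarith) (by linarith)
    (n := n) (by omega)
  have h2 := hC r (by linarith) (by linarith)
  simp only [meanPow, Real.rpow_one] at h2
  have h3 : (1 - r) ^ (-(γ * 1 - 1)) = (n : ℝ) ^ (γ - 1) := by
    rw [hr, sub_sub_cancel, Real.inv_rpow hn0.le, ← Real.rpow_neg hn0.le]
    ring_nf
  rw [h3] at h2
  -- `(1 - 1 / n)^{n / 2} ≥ 1 / 2` by Bernoulli's inequality
  have h4 : 1 / 4 ≤ r ^ n := by
    have h5 := one_add_mul_self_le_rpow_one_add (s := -(n : ℝ)⁻¹) (p := n / 2)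
      (by linarith) (by linarith)
    have h6 : 1 + (n : ℝ) / 2 * -(n : ℝ)⁻¹ = 1 / 2 := by field_simp; norm_num
    rw [h6, ← sub_eq_add_neg, ← hr] at h5
    have h7 : r ^ n = (r ^ ((n : ℝ) / 2)) ^ 2 := by
      rw [← Real.rpow_natCast, ← Real.rpow_natCast, ← Real.rpow_mul (by linarith)]
      congr 1
      push_cast
      ring
    rw [h7]
    nlinarith
  have h5 : ‖a n‖ * (1 / 4) ≤ ‖a n‖ * r ^ n := by gcongr
  have h6 := Real.pi_gt_three
  have h7 : 2 * 3 * (‖a n‖ * (1 / 4)) ≤ 2 * Real.pi * (‖a n‖ * r ^ n) := by gcongr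
  have h8 := norm_nonneg (a n)
  linarith

end HarmonicQR

theorem mainTheorem2 :
    -- `γ` is a finite supremum
    (HarmonicQR.secondCoeffs HarmonicQR.SH).Nonempty ∧
    BddAbove (HarmonicQR.secondCoeffs HarmonicQR.SH) ∧
    -- growth of the integral means and of the coefficients, for every `K ≥ 1`
    (∀ K : ℝ, 1 ≤ K →
      (∀ f ∈ HarmonicQR.SHK K, ∀ p : ℝ,
        1 / HarmonicQR.secondCoeffSup HarmonicQR.SH < p →
        (fun r : ℝ => HarmonicQR.integralMean p r f) =O[𝓝[<] (1 : ℝ)]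
          (fun r : ℝ =>
            1 / (1 - r) ^ (HarmonicQR.secondCoeffSup HarmonicQR.SH - 1 / p))) ∧
      (∃ C : ℝ, ∀ f ∈ HarmonicQR.SHK K, ∀ (h g : ℂ → ℂ) (a : ℕ → ℂ),
        HarmonicQR.IsNormalizedDecomp f h g → HarmonicQR.HasTaylorCoeffs h a →
        ∀ n : ℕ, 2 ≤ n →
          ‖a n‖ ≤ C * (n : ℝ) ^ (HarmonicQR.secondCoeffSup HarmonicQR.SH - 1))) ∧
    -- for `K = 1`, with the supremum over `S_H(1)`, the coefficient exponent is attained ...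
    (∃ C : ℝ, ∀ f ∈ HarmonicQR.SHK 1, ∀ (h g : ℂ → ℂ) (a : ℕ → ℂ),
      HarmonicQR.IsNormalizedDecomp f h g → HarmonicQR.HasTaylorCoeffs h a →
      ∀ n : ℕ, 2 ≤ n →
        ‖a n‖ ≤ C * (n : ℝ) ^ (HarmonicQR.secondCoeffSup (HarmonicQR.SHK 1) - 1)) ∧
    -- ... and cannot be lowered, even for a single mapping
    (∃ f ∈ HarmonicQR.SHK 1, ∃ (h g : ℂ → ℂ) (a : ℕ → ℂ),
      HarmonicQR.IsNormalizedDecomp f h g ∧ HarmonicQR.HasTaylorCoeffs h a ∧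
      ∀ α : ℝ, α < HarmonicQR.secondCoeffSup (HarmonicQR.SHK 1) - 1 →
        ¬ ∃ C : ℝ, ∀ n : ℕ, 2 ≤ n → ‖a n‖ ≤ C * (n : ℝ) ^ α) := by
  have hγ2 := HarmonicQR.two_le_secondCoeffSup
  set γ := HarmonicQR.secondCoeffSup HarmonicQR.SH with hγ
  refine ⟨⟨_, _, HarmonicQR.koebe_mem_SHK_one.1, rfl⟩, HarmonicQR.bddAbove_secondCoeffs,
    fun K hK => ⟨fun f hf p hp => ?_, ?_⟩, ?_,
    HarmonicQR.hmap HarmonicQR.koebe 0, HarmonicQR.koebe_mem_SHK_one, HarmonicQR.koebe, 0,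
    fun n => (n : ℂ), HarmonicQR.univalentPair_koebe.isNormalizedDecomp,
    HarmonicQR.hasTaylorCoeffs_koebe, ?_⟩
  · obtain ⟨h, g, hd⟩ := hf.1.1
    have hup := HarmonicQR.UnivalentPair.of_mem_SH hf.1 hd
    have hp0 : 0 < p := (by positivity : 0 < 1 / γ).trans hp
    have hγp : 1 < γ * p := by rwa [div_lt_iff₀' (by linarith)] at hp
    obtain ⟨C, hC⟩ := HarmonicQR.exists_meanPow_le (A := 2 ^ γ) (γ := γ) (p := p) (K := K)
      (by positivity) (by linarith) hγp (by linarith)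
    exact HarmonicQR.isBigO_integralMean hp0 hd.eq_add_conj
      (hC h g hup (HarmonicQR.dilatation_le_of_mem_SHK hf hd) hup.norm_hmap_le_secondCoeffSup)
  · -- `p = 1` is admissible because `γ ≥ 2`
    obtain ⟨C, hC⟩ := HarmonicQR.exists_meanPow_le (A := 2 ^ γ) (γ := γ) (p := 1) (K := K)
      (by positivity) (by linarith) (by linarith) (by linarith)
    refine ⟨C, fun f hf h g a hd ha n hn => ?_⟩
    have hup := HarmonicQR.UnivalentPair.of_mem_SH hf.1 hd
    exact HarmonicQR.norm_coeff_le_of_meanPow_one_le hup ha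
      (hC h g hup (HarmonicQR.dilatation_le_of_mem_SHK hf hd) hup.norm_hmap_le_secondCoeffSup) hn
  · rw [HarmonicQR.secondCoeffSup_SHK_one]
    obtain ⟨C, hC⟩ := HarmonicQR.exists_meanPow_le (A := 2 ^ (2 : ℝ)) (γ := 2) (p := 1) (K := 1)
      (by positivity) (by norm_num) (by norm_num) (by norm_num)
    refine ⟨C, fun f hf h g a hd ha n hn => ?_⟩
    have hup := HarmonicQR.UnivalentPair.of_mem_SH hf.1 hd
    exact HarmonicQR.norm_coeff_le_of_meanPow_one_le hup ha
      (hC h g hup (HarmonicQR.dilatation_le_of_mem_SHK hf hd)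
        (hup.norm_hmap_le_of_eq_zero (HarmonicQR.eq_zero_of_mem_SHK_one hf hd))) hn
  · rw [HarmonicQR.secondCoeffSup_SHK_one]
    rintro α hα ⟨C, hC⟩
    -- `n ≤ C n^α` for all `n ≥ 2` would bound the unbounded sequence `n^(1 - α)`
    have htop : Tendsto (fun n : ℕ => (n : ℝ) ^ (1 - α)) atTop atTop :=
      (tendsto_rpow_atTop (by linarith)).comp tendsto_natCast_atTop_atTop
    obtain ⟨n, hn, hn2⟩ := ((htop.eventually_gt_atTop C).and (eventually_ge_atTop 2)).exists
    have hn0 : (0 : ℝ) < n := by exact_mod_cast (by omega : 0 < n)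
    have h1 := hC n hn2
    rw [Complex.norm_natCast] at h1
    have h2 : (n : ℝ) ^ (1 - α) * (n : ℝ) ^ α = n := by
      rw [← Real.rpow_add hn0, sub_add_cancel, Real.rpow_one]
    have h3 := mul_lt_mul_of_pos_right hn (Real.rpow_pos_of_pos hn0 α)
    linarith
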